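/- **Setting.** Let $d\ge 2$, $0<\delta<1$, $\sigma>0$, $c_0>0$, $\theta\in\mathbb R^d$. In round $t=1,2,\dots$ the principal commits to a policy $\pi_t:\mathbb R^d\to\{0,1\}$ that depends on past observations. An agent with hidden context $x_t$ reports $x_t'$, a maximizer of $\pi_t$ over $\{y:\|y-x_t\|_2\le\delta\}$ that has the least distance to $x_t$ among all maximizers. The principal plays $a_t=\pi_t(x_t')$ and observes $x_t'$, together with $r_t(1)=\langle\theta,x_t\rangle+\epsilon_t$ if and only if $a_t=1$; the reward of action $0$ is $r_t(0)=0$. The $x_t$ are i.i.d. on the unit sphere of $\mathbb R^d$, with a density with respect to the uniform distribution that is at least $c_0$; the $\epsilon_t$ are i.i.d., of mean zero, sub-Gaussian with variance proxy $\sigma^2$, and independent of the contexts. The strategic regret is $\mathrm{Reg}(T)=\sum_{t\le T} r_t(\pi^*(x_t))-\sum_{t\le T} r_t(a_t)$, where $\pi^*(x)=\mathbf 1\{\langle\theta,x\rangle\ge 0\}$. **Algorithms.** The least squares estimate of a data set of pairs $(x,r)$ is $(\sum xx^\top)^{-1}\sum r\,x$ (set to $0$ if $\sum xx^\top$ is singular).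 * *SA-OLS*: play action $1$ in the first $d$ rounds and put these rounds $(x_t',r_t(1))$ in the data set. In every later round, with $\hat\theta_t$ the least squares estimate of the current data set, play $1$ iff $\langle\hat\theta_t,x_t'\rangle\ge\delta\|\hat\theta_t\|_2$, and add $(x_t',r_t(1))$ to the data set iff the inequality is strict. * *Explore-then-commit* with horizon $T$ and failure probability $\gamma$: play action $1$ in the first $\lceil T_0\rceil$ rounds, where $T_0=4\cdot 63^{1/3}\sigma^{2/3}\,d\,T^{2/3}\log^{1/3}(4d/\gamma)$; let $\hat\theta$ be the least squares estimate from these rounds; afterwards play $1$ iff $\langle\hat\theta,x_t'\rangle\ge\delta\|\hat\theta\|_2$. * *Combined algorithm* with switching time $\tau^*$: for $i=1,2,\dots$ put $\tau_i=2^i$; as long as $\sum_{j\le i}\tau_j<\tau^*$, run a fresh copy of explore-then-commit with horizon $\tau_i$ and failure probability $1/\tau_i^2$ for $\tau_i$ rounds; at the first $i$ for which this fails, switch to a fresh copy of SA-OLS for all remaining rounds. Let $\mathrm{Reg}_{\mathrm{OLS}}(T)$ be the strategic regret of SA-OLS over $T$ rounds, $\mathrm{Reg}_{\mathrm{ETC}}(T)$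 that of explore-then-commit with horizon $T$ and failure probability $1/T^2$, and $\mathrm{Reg}(T)$ that of the combined algorithm with $\tau^*=g(d,\delta)$. **Theorem.** There is a function $g$ of $d$ and $\delta$ alone (not of $c_0$, $\sigma$, $\theta$, $T$ or the distributions) such that the following two statements hold. 1. (Best of both guarantees.) For all $d,\delta,\sigma,c_0,\theta$ and all distributions as above, every $T\ge 1$ and every $M\in\mathbb R$: if $$\mathbb E[\mathrm{Reg}_{\mathrm{OLS}}(t)]\le M\,\frac{d^{5/2}}{(1-\delta)^{d/2}}\sqrt t\quad\text{and}\quad \mathbb E[\mathrm{Reg}_{\mathrm{ETC}}(t)]\le M\,d\,t^{2/3}\qquad\text{for all integers } 1\le t\le 2T,$$ then $$\mathbb E[\mathrm{Reg}(T)]\le 4\min\Big\{M\,\frac{d^{5/2}}{(1-\delta)^{d/2}}\sqrt T,\ M\,d\,T^{2/3}\Big\}.$$ 2. (Rates.) For all $c_0,\sigma>0$ and $B$ there are constants $C$ and $k$, depending only on $c_0,\sigma,B$, such that for all $d\ge2$, $\delta\in(0,1)$, all $\theta$ with $\|\theta\|_2\le B$, all distributions as above and all $T\ge1$, the three regrets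 are integrable and $$\mathbb E[\mathrm{Reg}_{\mathrm{OLS}}(T)]\le C(1+\log(dT))^k\,\frac{d^{5/2}}{(1-\delta)^{d/2}}\sqrt T,\qquad \mathbb E[\mathrm{Reg}_{\mathrm{ETC}}(T)]\le C(1+\log(dT))^k\,d\,T^{2/3},$$ $$\mathbb E[\mathrm{Reg}(T)]\le C(1+\log(dT))^k\,\min\Big\{\frac{d^{5/2}}{(1-\delta)^{d/2}}\sqrt T,\ d\,T^{2/3}\Big\}.$$ -/

import Mathlib

open MeasureTheory ProbabilityTheory

noncomputable section

/-- The space of contexts, `ℝᵈ` with its Euclidean norm. -/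
abbrev Ctx (d : ℕ) : Type := EuclideanSpace ℝ (Fin d)

/-- A policy assigns to each reported context a decision: `true` is action `1` (accept), `false` is
action `0` (reject). -/
abbrev Policy (d : ℕ) : Type := Ctx d → Bool

/-- The linear threshold policy: accept `x` if and only if `⟨β, x⟩ ≥ c`. -/
def linPolicy {d : ℕ} (β : Ctx d) (c : ℝ) : Policy d := fun x => decide (c ≤ inner ℝ β x)

/-- The policy that always takes action `1`. -/
def acceptAll (d : ℕ) : Policy d := fun _ => true

/-- `x'` is a best response of an agent with context `x` and effort budget `δ` to the policy `π`:
it maximizes the decision `π` over all contexts at distance at most `δ` from `x` and, among all such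
maximizers, it requires the least effort (lazy tiebreaking). -/
structure IsBestResponse {d : ℕ} (δ : ℝ) (π : Policy d) (x x' : Ctx d) : Prop where
  feasible : ‖x' - x‖ ≤ δ
  maximal : ∀ y, ‖y - x‖ ≤ δ → π y ≤ π x'
  lazy : ∀ y, ‖y - x‖ ≤ δ → (∀ z, ‖z - x‖ ≤ δ → π z ≤ π y) → ‖x' - x‖ ≤ ‖y - x‖

theorem existsUnique_isBestResponse_acceptAll {d : ℕ} {δ : ℝ} (hδ : 0 ≤ δ) (x : Ctx d) :
    ∃! x', IsBestResponse δ (acceptAll d) x x' := by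
  refine ⟨x, ⟨by simpa using hδ, fun y _ => le_rfl, fun y _ _ => by simp⟩, ?_⟩
  intro y hy
  have h := hy.lazy x (by simpa using hδ) (fun z _ => le_rfl)
  rw [sub_self, norm_zero] at h
  exact sub_eq_zero.1 (norm_le_zero_iff.1 h)

theorem existsUnique_isBestResponse_linPolicy {d : ℕ} {δ : ℝ} (hδ : 0 ≤ δ) (β : Ctx d) (c : ℝ)
    (x : Ctx d) : ∃! x', IsBestResponse δ (linPolicy β c) x x' := by
  have hx : ‖x - x‖ ≤ δ := by simpa using hδ
  by_cases hne : ∃ y, ‖y - x‖ ≤ δ ∧ linPolicy β c y = true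
  · obtain ⟨y₀, hy₀, hc₀⟩ := hne
    have hS : IsCompact (Metric.closedBall x δ ∩ {y | c ≤ inner ℝ β y}) :=
      (isCompact_closedBall x δ).inter_right
        (isClosed_le continuous_const (continuous_const.inner continuous_id))
    have hmem : ∀ y, y ∈ Metric.closedBall x δ ∩ {y | c ≤ inner ℝ β y} ↔
        ‖y - x‖ ≤ δ ∧ linPolicy β c y = true := by
      intro y
      simp [linPolicy, dist_eq_norm]
    obtain ⟨m, hm, hmin⟩ := hS.exists_isMinOn (f := fun y => ‖y - x‖)
      ⟨y₀, (hmem y₀).2 ⟨hy₀, hc₀⟩⟩ (by fun_prop)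
    have hm' := (hmem m).1 hm
    have hbest : ∀ w, (∀ z, ‖z - x‖ ≤ δ → linPolicy β c z ≤ linPolicy β c w) →
        linPolicy β c w = true := by
      intro w hw
      have h := hw y₀ hy₀
      rw [hc₀] at h
      exact Bool.eq_true_of_true_le h
    refine ⟨m, ⟨hm'.1, fun y _ => by rw [hm'.2]; exact Bool.le_true _, fun y hy hz =>
      hmin ((hmem y).2 ⟨hy, hbest y hz⟩)⟩, ?_⟩
    intro w hw
    have hw1 : ‖w - x‖ ≤ ‖m - x‖ :=
      hw.lazy m hm'.1 fun z _ => by rw [hm'.2]; exact Bool.le_true _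
    have hwS := (hmem w).2 ⟨hw.feasible, hbest w hw.maximal⟩
    by_contra hne'
    have hcv : Convex ℝ (Metric.closedBall x δ ∩ {y | c ≤ inner ℝ β y}) :=
      (convex_closedBall x δ).inter
        (convex_halfSpace_ge ⟨fun a b => inner_add_right β a b,
          fun r a => by rw [inner_smul_right, smul_eq_mul]⟩ c)
    have hmid := hmin (hcv hwS hm (by norm_num : (0 : ℝ) ≤ 1 / 2) (by norm_num : (0 : ℝ) ≤ 1 / 2)
      (by norm_num))
    have hlt := norm_combo_lt_of_ne hw1 le_rfl (fun h => hne' (sub_left_inj.1 h))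
      (by norm_num : (0 : ℝ) < 1 / 2) (by norm_num : (0 : ℝ) < 1 / 2) (by norm_num)
    have heq : ((1 / 2 : ℝ) • w + (1 / 2 : ℝ) • m) - x =
        (1 / 2 : ℝ) • (w - x) + (1 / 2 : ℝ) • (m - x) := by module
    have hmid' : ‖m - x‖ ≤ ‖((1 / 2 : ℝ) • w + (1 / 2 : ℝ) • m) - x‖ := hmid
    rw [heq] at hmid'
    exact absurd hlt (not_lt.2 hmid')
  · push Not at hne
    have hf : ∀ y, ‖y - x‖ ≤ δ → linPolicy β c y = false := fun y hy => by
      simpa using hne y hy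
    refine ⟨x, ⟨hx, fun y hy => by rw [hf y hy]; exact Bool.false_le _, fun y _ _ => by simp⟩, ?_⟩
    intro y hy
    have h := hy.lazy x hx (fun z hz => by rw [hf z hz]; exact Bool.false_le _)
    rw [sub_self, norm_zero] at h
    exact sub_eq_zero.1 (norm_le_zero_iff.1 h)

/-- The best response of an agent with context `x` to the policy `π`. All policies below are linear
threshold policies or constant; for these it exists and is unique
(`existsUnique_isBestResponse_linPolicy`, `existsUnique_isBestResponse_acceptAll`). -/
def bestResponse {d : ℕ} (δ : ℝ) (π : Policy d) (x : Ctx d) : Ctx d :=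
  Classical.epsilon (IsBestResponse δ π x)

/-- What the principal sees in one round: the reported (possibly modified) context, and the reward
if the action was `1` (apple tasting feedback; `none` if the action was `0`). -/
structure Obs (d : ℕ) where
  ctx : Ctx d
  reward : Option ℝ

/-- An algorithm for the principal chooses the next policy from the past observations. Histories are
lists with the most recent observation first, so in round `t` the history has length `t - 1`. -/
abbrev Algo (d : ℕ) : Type := List (Obs d) → Policy d

/-- The reward for action `a` on an agent with unmodified context `x` and noise `e`; the known
constant reward for action `0` is normalized to `0`. -/
def rew {d : ℕ} (θ x : Ctx d) (e : ℝ) (a : Bool) : ℝ := if a then inner ℝ θ x + e else 0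

/-- The history after `t` rounds of `alg` against the unmodified contexts `x 0, x 1, …` with noise
`ε 0, ε 1, …` (round `t` of the game has index `t - 1`): the principal commits to a policy, the
agent best-responds, and the reward is observed if and only if the action is `1`. -/
def history {d : ℕ} (alg : Algo d) (δ : ℝ) (θ : Ctx d) (x : ℕ → Ctx d) (ε : ℕ → ℝ) :
    ℕ → List (Obs d)
  | 0 => []
  | t + 1 =>
    let h := history alg δ θ x ε t
    let x' := bestResponse δ (alg h) (x t)
    ⟨x', if alg h x' then some (rew θ (x t) (ε t) true) else none⟩ :: h

/-- The action played by `alg` in the round with index `t`. -/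
def action {d : ℕ} (alg : Algo d) (δ : ℝ) (θ : Ctx d) (x : ℕ → Ctx d) (ε : ℕ → ℝ) (t : ℕ) : Bool :=
  let π := alg (history alg δ θ x ε t)
  π (bestResponse δ π (x t))

/-- Strategic regret over `T` rounds, with respect to the optimal policy on truthful contexts, which
accepts `x` if and only if `⟨θ, x⟩ ≥ 0`. -/
def stratRegret {d : ℕ} (alg : Algo d) (δ : ℝ) (θ : Ctx d) (x : ℕ → Ctx d) (ε : ℕ → ℝ) (T : ℕ) : ℝ :=
  ∑ t ∈ Finset.range T, rew θ (x t) (ε t) (linPolicy θ 0 (x t)) -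
    ∑ t ∈ Finset.range T, rew θ (x t) (ε t) (action alg δ θ x ε t)

/-- The matrix `∑ x xᵀ` of a data set of pairs (context, reward). -/
def gram {d : ℕ} (D : List (Ctx d × ℝ)) : Matrix (Fin d) (Fin d) ℝ :=
  (D.map fun p : Ctx d × ℝ => Matrix.vecMulVec p.1.ofLp p.1.ofLp).sum

/-- The ordinary least squares estimate `(∑ x xᵀ)⁻¹ ∑ r x` (it is `0` if `∑ x xᵀ` is singular). -/
def ols {d : ℕ} (D : List (Ctx d × ℝ)) : Ctx d :=
  WithLp.toLp 2 (((gram D)⁻¹).mulVec ((D.map fun p : Ctx d × ℝ => p.2 • p.1).sum).ofLp)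

/-- The data set kept by strategy-aware OLS: all of the first `d` rounds, and afterwards the clean
rounds, those whose reported context lies strictly above the current shifted decision boundary. -/
def saOLSData {d : ℕ} (δ : ℝ) : List (Obs d) → List (Ctx d × ℝ)
  | [] => []
  | o :: past =>
    let D := saOLSData δ past
    match o.reward with
    | none => D
    | some r =>
      if past.length < d ∨ δ * ‖ols D‖ < inner ℝ (ols D) o.ctx then (o.ctx, r) :: D else D

/-- Strategy-aware OLS with apple tasting feedback: accept during the first `d` rounds, afterwards
play the least squares policy on the clean data, with the boundary shifted by `δ ‖θ̂‖`. -/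
def saOLS (d : ℕ) (δ : ℝ) : Algo d := fun h =>
  if h.length < d then acceptAll d
  else linPolicy (ols (saOLSData δ h)) (δ * ‖ols (saOLSData δ h)‖)

/-- The length of the exploration phase of explore-then-commit with horizon `T`, failure probability
`γ` and noise level `σ`:
`4 · 63^(1/3) · σ^(2/3) · d · T^(2/3) · log^(1/3)(4 d / γ)`, rounded up. -/
def exploreLength (d : ℕ) (σ T γ : ℝ) : ℕ :=
  ⌈4 * (63 : ℝ) ^ (1 / 3 : ℝ) * σ ^ (2 / 3 : ℝ) * d * T ^ (2 / 3 : ℝ) *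
    (Real.log (4 * d / γ)) ^ (1 / 3 : ℝ)⌉₊

/-- Explore-then-commit with horizon `T` and failure probability `γ`: accept in the exploration
rounds, then commit to the shifted least squares policy computed from these rounds. -/
def etc (d : ℕ) (δ σ T γ : ℝ) : Algo d := fun h =>
  let n := exploreLength d σ T γ
  let θhat := ols ((h.drop (h.length - n)).filterMap fun o => o.reward.map fun r => (o.ctx, r))
  if h.length < n then acceptAll d else linPolicy θhat (δ * ‖θhat‖)

/-- Explore-then-commit with horizon `T` and failure probability `1 / T²`. -/
def etcRun (d : ℕ) (δ σ : ℝ) (T : ℕ) : Algo d := etc d δ σ T (1 / (T : ℝ) ^ 2)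

/-- The total length `τ₁ + ⋯ + τᵢ` of the first `i` epochs, where `τⱼ = 2ʲ`. -/
def epochSum (i : ℕ) : ℕ := ∑ j ∈ Finset.Icc 1 i, 2 ^ j

/-- The number of explore-then-commit epochs that are run: one less than the first `i ≥ 1` for which
`τ₁ + ⋯ + τᵢ < τstar` fails. -/
def numEpochs (τstar : ℝ) : ℕ := sInf {i : ℕ | 1 ≤ i ∧ ¬ ((epochSum i : ℝ) < τstar)} - 1

/-- The epoch `i ≥ 1` that contains the round played after `n` rounds: the first `i` with
`n < τ₁ + ⋯ + τᵢ`. -/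
def epochOf (n : ℕ) : ℕ := sInf {i : ℕ | n < epochSum i}

/-- Strategy-aware classification with unknown time horizon: explore-then-commit, started afresh in
epochs `i = 1, 2, …` of length `τᵢ = 2ⁱ` with horizon `τᵢ` and failure probability `1 / τᵢ²`, as
long as `τ₁ + ⋯ + τᵢ < τstar`; then strategy-aware OLS, started afresh, for all remaining rounds. -/
def combined (d : ℕ) (δ σ τstar : ℝ) : Algo d := fun h =>
  let s := epochSum (numEpochs τstar)
  let i := epochOf h.length
  if h.length < s then etcRun d δ σ (2 ^ i) (h.take (h.length - epochSum (i - 1)))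
  else saOLS d δ (h.take (h.length - s))

/-- The uniform probability distribution on the unit sphere of `ℝᵈ`, as a measure on `ℝᵈ`. -/
def sphereUniform (d : ℕ) : Measure (Ctx d) :=
  (ProbabilityTheory.cond ((volume : Measure (Ctx d)).toSphere) Set.univ).map Subtype.val

/-- Stochastic environment. The contexts `x t` are i.i.d. on the unit sphere with a density that is
at least `c₀` times the uniform one; the noise `ε t` is i.i.d., of mean zero and sub-Gaussian with
variance proxy `σ²`; contexts and noise are independent. -/
structure IsStochasticEnv {Ω : Type*} [MeasurableSpace Ω] (P : Measure Ω) {d : ℕ} (c₀ : ℝ)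
    (σ : NNReal) (x : ℕ → Ω → Ctx d) (ε : ℕ → Ω → ℝ) : Prop where
  measurable_ctx : ∀ t, Measurable (x t)
  measurable_noise : ∀ t, Measurable (ε t)
  law_ctx : ∃ f : Ctx d → ℝ, Measurable f ∧ (∀ u, ‖u‖ = 1 → c₀ ≤ f u) ∧
    ∀ t, P.map (x t) = (sphereUniform d).withDensity fun u => ENNReal.ofReal (f u)
  identDistrib_noise : ∀ t, IdentDistrib (ε t) (ε 0) P P
  mean_noise : ∀ t, ∫ ω, ε t ω ∂P = 0
  subgaussian_noise : ∀ t, HasSubgaussianMGF (ε t) (σ ^ 2) P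
  indep_rounds : iIndepFun (fun t ω => (x t ω, ε t ω)) P
  indep_ctx_noise : ∀ t, IndepFun (x t) (ε t) P

/-- The expected strategic regret of `alg` over `T` rounds. -/
def expRegret {Ω : Type*} [MeasurableSpace Ω] (P : Measure Ω) {d : ℕ} (alg : Algo d) (δ : ℝ)
    (θ : Ctx d) (x : ℕ → Ω → Ctx d) (ε : ℕ → Ω → ℝ) (T : ℕ) : ℝ :=
  ∫ ω, stratRegret alg δ θ (fun t => x t ω) (fun t => ε t ω) T ∂P

/-- `d^(5/2) (1 - δ)^(-d/2) √T`. -/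
def rateOLS (d : ℕ) (δ : ℝ) (T : ℕ) : ℝ :=
  (d : ℝ) ^ (5 / 2 : ℝ) / (1 - δ) ^ ((d : ℝ) / 2) * √(T : ℝ)

/-- `d T^(2/3)`. -/
def rateETC (d : ℕ) (T : ℕ) : ℝ := d * (T : ℝ) ^ (2 / 3 : ℝ)

end

/-!
Why the theorem holds.

*Reduction to truthful agents.* Both subroutines shift the threshold of their policy by `δ ‖β‖`,
where `β` is the least squares estimate. Against agents with effort budget `δ` this accepts
exactly the agents whose true context `x` satisfies `0 ≤ ⟨β, x⟩` (`linPolicy_bestResponse`), and a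
report strictly beyond the threshold is truthful (`bestResponse_eq_self_of_lt`). So the recorded
data are truthful, and the play is that of a least squares learner which sees the contexts
themselves and records those that satisfy a rule depending on its estimate (`IsLeastSquaresAlgo`).
As the noise of a round is independent of its policy and context, the expected regret is the sum
over the rounds of `E[instRegret]`, a nonnegative quantity that is at most `‖β - θ‖`
(`IsStochasticEnv.integrable_stratRegret_and_expRegret_eq`).

*Rates.* Let `S = ∑ x xᵀ` be the Gram matrix of the recorded data, `V = S + 1`, and `Z = ∑ e x`
the recorded noise. If `tr V⁻¹ ≤ 1 / 2`, then `‖β - θ‖² ≤ 4 tr V⁻¹ · Zᵀ V⁻¹ Z`, and otherwise the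
trivial bound `‖θ‖` for the regret is good enough. Hence
`instRegret ≤ l tr V⁻¹ + (Zᵀ V⁻¹ Z + ‖θ‖²) / l` for every `l > 0`, without any exceptional event
(`instRegret_est_le`). Both quantities are compared with the potential
`log det V ≤ d log (d + t)`. In expectation `Zᵀ V⁻¹ Z` grows at most in proportion to the
potential, since the linear noise terms have mean zero
(`IsStochasticEnv.integral_dev_le`). If the law of the context, restricted to the contexts that
get recorded, has second moment at least `q` in every direction, then the sum of `E[tr V⁻¹]` over
the rounds is at most `2 d log (d + t) / q` (`IsStochasticEnv.mul_sum_integral_width_le`).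
Optimizing `l` gives a regret of order `d log (d T) √(T / q)` for strategy-aware OLS. For
explore-then-commit with `n` exploration rounds the same argument gives
`n + T d log (d T) / √(n q)`.

During exploration all contexts are recorded, and `q` is of order `c₀ / d`
(`le_lintegral_sphere_inner_sq`). Strategy-aware OLS records the contexts in a spherical cap of
height `δ`, for which `q` is of order `c₀ (1 - δ)ᵈ / d`: the cone over the cap contains a half
ball of radius `1 - δ` and, for `δ` near `1`, an ellipsoid with one semi-axis of constant length
and the others of order `√(1 - δ)` (`le_lintegral_cap_inner_sq`). A vanishing estimate would stop
the recording for good, but it almost surely never occurs when `θ ≠ 0`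
(`IsStochasticEnv.ae_est_ne_zero`), and when `θ = 0` there is no regret.

*Combination.* The law of the environment is invariant under shifts of time, so a fresh copy of a
subroutine has its original expected regret (`IsStochasticEnv.meanRegret_shift`), and the last,
unfinished epoch costs at most a full one. The explore-then-commit epochs form a geometric sum,
which stays below `14 / 5` times the rate at the current time. The switch happens, up to a factor
`2`, at `switchTime = d⁹ / (1 - δ)³ᵈ`, where the two rates cross: before it the rate of
explore-then-commit is the smaller one, and after it the cost of all epochs is at most
`14 / 5` times either rate, and the rate of strategy-aware OLS is at most `9 / 8` times that of
explore-then-commit (`IsStochasticEnv.expRegret_combined_le`).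
-/

noncomputable section

/-! ### Rank-one updates of positive definite matrices -/

section RankOne

open Matrix

variable {n : Type*} [Fintype n]

theorem posSemidef_vecMulVec_self_real (x : n → ℝ) : (vecMulVec x x).PosSemidef := by
  simpa using posSemidef_vecMulVec_self_star x

theorem dotProduct_transpose_mul_self_mulVec (N : Matrix n n ℝ) (v : n → ℝ) :
    v ⬝ᵥ (Nᵀ * N) *ᵥ v = ∑ i, (N i ⬝ᵥ v) ^ 2 := by
  rw [← mulVec_mulVec, dotProduct_mulVec, vecMul_transpose]
  simp [dotProduct, mulVec, sq]

theorem trace_transpose_mul_self (N : Matrix n n ℝ) : (Nᵀ * N).trace = ∑ i, N i ⬝ᵥ N i := by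
  simp only [trace, diag, mul_apply, transpose_apply, dotProduct]
  exact Finset.sum_comm

variable [DecidableEq n]

theorem dotProduct_inv_mulVec_comm {V : Matrix n n ℝ} (hV : V.PosDef) (x y : n → ℝ) :
    x ⬝ᵥ V⁻¹ *ᵥ y = (V⁻¹ *ᵥ x) ⬝ᵥ y := by
  have hT : (V⁻¹)ᵀ = V⁻¹ := by
    have := hV.inv.isHermitian.eq
    rwa [conjTranspose_eq_transpose_of_trivial] at this
  rw [dotProduct_mulVec, ← mulVec_transpose, hT]

theorem quadForm_inv_nonneg {V : Matrix n n ℝ} (hV : V.PosDef) (x : n → ℝ) :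
    0 ≤ x ⬝ᵥ V⁻¹ *ᵥ x := by
  simpa using hV.inv.posSemidef.dotProduct_mulVec_nonneg x

/-- The **Sherman–Morrison formula** for a symmetric update. -/
theorem inv_add_vecMulVec_self {V : Matrix n n ℝ} (hV : V.PosDef) (x : n → ℝ) :
    (V + vecMulVec x x)⁻¹ =
      V⁻¹ - (1 + x ⬝ᵥ V⁻¹ *ᵥ x)⁻¹ • vecMulVec (V⁻¹ *ᵥ x) (V⁻¹ *ᵥ x) := by
  have hu := quadForm_inv_nonneg hV x
  have hdet : IsUnit V.det := hV.det_pos.ne'.isUnit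
  apply Matrix.inv_eq_right_inv
  have h1 : vecMulVec x x * V⁻¹ = vecMulVec x (V⁻¹ *ᵥ x) := by
    have hT : (V⁻¹)ᵀ = V⁻¹ := by
      have := hV.inv.isHermitian.eq
      rwa [conjTranspose_eq_transpose_of_trivial] at this
    rw [vecMulVec_mul, ← mulVec_transpose, hT]
  have h2 : V * vecMulVec (V⁻¹ *ᵥ x) (V⁻¹ *ᵥ x) = vecMulVec x (V⁻¹ *ᵥ x) := by
    rw [mul_vecMulVec, mulVec_mulVec, mul_nonsing_inv _ hdet, one_mulVec]
  have h3 : vecMulVec x x * vecMulVec (V⁻¹ *ᵥ x) (V⁻¹ *ᵥ x)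
      = (x ⬝ᵥ V⁻¹ *ᵥ x) • vecMulVec x (V⁻¹ *ᵥ x) := by
    rw [vecMulVec_mul_vecMulVec]
    ext i j
    simp [vecMulVec_apply]
    ring
  rw [add_mul, mul_sub, mul_sub, mul_nonsing_inv _ hdet, h1, Matrix.mul_smul, Matrix.mul_smul, h2,
    h3]
  have h4 : (1 + x ⬝ᵥ V⁻¹ *ᵥ x)⁻¹ + (1 + x ⬝ᵥ V⁻¹ *ᵥ x)⁻¹ * (x ⬝ᵥ V⁻¹ *ᵥ x) = 1 := by
    field_simp
  rw [smul_smul]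
  have h5 : vecMulVec x (V⁻¹ *ᵥ x) = (1 + x ⬝ᵥ V⁻¹ *ᵥ x)⁻¹ • vecMulVec x (V⁻¹ *ᵥ x) +
      ((1 + x ⬝ᵥ V⁻¹ *ᵥ x)⁻¹ * (x ⬝ᵥ V⁻¹ *ᵥ x)) • vecMulVec x (V⁻¹ *ᵥ x) := by
    rw [← add_smul, h4, one_smul]
  nth_rewrite 2 [h5]
  abel

theorem quadForm_inv_add_vecMulVec {V : Matrix n n ℝ} (hV : V.PosDef) (x y z : n → ℝ) :
    y ⬝ᵥ (V + vecMulVec x x)⁻¹ *ᵥ z =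
      y ⬝ᵥ V⁻¹ *ᵥ z - (y ⬝ᵥ V⁻¹ *ᵥ x) * (x ⬝ᵥ V⁻¹ *ᵥ z) / (1 + x ⬝ᵥ V⁻¹ *ᵥ x) := by
  rw [inv_add_vecMulVec_self hV, sub_mulVec, dotProduct_sub, smul_mulVec, dotProduct_smul,
    vecMulVec_mulVec, dotProduct_inv_mulVec_comm hV x z]
  simp only [op_smul_eq_smul, dotProduct_smul, smul_eq_mul]
  ring

theorem trace_inv_add_vecMulVec_le {V : Matrix n n ℝ} (hV : V.PosDef) (x : n → ℝ) :
    (V + vecMulVec x x)⁻¹.trace ≤ V⁻¹.trace := by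
  have hu := quadForm_inv_nonneg hV x
  rw [inv_add_vecMulVec_self hV, trace_sub, trace_smul, trace_vecMulVec, smul_eq_mul]
  have : 0 ≤ (V⁻¹ *ᵥ x) ⬝ᵥ (V⁻¹ *ᵥ x) := by
    simpa using dotProduct_star_self_nonneg (V⁻¹ *ᵥ x)
  have : 0 ≤ (1 + x ⬝ᵥ V⁻¹ *ᵥ x)⁻¹ * ((V⁻¹ *ᵥ x) ⬝ᵥ (V⁻¹ *ᵥ x)) := by positivity
  linarith

/-- The **matrix determinant lemma** for a symmetric update. -/
theorem det_add_vecMulVec_self {V : Matrix n n ℝ} (hV : V.PosDef) (x : n → ℝ) :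
    (V + vecMulVec x x).det = V.det * (1 + x ⬝ᵥ V⁻¹ *ᵥ x) := by
  rw [vecMulVec_eq Unit, det_add_replicateCol_mul_replicateRow hV.det_pos.ne'.isUnit,
    det_unique (n := Unit)]
  congr 1
  simp [Matrix.mul_assoc, Matrix.mul_apply, dotProduct, mulVec, Finset.mul_sum]

theorem exists_eq_transpose_mul_self {M : Matrix n n ℝ} (hM : M.PosSemidef) :
    ∃ N : Matrix n n ℝ, M = Nᵀ * N := by
  open scoped MatrixOrder in
  obtain ⟨N, hN⟩ := CStarAlgebra.nonneg_iff_eq_star_mul_self.mp hM.nonneg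
  exact ⟨N, by rw [hN, star_eq_conjTranspose, conjTranspose_eq_transpose_of_trivial]⟩

theorem dotProduct_mulVec_le_trace_mul {M : Matrix n n ℝ} (hM : M.PosSemidef) (v : n → ℝ) :
    v ⬝ᵥ M *ᵥ v ≤ M.trace * (v ⬝ᵥ v) := by
  obtain ⟨N, rfl⟩ := exists_eq_transpose_mul_self hM
  rw [dotProduct_transpose_mul_self_mulVec, trace_transpose_mul_self, Finset.sum_mul]
  refine Finset.sum_le_sum fun i _ => ?_
  have h := Finset.sum_mul_sq_le_sq_mul_sq Finset.univ (N i) v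
  simpa [dotProduct, sq] using h

/-- A positive semidefinite matrix dominates its square up to its trace. -/
theorem mulVec_dotProduct_self_le_trace_mul {M : Matrix n n ℝ} (hM : M.PosSemidef) (v : n → ℝ) :
    (M *ᵥ v) ⬝ᵥ (M *ᵥ v) ≤ M.trace * (v ⬝ᵥ M *ᵥ v) := by
  obtain ⟨N, rfl⟩ := exists_eq_transpose_mul_self hM
  rw [dotProduct_transpose_mul_self_mulVec, ← mulVec_mulVec, trace, Finset.sum_mul]
  refine Finset.sum_le_sum fun j _ => ?_
  have h := Finset.sum_mul_sq_le_sq_mul_sq Finset.univ (fun i => N i j) (N *ᵥ v)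
  simpa [dotProduct, sq, mulVec, Matrix.mul_apply] using h

theorem trace_nonneg_of_posSemidef {M : Matrix n n ℝ} (hM : M.PosSemidef) : 0 ≤ M.trace := by
  obtain ⟨N, rfl⟩ := exists_eq_transpose_mul_self hM
  rw [trace_transpose_mul_self]
  exact Finset.sum_nonneg fun i _ => by simpa using dotProduct_star_self_nonneg (N i)

theorem det_le_trace_pow {V : Matrix n n ℝ} (hV : V.PosSemidef) :
    V.det ≤ V.trace ^ Fintype.card n := by
  have h0 := fun i => hV.eigenvalues_nonneg i
  rw [hV.isHermitian.det_eq_prod_eigenvalues, hV.isHermitian.trace_eq_sum_eigenvalues]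
  simp only [RCLike.ofReal_real_eq_id, id_eq]
  calc _ ≤ ∏ _i : n, ∑ j, hV.isHermitian.eigenvalues j :=
        Finset.prod_le_prod (fun i _ => h0 i) fun i _ =>
          Finset.single_le_sum (fun j _ => h0 j) (Finset.mem_univ i)
    _ = _ := by simp

theorem posDef_add_one {m : Type*} [DecidableEq m] {S : Matrix m m ℝ} (hS : S.PosSemidef) :
    (S + 1).PosDef :=
  PosDef.one.posSemidef_add hS

theorem dotProduct_self_le_dotProduct_add_one {S : Matrix n n ℝ} (hS : S.PosSemidef) (y : n → ℝ) :
    y ⬝ᵥ y ≤ y ⬝ᵥ (S + 1) *ᵥ y := by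
  have : 0 ≤ y ⬝ᵥ S *ᵥ y := by simpa using hS.dotProduct_mulVec_nonneg y
  rw [add_mulVec, dotProduct_add, one_mulVec]
  linarith

theorem mulVec_inv_mulVec_add_one {S : Matrix n n ℝ} (hS : S.PosSemidef) (x : n → ℝ) :
    (S + 1) *ᵥ ((S + 1)⁻¹ *ᵥ x) = x := by
  rw [mulVec_mulVec, mul_nonsing_inv _ (posDef_add_one hS).det_pos.ne'.isUnit, one_mulVec]

theorem inv_mulVec_mulVec_add_one {S : Matrix n n ℝ} (hS : S.PosSemidef) (x : n → ℝ) :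
    (S + 1)⁻¹ *ᵥ ((S + 1) *ᵥ x) = x := by
  rw [mulVec_mulVec, nonsing_inv_mul _ (posDef_add_one hS).det_pos.ne'.isUnit, one_mulVec]

theorem quadForm_inv_add_one_le {S : Matrix n n ℝ} (hS : S.PosSemidef) (x : n → ℝ) :
    x ⬝ᵥ (S + 1)⁻¹ *ᵥ x ≤ x ⬝ᵥ x := by
  set y := (S + 1)⁻¹ *ᵥ x with hy
  have h1 : y ⬝ᵥ y ≤ x ⬝ᵥ y := by
    have h := dotProduct_self_le_dotProduct_add_one hS y
    rwa [hy, mulVec_inv_mulVec_add_one hS, ← hy, dotProduct_comm y x] at h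
  have h2 : 0 ≤ (x - y) ⬝ᵥ (x - y) := by simpa using dotProduct_star_self_nonneg (x - y)
  rw [sub_dotProduct, dotProduct_sub, dotProduct_sub, dotProduct_comm y x] at h2
  linarith

/-- If `(S + 1)⁻¹` has trace at most `1 / 2`, then `S` is invertible, and the solution of `S e = z`
is controlled by the quadratic form of `(S + 1)⁻¹` at `z`. -/
theorem isUnit_det_and_error_le {S : Matrix n n ℝ} (hS : S.PosSemidef)
    (ht : (S + 1)⁻¹.trace ≤ 1 / 2) :
    IsUnit S.det ∧ ∀ e z : n → ℝ, S *ᵥ e = z →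
      e ⬝ᵥ e ≤ 4 * ((S + 1)⁻¹.trace * (z ⬝ᵥ (S + 1)⁻¹ *ᵥ z)) := by
  have hV := posDef_add_one hS
  have key : ∀ e z : n → ℝ, S *ᵥ e = z →
      e ⬝ᵥ e ≤ 4 * ((S + 1)⁻¹.trace * (z ⬝ᵥ (S + 1)⁻¹ *ᵥ z)) := by
    intro e z h
    have hP := hV.inv.posSemidef
    -- `e = V⁻¹ z + V⁻¹ e` with `V = S + 1`, and `V⁻¹ e` is at most half as long as `e`.
    have he : e = (S + 1)⁻¹ *ᵥ z + (S + 1)⁻¹ *ᵥ e := by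
      rw [← mulVec_add, ← h]
      nth_rewrite 3 [← one_mulVec e]
      rw [← add_mulVec, inv_mulVec_mulVec_add_one hS]
    set a := (S + 1)⁻¹ *ᵥ z
    set b := (S + 1)⁻¹ *ᵥ e
    have h0 := trace_nonneg_of_posSemidef hP
    have h1 : a ⬝ᵥ a ≤ _ := mulVec_dotProduct_self_le_trace_mul hP z
    have h2 : b ⬝ᵥ b ≤ _ := mulVec_dotProduct_self_le_trace_mul hP e
    have h3 := dotProduct_mulVec_le_trace_mul hP e
    have hee : 0 ≤ e ⬝ᵥ e := by simpa using dotProduct_star_self_nonneg e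
    have h4 : b ⬝ᵥ b ≤ 1 / 4 * (e ⬝ᵥ e) := by
      calc b ⬝ᵥ b ≤ (S + 1)⁻¹.trace * ((S + 1)⁻¹.trace * (e ⬝ᵥ e)) :=
            h2.trans (mul_le_mul_of_nonneg_left h3 h0)
        _ ≤ 1 / 2 * (1 / 2 * (e ⬝ᵥ e)) := by gcongr
        _ = _ := by ring
    have h5 : 0 ≤ (a - b) ⬝ᵥ (a - b) := by simpa using dotProduct_star_self_nonneg (a - b)
    have h6 : e ⬝ᵥ e = a ⬝ᵥ a + 2 * (a ⬝ᵥ b) + b ⬝ᵥ b := by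
      nth_rewrite 1 2 [he]
      rw [add_dotProduct, dotProduct_add, dotProduct_add, dotProduct_comm b a]
      ring
    rw [sub_dotProduct, dotProduct_sub, dotProduct_sub, dotProduct_comm b a] at h5
    linarith
  refine ⟨?_, key⟩
  rw [isUnit_iff_ne_zero]
  intro h
  obtain ⟨v, hv, hv0⟩ := exists_mulVec_eq_zero_iff.2 h
  have := key v 0 hv0
  simp only [mulVec_zero, dotProduct_zero, mul_zero] at this
  have h7 : 0 ≤ v ⬝ᵥ v := by simpa using dotProduct_star_self_nonneg v
  exact hv (dotProduct_self_eq_zero.1 (le_antisymm this h7))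

end RankOne

/-! ### Best responses to shifted threshold policies -/

section BestResponse

variable {d : ℕ} {δ : ℝ}

theorem bestResponse_linPolicy_spec (hδ : 0 ≤ δ) (β : Ctx d) (c : ℝ) (x : Ctx d) :
    IsBestResponse δ (linPolicy β c) x (bestResponse δ (linPolicy β c) x) :=
  Classical.epsilon_spec (existsUnique_isBestResponse_linPolicy hδ β c x).exists

theorem bestResponse_acceptAll (hδ : 0 ≤ δ) (x : Ctx d) : bestResponse δ (acceptAll d) x = x := by
  have h : IsBestResponse δ (acceptAll d) x (bestResponse δ (acceptAll d) x) :=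
    Classical.epsilon_spec (existsUnique_isBestResponse_acceptAll hδ x).exists
  have h1 := h.lazy x (by simpa using hδ) fun z _ => le_rfl
  rw [sub_self, norm_zero] at h1
  exact sub_eq_zero.1 (norm_le_zero_iff.1 h1)

/-- Shifting the threshold by `δ ‖β‖` undoes the effect of strategic behaviour: an agent gets
accepted if and only if its unmodified context satisfies the unshifted test. -/
theorem linPolicy_bestResponse (hδ : 0 ≤ δ) (β x : Ctx d) :
    linPolicy β (δ * ‖β‖) (bestResponse δ (linPolicy β (δ * ‖β‖)) x) =
      decide (0 ≤ inner ℝ β x) := by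
  have hb := bestResponse_linPolicy_spec hδ β (δ * ‖β‖) x
  set x' := bestResponse δ (linPolicy β (δ * ‖β‖)) x
  by_cases h : 0 ≤ inner ℝ β x
  · have hy : ∃ y, ‖y - x‖ ≤ δ ∧ δ * ‖β‖ ≤ inner ℝ β y := by
      by_cases hβ : β = 0
      · exact ⟨x, by simpa using hδ, by simp [hβ]⟩
      · have hβ' : ‖β‖ ≠ 0 := norm_ne_zero_iff.2 hβ
        refine ⟨x + (δ / ‖β‖) • β, ?_, ?_⟩
        · rw [add_sub_cancel_left, norm_smul, Real.norm_eq_abs, abs_div, abs_norm,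
            div_mul_cancel₀ _ hβ', abs_of_nonneg hδ]
        · rw [inner_add_right, inner_smul_right, real_inner_self_eq_norm_sq]
          have : δ / ‖β‖ * ‖β‖ ^ 2 = δ * ‖β‖ := by field_simp
          linarith
    obtain ⟨y, hy1, hy2⟩ := hy
    have h1 := hb.maximal y hy1
    rw [show linPolicy β (δ * ‖β‖) y = true by simpa [linPolicy] using hy2] at h1
    rw [Bool.eq_true_of_true_le h1, eq_comm]
    simpa using h
  · have h2 : ¬ (δ * ‖β‖ ≤ inner ℝ β x') := by
      have h3 : inner ℝ β x' = inner ℝ β x + inner ℝ β (x' - x) := by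
        rw [← inner_add_right, add_sub_cancel]
      have h4 := (real_inner_le_norm β (x' - x)).trans
        (mul_le_mul_of_nonneg_left hb.feasible (norm_nonneg β))
      push Not at h ⊢
      rw [h3]
      linarith [mul_comm δ ‖β‖]
    simp [linPolicy, h, h2]

/-- A report strictly beyond the threshold is truthful, by lazy tiebreaking. -/
theorem lt_inner_bestResponse_iff (hδ : 0 ≤ δ) (β : Ctx d) (c : ℝ) (x : Ctx d) :
    c < inner ℝ β (bestResponse δ (linPolicy β c) x) ↔ c < inner ℝ β x := by
  have hb := bestResponse_linPolicy_spec hδ β c x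
  set x' := bestResponse δ (linPolicy β c) x
  have htriv : ∀ w, c ≤ inner ℝ β w → ∀ z, ‖z - x‖ ≤ δ → linPolicy β c z ≤ linPolicy β c w := by
    intro w hw z _
    rw [show linPolicy β c w = true by simpa [linPolicy] using hw]
    exact Bool.le_true _
  constructor
  · intro h
    by_contra! h1
    -- The point of the segment from `x` to `x'` on the boundary is accepted with less effort.
    set s : ℝ := (c - inner ℝ β x) / (inner ℝ β x' - inner ℝ β x)
    have hpos : 0 < inner ℝ β x' - inner ℝ β x := by linarith
    have hs0 : 0 ≤ s := div_nonneg (by linarith) hpos.le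
    have hs1 : s < 1 := (div_lt_one hpos).2 (by linarith)
    have hxx : 0 < ‖x' - x‖ := by
      rw [norm_pos_iff, sub_ne_zero]
      rintro h2
      rw [h2] at h
      linarith
    have hn : ‖(x + s • (x' - x)) - x‖ = s * ‖x' - x‖ := by
      rw [add_sub_cancel_left, norm_smul, Real.norm_eq_abs, abs_of_nonneg hs0]
    have hc : c ≤ inner ℝ β (x + s • (x' - x)) := by
      rw [inner_add_right, inner_smul_right, inner_sub_right, div_mul_cancel₀ _ hpos.ne']
      linarith
    have h3 := hb.lazy (x + s • (x' - x)) (by rw [hn]; nlinarith [hb.feasible]) (htriv _ hc)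
    rw [hn] at h3
    nlinarith
  · intro h
    have h1 := hb.lazy x (by simpa using hδ) (htriv x h.le)
    rw [sub_self, norm_zero] at h1
    rwa [sub_eq_zero.1 (norm_le_zero_iff.1 h1)]

theorem bestResponse_eq_self_of_lt (hδ : 0 ≤ δ) {β : Ctx d} {c : ℝ} {x : Ctx d}
    (h : c < inner ℝ β x) : bestResponse δ (linPolicy β c) x = x := by
  have hb := bestResponse_linPolicy_spec hδ β c x
  have h1 := hb.lazy x (by simpa using hδ) fun z _ => by
    rw [show linPolicy β c x = true by simpa [linPolicy] using h.le]
    exact Bool.le_true _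
  rw [sub_self, norm_zero] at h1
  exact sub_eq_zero.1 (norm_le_zero_iff.1 h1)

end BestResponse

/-! ### Sufficient statistics of the two algorithms -/

section Stats

open Matrix hiding gram

variable {d : ℕ}

/-- The sufficient statistics `(∑ x xᵀ, ∑ r x)` of a data set of pairs `(x, r)`. -/
abbrev Stats (d : ℕ) : Type := Matrix (Fin d) (Fin d) ℝ × Ctx d

/-- The least squares estimate as a function of the sufficient statistics. -/
def Stats.est (p : Stats d) : Ctx d := WithLp.toLp 2 (p.1⁻¹ *ᵥ p.2.ofLp)

/-- The sufficient statistics of a list of pairs. -/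
def statsOf (D : List (Ctx d × ℝ)) : Stats d :=
  (gram D, (D.map fun p : Ctx d × ℝ => p.2 • p.1).sum)

theorem ols_eq_est (D : List (Ctx d × ℝ)) : ols D = (statsOf D).est := rfl

/-- The statistics after adding the pair `(x, r)`. -/
def Stats.push (p : Stats d) (x : Ctx d) (r : ℝ) : Stats d :=
  (p.1 + vecMulVec x.ofLp x.ofLp, p.2 + r • x)

theorem statsOf_cons (x : Ctx d) (r : ℝ) (D : List (Ctx d × ℝ)) :
    statsOf ((x, r) :: D) = (statsOf D).push x r := by
  simp [statsOf, Stats.push, gram, add_comm]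

open Classical in
/-- The statistics after `t` rounds of a learner that records the unmodified context and the reward
of the round with index `s` if and only if `incl s β (x s)` holds, where `β` is its least squares
estimate at the start of that round. -/
def runStats (incl : ℕ → Ctx d → Ctx d → Prop) (θ : Ctx d) (x : ℕ → Ctx d) (ε : ℕ → ℝ) :
    ℕ → Stats d
  | 0 => (0, 0)
  | t + 1 =>
    let p := runStats incl θ x ε t
    if incl t p.est (x t) then p.push (x t) (inner ℝ θ (x t) + ε t) else p

/-- The direction of the policy in the round with index `t`: it is `0`, which accepts everybody,
during the first `m` rounds, and the least squares estimate afterwards. -/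
def runDir (incl : ℕ → Ctx d → Ctx d → Prop) (m : ℕ) (θ : Ctx d) (x : ℕ → Ctx d) (ε : ℕ → ℝ)
    (t : ℕ) : Ctx d :=
  if t < m then 0 else (runStats incl θ x ε t).est

/-- Strategy-aware OLS records the first `d` rounds and the clean rounds. -/
def saIncl (d : ℕ) (δ : ℝ) (t : ℕ) (β y : Ctx d) : Prop := t < d ∨ δ * ‖β‖ < inner ℝ β y

/-- Explore-then-commit records the exploration rounds. -/
def etcIncl (d n : ℕ) (t : ℕ) (_ _ : Ctx d) : Prop := t < n

/-- The actions of `alg` are those of a learner which records data according to `incl`, accepts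
everybody for `m` rounds, and from then on accepts exactly those agents whose unmodified context
has a nonnegative inner product with the least squares estimate. -/
def IsLeastSquaresAlgo (alg : Algo d) (δ : ℝ) (incl : ℕ → Ctx d → Ctx d → Prop) (m : ℕ) : Prop :=
  ∀ θ x ε t, action alg δ θ x ε t = decide (0 ≤ inner ℝ (runDir incl m θ x ε t) (x t))

theorem length_history (alg : Algo d) (δ : ℝ) (θ : Ctx d) (x : ℕ → Ctx d) (ε : ℕ → ℝ) (t : ℕ) :
    (history alg δ θ x ε t).length = t := by
  induction t with
  | zero => rfl
  | succ t ih => simp [history, ih]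

theorem statsOf_saOLSData {δ : ℝ} (hδ : 0 ≤ δ) (θ : Ctx d) (x : ℕ → Ctx d) (ε : ℕ → ℝ) (t : ℕ) :
    statsOf (saOLSData δ (history (saOLS d δ) δ θ x ε t)) = runStats (saIncl d δ) θ x ε t := by
  induction t with
  | zero => simp [history, saOLSData, statsOf, gram, runStats]
  | succ t ih =>
    set h := history (saOLS d δ) δ θ x ε t with hh
    have hlen : h.length = t := length_history ..
    have hest : ols (saOLSData δ h) = (runStats (saIncl d δ) θ x ε t).est := by
      rw [ols_eq_est, ih]
    by_cases htd : t < d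
    · have halg : saOLS d δ h = acceptAll d := by simp [saOLS, hlen, htd]
      simp only [history, ← hh, halg, bestResponse_acceptAll hδ, acceptAll, runStats, rew,
        saOLSData, hlen, htd, saIncl, true_or, if_true, statsOf_cons, ih]
    · have halg : saOLS d δ h = linPolicy (ols (saOLSData δ h)) (δ * ‖ols (saOLSData δ h)‖) := by
        simp [saOLS, hlen, htd]
      simp only [history, ← hh, halg, runStats, saOLSData, hlen, htd, saIncl, false_or,
        linPolicy_bestResponse hδ, lt_inner_bestResponse_iff hδ, ← hest]
      by_cases hc : δ * ‖ols (saOLSData δ h)‖ < inner ℝ (ols (saOLSData δ h)) (x t)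
      · have h0 : 0 ≤ inner ℝ (ols (saOLSData δ h)) (x t) :=
          (mul_nonneg hδ (norm_nonneg _)).trans hc.le
        simp only [h0, decide_true, if_true, hc, statsOf_cons, ih, rew,
          bestResponse_eq_self_of_lt hδ hc]
      · simp only [hc, if_false]
        by_cases h0 : 0 ≤ inner ℝ (ols (saOLSData δ h)) (x t)
        · simp only [h0, decide_true, if_true, ih]
        · simp only [h0, decide_false, Bool.false_eq_true, if_false, ih]

theorem isLeastSquaresAlgo_saOLS {δ : ℝ} (hδ : 0 ≤ δ) :
    IsLeastSquaresAlgo (saOLS d δ) δ (saIncl d δ) d := by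
  intro θ x ε t
  have hlen := length_history (saOLS d δ) δ θ x ε t
  have hest := statsOf_saOLSData hδ θ x ε t
  simp only [action]
  by_cases htd : t < d
  · rw [show saOLS d δ (history (saOLS d δ) δ θ x ε t) = acceptAll d by simp [saOLS, hlen, htd]]
    simp [acceptAll, runDir, htd]
  · rw [show saOLS d δ (history (saOLS d δ) δ θ x ε t) = linPolicy _ _ by
      simp only [saOLS, hlen, htd, if_false]; rfl, linPolicy_bestResponse hδ, ols_eq_est, hest]
    simp [runDir, htd]

theorem statsOf_etcData {δ : ℝ} (hδ : 0 ≤ δ) (σ T γ : ℝ) (θ : Ctx d) (x : ℕ → Ctx d) (ε : ℕ → ℝ)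
    (t : ℕ) :
    statsOf (((history (etc d δ σ T γ) δ θ x ε t).drop
      (t - exploreLength d σ T γ)).filterMap fun o => o.reward.map fun r => (o.ctx, r)) =
      runStats (etcIncl d (exploreLength d σ T γ)) θ x ε t := by
  set n := exploreLength d σ T γ with hn
  induction t with
  | zero => simp [history, statsOf, gram, runStats]
  | succ t ih =>
    set h := history (etc d δ σ T γ) δ θ x ε t with hh
    have hlen : h.length = t := length_history ..
    by_cases htn : t < n
    · have halg : etc d δ σ T γ h = acceptAll d := by simp [etc, hlen, htn, ← hn]
      rw [show t - n = 0 by omega, List.drop_zero] at ih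
      rw [show t + 1 - n = 0 by omega, List.drop_zero]
      simp only [history, ← hh, halg, bestResponse_acceptAll hδ, acceptAll, runStats, rew,
        etcIncl, htn, if_true, List.filterMap_cons, Option.map_some, statsOf_cons, ih]
    · rw [show t + 1 - n = (t - n) + 1 by omega]
      simp only [history, ← hh, List.drop_succ_cons, ih, runStats, etcIncl, htn, if_false]

theorem isLeastSquaresAlgo_etc {δ : ℝ} (hδ : 0 ≤ δ) (σ T γ : ℝ) :
    IsLeastSquaresAlgo (etc d δ σ T γ) δ (etcIncl d (exploreLength d σ T γ))
      (exploreLength d σ T γ) := by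
  intro θ x ε t
  have hlen := length_history (etc d δ σ T γ) δ θ x ε t
  have hest := statsOf_etcData hδ σ T γ θ x ε t
  simp only [action]
  by_cases htn : t < exploreLength d σ T γ
  · rw [show etc d δ σ T γ (history (etc d δ σ T γ) δ θ x ε t) = acceptAll d by
      simp [etc, hlen, htn]]
    simp [acceptAll, runDir, htn]
  · rw [show etc d δ σ T γ (history (etc d δ σ T γ) δ θ x ε t) = linPolicy _ _ by
      simp only [etc, hlen, htn, if_false]; rfl, linPolicy_bestResponse hδ, ols_eq_est, hest]
    simp [runDir, htn]

/-- If `alg` forgets its first `s` rounds and then follows `alg'`, its later actions are those of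
`alg'` in the shifted environment. -/
theorem action_eq_of_restart {alg alg' : Algo d} {s e : ℕ}
    (h : ∀ l : List (Obs d), s ≤ l.length → l.length < e → alg l = alg' (l.take (l.length - s)))
    (δ : ℝ) (θ : Ctx d) (x : ℕ → Ctx d) (ε : ℕ → ℝ) (t : ℕ) (ht : s + t < e) :
    action alg δ θ x ε (s + t) = action alg' δ θ (fun i => x (s + i)) (fun i => ε (s + i)) t := by
  have hlen := length_history alg δ θ x ε
  have key : ∀ t, s + t ≤ e → (history alg δ θ x ε (s + t)).take t =
      history alg' δ θ (fun i => x (s + i)) (fun i => ε (s + i)) t := by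
    intro t
    induction t with
    | zero => intro _; simp [history]
    | succ t ih =>
      intro ht
      have ih := ih (by omega)
      have h1 := h (history alg δ θ x ε (s + t)) (by rw [hlen]; omega) (by rw [hlen]; omega)
      rw [hlen, Nat.add_sub_cancel_left, ih] at h1
      rw [← add_assoc]
      simp only [history, List.take_succ_cons, ih, h1]
  have h1 := h (history alg δ θ x ε (s + t)) (by rw [hlen]; omega) (by rw [hlen]; omega)
  rw [hlen, Nat.add_sub_cancel_left, key t ht.le] at h1
  simp only [action, h1]

end Stats

/-! ### Second moments of balls and spherical caps -/

section Geometry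

open Metric
open scoped Pointwise

variable {d : ℕ}

/-- The radial projection of the uniform measure of the unit ball is the uniform distribution of the
sphere. -/
theorem sphereUniform_apply (hd : 0 < d) {A : Set (Ctx d)} (hA : MeasurableSet A) :
    sphereUniform d A = (volume (ball (0 : Ctx d) 1))⁻¹ *
      volume (ball (0 : Ctx d) 1 ∩ {y | y ≠ 0 ∧ ‖y‖⁻¹ • y ∈ A}) := by
  have : Nonempty (Fin d) := ⟨⟨0, hd⟩⟩
  have hdim : Module.finrank ℝ (Ctx d) = d := by simp
  have hset : Set.Ioo (0 : ℝ) 1 • (Subtype.val '' (Subtype.val ⁻¹' A : Set (sphere (0 : Ctx d) 1)))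
      = ball (0 : Ctx d) 1 ∩ {y | y ≠ 0 ∧ ‖y‖⁻¹ • y ∈ A} := by
    ext y
    simp only [Set.mem_smul, Set.mem_image, Set.mem_preimage, Set.mem_inter_iff, mem_ball_zero_iff,
      Set.mem_ofPred_eq]
    constructor
    · rintro ⟨r, ⟨hr0, hr1⟩, _, ⟨⟨u, hu⟩, huA, rfl⟩, rfl⟩
      have hu1 : ‖u‖ = 1 := by simpa using hu
      have hn : ‖r • u‖ = r := by rw [norm_smul, hu1, mul_one, Real.norm_of_nonneg hr0.le]
      refine ⟨by rw [hn]; exact hr1, ?_, ?_⟩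
      · rw [← norm_pos_iff, hn]
        exact hr0
      · rw [hn, smul_smul, inv_mul_cancel₀ hr0.ne', one_smul]
        exact huA
    · rintro ⟨h1, h0, hyA⟩
      have hn : 0 < ‖y‖ := norm_pos_iff.2 h0
      refine ⟨‖y‖, ⟨hn, h1⟩, ‖y‖⁻¹ • y, ⟨⟨‖y‖⁻¹ • y, ?_⟩, hyA, rfl⟩, ?_⟩
      · rw [mem_sphere_zero_iff_norm, norm_smul, norm_inv, norm_norm, inv_mul_cancel₀ hn.ne']
      · rw [smul_smul, mul_inv_cancel₀ hn.ne', one_smul]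
  have hd0 : (d : ENNReal) ≠ 0 := by exact_mod_cast hd.ne'
  rw [sphereUniform, Measure.map_apply measurable_subtype_coe hA, cond_apply MeasurableSet.univ,
    Set.univ_inter, Measure.toSphere_apply' _ (measurable_subtype_coe hA), hset,
    Measure.toSphere_apply_univ, hdim, ENNReal.mul_inv (Or.inl hd0) (Or.inl (by simp)),
    mul_assoc, mul_left_comm _ (d : ENNReal), ← mul_assoc, ENNReal.inv_mul_cancel hd0 (by simp),
    one_mul]

theorem measurable_normalize : Measurable fun y : Ctx d => ‖y‖⁻¹ • y := by fun_prop

theorem sphereUniform_eq_map (hd : 0 < d) :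
    sphereUniform d = (volume (ball (0 : Ctx d) 1))⁻¹ •
      (volume.restrict (ball (0 : Ctx d) 1)).map fun y => ‖y‖⁻¹ • y := by
  have : Nonempty (Fin d) := ⟨⟨0, hd⟩⟩
  ext A hA
  rw [sphereUniform_apply hd hA, Measure.smul_apply, smul_eq_mul,
    Measure.map_apply measurable_normalize hA,
    Measure.restrict_apply (measurable_normalize hA)]
  congr 1
  apply measure_congr
  have h0 : ∀ᵐ y : Ctx d, y ≠ 0 := by simp [ae_iff]
  filter_upwards [h0] with y hy
  apply propext
  change (y ∈ ball (0 : Ctx d) 1 ∧ y ≠ 0 ∧ ‖y‖⁻¹ • y ∈ A) ↔ (‖y‖⁻¹ • y ∈ A ∧ y ∈ ball (0 : Ctx d) 1)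
  tauto

theorem ae_sphereUniform_norm_eq_one : ∀ᵐ u ∂(sphereUniform d), ‖u‖ = 1 := by
  rw [sphereUniform]
  refine (ae_map_iff measurable_subtype_coe.aemeasurable ?_).2 (ae_of_all _ fun u => by simp)
  exact measurableSet_eq_fun measurable_norm measurable_const

theorem lintegral_sphereUniform (hd : 0 < d) {F : Ctx d → ENNReal} (hF : Measurable F) :
    ∫⁻ u, F u ∂(sphereUniform d) = (volume (ball (0 : Ctx d) 1))⁻¹ *
      ∫⁻ y in ball (0 : Ctx d) 1, F (‖y‖⁻¹ • y) := by
  rw [sphereUniform_eq_map hd, lintegral_smul_measure, lintegral_map hF measurable_normalize,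
    smul_eq_mul]

theorem measurable_ofReal_inner_sq {f : Ctx d → Ctx d} (hf : Continuous f) (v : Ctx d) :
    Measurable fun z => ENNReal.ofReal (inner ℝ v (f z) ^ 2) :=
  ((continuous_const.inner hf).pow 2).measurable.ennreal_ofReal

/-- By symmetry, the second moment of the ball in direction `v` depends only on the length of
`v`. -/
theorem lintegral_ball_inner_sq_congr {v w : Ctx d} (h : ‖v‖ = ‖w‖) :
    ∫⁻ z in ball (0 : Ctx d) 1, ENNReal.ofReal (inner ℝ v z ^ 2) =
      ∫⁻ z in ball (0 : Ctx d) 1, ENNReal.ofReal (inner ℝ w z ^ 2) := by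
  set R := (Submodule.span ℝ {v - w})ᗮ.reflection
  have hR : R v = w := Submodule.reflection_sub h
  have hpre : R ⁻¹' ball (0 : Ctx d) 1 = ball (0 : Ctx d) 1 := by
    ext z
    simp
  have hm := R.measurePreserving.setLIntegral_comp_preimage (s := ball (0 : Ctx d) 1)
    measurableSet_ball (f := fun z => ENNReal.ofReal (inner ℝ w z ^ 2)) (by fun_prop)
  rw [hpre] at hm
  rw [← hm]
  congr with z
  rw [← hR, R.inner_map_map]

theorem le_lintegral_ball_inner_sq (hd : 0 < d) (v : Ctx d) :
    ENNReal.ofReal (‖v‖ ^ 2 / (8 * d)) * volume (ball (0 : Ctx d) 1) ≤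
      ∫⁻ z in ball (0 : Ctx d) 1, ENNReal.ofReal (inner ℝ v z ^ 2) := by
  have : Nonempty (Fin d) := ⟨⟨0, hd⟩⟩
  have hd' : (0 : ℝ) < d := by exact_mod_cast hd
  set I := ∫⁻ z in ball (0 : Ctx d) 1, ENNReal.ofReal (inner ℝ v z ^ 2) with hI
  let b := EuclideanSpace.basisFun (Fin d) ℝ
  have h1 : (d : ENNReal) * I =
      ∫⁻ z in ball (0 : Ctx d) 1, ENNReal.ofReal (‖v‖ ^ 2 * ‖z‖ ^ 2) := by
    have h2 : ∀ i, ∫⁻ z in ball (0 : Ctx d) 1, ENNReal.ofReal (inner ℝ (‖v‖ • b i) z ^ 2) = I :=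
      fun i => lintegral_ball_inner_sq_congr (by simp [norm_smul, b])
    calc (d : ENNReal) * I = ∑ i : Fin d,
          ∫⁻ z in ball (0 : Ctx d) 1, ENNReal.ofReal (inner ℝ (‖v‖ • b i) z ^ 2) := by
          simp [h2]
      _ = ∫⁻ z in ball (0 : Ctx d) 1, ∑ i : Fin d, ENNReal.ofReal (inner ℝ (‖v‖ • b i) z ^ 2) := by
          rw [lintegral_finsetSum]
          intro i _
          fun_prop
      _ = _ := by
          congr with z
          rw [← ENNReal.ofReal_sum_of_nonneg fun i _ => sq_nonneg _]
          congr 1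
          rw [← b.sum_sq_inner_left z, Finset.mul_sum]
          refine Finset.sum_congr rfl fun i _ => ?_
          rw [real_inner_smul_left, real_inner_comm]
          ring
  have h3 : ENNReal.ofReal (‖v‖ ^ 2 / 8) * volume (ball (0 : Ctx d) 1) ≤
      ∫⁻ z in ball (0 : Ctx d) 1, ENNReal.ofReal (‖v‖ ^ 2 * ‖z‖ ^ 2) := by
    have hhalf : volume (ball (0 : Ctx d) (1 / 2)) ≤
        ENNReal.ofReal (1 / 2) * volume (ball (0 : Ctx d) 1) := by
      have := Measure.addHaar_ball_mul (volume : Measure (Ctx d)) 0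
        (by norm_num : (0 : ℝ) ≤ 1 / 2) 1
      rw [mul_one] at this
      rw [this]
      gcongr
      simp only [finrank_euclideanSpace, Fintype.card_fin]
      exact pow_le_of_le_one (by norm_num) (by norm_num) hd.ne'
    have hfin : volume (ball (0 : Ctx d) 1) ≠ ⊤ := measure_ball_lt_top.ne
    have hdiff : ENNReal.ofReal (1 / 2) * volume (ball (0 : Ctx d) 1) ≤
        volume (ball (0 : Ctx d) 1 \ ball 0 (1 / 2)) := by
      have h4 : volume (ball (0 : Ctx d) 1) ≤ volume (ball (0 : Ctx d) 1 \ ball 0 (1 / 2)) +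
          ENNReal.ofReal (1 / 2) * volume (ball (0 : Ctx d) 1) := by
        refine (measure_mono ?_).trans ((measure_union_le _ _).trans (add_le_add_right hhalf _))
        intro z hz
        by_cases h : z ∈ ball (0 : Ctx d) (1 / 2)
        · exact Or.inr h
        · exact Or.inl ⟨hz, h⟩
      have h5 : volume (ball (0 : Ctx d) 1) =
          ENNReal.ofReal (1 / 2) * volume (ball (0 : Ctx d) 1) +
            ENNReal.ofReal (1 / 2) * volume (ball (0 : Ctx d) 1) := by
        rw [← add_mul, ← ENNReal.ofReal_add (by norm_num) (by norm_num)]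
        norm_num
      nth_rewrite 1 [h5] at h4
      exact (ENNReal.add_le_add_iff_right (ENNReal.mul_ne_top ENNReal.ofReal_ne_top hfin)).1 h4
    calc ENNReal.ofReal (‖v‖ ^ 2 / 8) * volume (ball (0 : Ctx d) 1)
        = ENNReal.ofReal (‖v‖ ^ 2 * (1 / 4)) *
            (ENNReal.ofReal (1 / 2) * volume (ball (0 : Ctx d) 1)) := by
          rw [← mul_assoc, ← ENNReal.ofReal_mul (by positivity)]
          ring_nf
      _ ≤ ENNReal.ofReal (‖v‖ ^ 2 * (1 / 4)) *
            volume (ball (0 : Ctx d) 1 \ ball 0 (1 / 2)) := by gcongr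
      _ = ∫⁻ _z in ball (0 : Ctx d) 1 \ ball 0 (1 / 2), ENNReal.ofReal (‖v‖ ^ 2 * (1 / 4)) := by
          rw [lintegral_const, Measure.restrict_apply_univ]
      _ ≤ ∫⁻ z in ball (0 : Ctx d) 1 \ ball 0 (1 / 2), ENNReal.ofReal (‖v‖ ^ 2 * ‖z‖ ^ 2) := by
          refine setLIntegral_mono (by fun_prop) fun z hz => ?_
          have hz2 : 1 / 2 ≤ ‖z‖ := by simpa using hz.2
          apply ENNReal.ofReal_le_ofReal
          gcongr
          nlinarith
      _ ≤ _ := lintegral_mono_set Set.sdiff_subset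
  have hd0 : (d : ENNReal) ≠ 0 := by exact_mod_cast hd.ne'
  rw [← h1] at h3
  rw [← ENNReal.mul_le_mul_iff_right hd0 (by simp), ← mul_assoc]
  refine le_trans (le_of_eq ?_) h3
  rw [← ENNReal.ofReal_natCast, ← ENNReal.ofReal_mul hd'.le]
  congr 2
  field_simp

/-- Change of variables for an affine map of a set `H` into a set `K`, as a lower bound. -/
theorem lintegral_comp_affine_le {K H : Set (Ctx d)} (hH : MeasurableSet H)
    (A : Ctx d →L[ℝ] Ctx d) (hA : LinearMap.det (A : Ctx d →ₗ[ℝ] Ctx d) ≠ 0) (b : Ctx d)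
    (hmaps : ∀ z ∈ H, b + A z ∈ K) (F : Ctx d → ENNReal) :
    ENNReal.ofReal |LinearMap.det (A : Ctx d →ₗ[ℝ] Ctx d)| * ∫⁻ z in H, F (b + A z) ≤
      ∫⁻ y in K, F y := by
  have hinj : Function.Injective A :=
    (LinearMap.equivOfDetNeZero (A : Ctx d →ₗ[ℝ] Ctx d) hA).injective
  have h := lintegral_image_eq_lintegral_abs_det_fderiv_mul volume hH (f := fun z => b + A z)
    (f' := fun _ => A) (fun z _ => (A.hasFDerivAt.const_add b).hasFDerivWithinAt)
    (fun z _ z' _ hz => hinj (add_left_cancel hz)) F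
  have hdet : A.det = LinearMap.det (A : Ctx d →ₗ[ℝ] Ctx d) := rfl
  rw [lintegral_const_mul' _ _ ENNReal.ofReal_ne_top, hdet] at h
  rw [← h]
  exact lintegral_mono_set (Set.image_subset_iff.2 hmaps)

/-- The part of the unit ball that projects to the spherical cap `{δ < ⟨w, u⟩}`. -/
def capCone (δ : ℝ) (w : Ctx d) : Set (Ctx d) := ball 0 1 ∩ {y | δ * ‖y‖ < inner ℝ w y}

/-- The radial projection only lengthens the vectors of the ball, so that the second moments of a
cap are at least those of the cone over it. -/
theorem le_lintegral_cap_of_cone (hd : 0 < d) {δ : ℝ} {w v : Ctx d} {q : ℝ}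
    (h : ENNReal.ofReal q * volume (ball (0 : Ctx d) 1) ≤
      ∫⁻ y in capCone δ w, ENNReal.ofReal (inner ℝ v y ^ 2)) :
    ENNReal.ofReal q ≤
      ∫⁻ u in {u | δ < inner ℝ w u}, ENNReal.ofReal (inner ℝ v u ^ 2) ∂(sphereUniform d) := by
  have : Nonempty (Fin d) := ⟨⟨0, hd⟩⟩
  have hm : MeasurableSet {u : Ctx d | δ < inner ℝ w u} :=
    measurableSet_lt measurable_const (by fun_prop)
  have hfin : volume (ball (0 : Ctx d) 1) ≠ ⊤ := measure_ball_lt_top.ne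
  have hpos : volume (ball (0 : Ctx d) 1) ≠ 0 := (measure_ball_pos _ _ one_pos).ne'
  rw [← lintegral_indicator hm, lintegral_sphereUniform hd (Measurable.indicator (by fun_prop) hm),
    mul_comm, ← div_eq_mul_inv, ENNReal.le_div_iff_mul_le (Or.inl hpos) (Or.inl hfin)]
  refine h.trans ?_
  rw [capCone, Set.inter_comm, ← Measure.restrict_restrict (measurableSet_lt (by fun_prop)
    (by fun_prop)), ← lintegral_indicator (measurableSet_lt (by fun_prop) (by fun_prop))]
  refine setLIntegral_mono' measurableSet_ball fun y hy => ?_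
  by_cases hy' : δ * ‖y‖ < inner ℝ w y
  · have hy0 : y ≠ 0 := by
      rintro rfl
      simp at hy'
    have hn : 0 < ‖y‖ := norm_pos_iff.2 hy0
    have hy1 : ‖y‖ < 1 := by simpa using hy
    have hcap : δ < inner ℝ w (‖y‖⁻¹ • y) := by
      rw [inner_smul_right, inv_mul_eq_div, lt_div_iff₀ hn]
      exact hy'
    rw [Set.indicator_of_mem (show y ∈ {y | δ * ‖y‖ < inner ℝ w y} from hy'),
      Set.indicator_of_mem (show _ ∈ {u : Ctx d | δ < inner ℝ w u} from hcap)]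
    apply ENNReal.ofReal_le_ofReal
    rw [inner_smul_right, mul_pow]
    have h1 : 1 ≤ ‖y‖⁻¹ ^ 2 := one_le_pow₀ ((one_le_inv₀ hn).2 hy1.le)
    nlinarith [sq_nonneg (inner ℝ v y)]
  · rw [Set.indicator_of_notMem (show y ∉ {y | δ * ‖y‖ < inner ℝ w y} from hy')]
    exact zero_le

/-- For bounded `δ`, the cone over a cap contains a translate of the half ball, shrunk by the factor
`1 - δ`. -/
theorem le_lintegral_capCone_of_le (hd : 0 < d) {δ : ℝ} (h0 : 0 < δ) (h1 : δ ≤ 15 / 16)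
    {w : Ctx d} (hw : ‖w‖ = 1) (v : Ctx d) :
    ENNReal.ofReal ((1 - δ) ^ d / (4096 * d) * ‖v‖ ^ 2) * volume (ball (0 : Ctx d) 1) ≤
      ∫⁻ y in capCone δ w, ENNReal.ofReal (inner ℝ v y ^ 2) := by
  have hd' : (0 : ℝ) < d := by exact_mod_cast hd
  have hδ : 0 < 1 - δ := by linarith
  have hww : inner ℝ w w = 1 := by rw [real_inner_self_eq_norm_sq, hw, one_pow]
  set H : Set (Ctx d) := ball 0 1 ∩ {z | 0 ≤ inner ℝ w z} with hHdef
  have hHm : MeasurableSet H :=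
    measurableSet_ball.inter (measurableSet_le measurable_const (by fun_prop))
  let A : Ctx d →L[ℝ] Ctx d := (1 - δ) • ContinuousLinearMap.id ℝ (Ctx d)
  have hA : LinearMap.det (A : Ctx d →ₗ[ℝ] Ctx d) = (1 - δ) ^ d := by
    have : (A : Ctx d →ₗ[ℝ] Ctx d) = (1 - δ) • LinearMap.id := rfl
    rw [this, LinearMap.det_smul, LinearMap.det_id, mul_one, finrank_euclideanSpace,
      Fintype.card_fin]
  have hAz : ∀ z, A z = (1 - δ) • z := fun _ => rfl
  clear_value A
  have key := lintegral_comp_affine_le (K := capCone δ w) hHm A (by rw [hA]; positivity) (δ • w)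
    (by
      rintro z ⟨hz1, hz2⟩
      have hz1' : ‖z‖ < 1 := by simpa using hz1
      have hz2' : 0 ≤ inner ℝ w z := hz2
      have hn : ‖δ • w + A z‖ < 1 := by
        calc ‖δ • w + A z‖ ≤ ‖δ • w‖ + ‖(1 - δ) • z‖ := by
              rw [hAz]
              exact norm_add_le _ _
          _ = δ + (1 - δ) * ‖z‖ := by
            rw [norm_smul, norm_smul, hw, Real.norm_of_nonneg h0.le, Real.norm_of_nonneg hδ.le,
              mul_one]
          _ < 1 := by nlinarith
      refine ⟨by simpa using hn, ?_⟩
      change δ * ‖δ • w + A z‖ < inner ℝ w (δ • w + A z)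
      rw [hAz] at hn ⊢
      rw [inner_add_right, inner_smul_right, inner_smul_right, hww]
      nlinarith [mul_nonneg hδ.le hz2'])
    fun y => ENNReal.ofReal (inner ℝ v y ^ 2)
  rw [hA, abs_of_pos (by positivity)] at key
  refine le_trans ?_ key
  -- The reflection that fixes `w` preserves the half ball; averaging over it removes cross terms.
  let R := (Submodule.span ℝ {w}).reflection
  have hRz : ∀ z, R z = (2 * inner ℝ w z) • w - z := by
    intro z
    rw [Submodule.reflection_apply, Submodule.starProjection_unit_singleton ℝ hw, two_smul,
      two_mul, add_smul]
  clear_value R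
  have hRw : ∀ z, inner ℝ w (R z) = inner ℝ w z := by
    intro z
    rw [hRz, inner_sub_right, inner_smul_right, hww]
    ring
  have hpre : R ⁻¹' H = H := by
    ext z
    simp [hHdef, hRw]
  have hsymm : ∀ F : Ctx d → ENNReal, Measurable F → ∫⁻ z in H, F (R z) = ∫⁻ z in H, F z := by
    intro F hF
    have := R.measurePreserving.setLIntegral_comp_preimage hHm hF
    rwa [hpre] at this
  have hstep1 : ENNReal.ofReal ((1 - δ) ^ 2) * ∫⁻ z in H, ENNReal.ofReal (inner ℝ v z ^ 2) ≤
      ∫⁻ z in H, ENNReal.ofReal (inner ℝ v (δ • w + A z) ^ 2) := by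
    rw [← ENNReal.mul_le_mul_iff_right (a := 2) (by norm_num) (by norm_num), two_mul, two_mul]
    have m1 : Measurable fun z : Ctx d => ENNReal.ofReal (inner ℝ v z ^ 2) :=
      measurable_ofReal_inner_sq continuous_id v
    have m2 : Measurable fun z => ENNReal.ofReal (inner ℝ v (δ • w + A z) ^ 2) :=
      measurable_ofReal_inner_sq (continuous_const.add A.continuous) v
    have m1R : Measurable fun z => ENNReal.ofReal (inner ℝ v (R z) ^ 2) :=
      m1.comp R.continuous.measurable
    have e1 := hsymm _ m1
    have e2 := hsymm _ m2
    nth_rewrite 2 [← e1]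
    nth_rewrite 2 [← e2]
    rw [← lintegral_const_mul _ m1, ← lintegral_const_mul _ m1R,
      ← lintegral_add_left (m1.const_mul _), ← lintegral_add_left m2]
    refine setLIntegral_mono' hHm fun z hz => ?_
    have hz2 : 0 ≤ inner ℝ w z := hz.2
    rw [← ENNReal.ofReal_mul (by positivity), ← ENNReal.ofReal_mul (by positivity),
      ← ENNReal.ofReal_add (by positivity) (by positivity),
      ← ENNReal.ofReal_add (by positivity) (by positivity)]
    apply ENNReal.ofReal_le_ofReal
    have ha : inner ℝ v (δ • w + A z) = δ * inner ℝ v w + (1 - δ) * inner ℝ v z := by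
      rw [hAz, inner_add_right, inner_smul_right, inner_smul_right]
    have hb : inner ℝ v (δ • w + A (R z)) =
        δ * inner ℝ v w + (1 - δ) * (2 * inner ℝ w z * inner ℝ v w - inner ℝ v z) := by
      rw [hAz, hRz, inner_add_right, inner_smul_right, inner_smul_right, inner_sub_right,
        inner_smul_right]
    rw [ha, hb, hRz, inner_sub_right, inner_smul_right]
    have h2 : 0 ≤ δ * (1 - δ) * inner ℝ w z * (inner ℝ v w) ^ 2 := by positivity
    nlinarith [sq_nonneg (δ * inner ℝ v w)]
  have hstep2 : ∫⁻ z in ball (0 : Ctx d) 1, ENNReal.ofReal (inner ℝ v z ^ 2) ≤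
      2 * ∫⁻ z in H, ENNReal.ofReal (inner ℝ v z ^ 2) := by
    have hneg : ∫⁻ z in (fun z => -z) ⁻¹' H, ENNReal.ofReal (inner ℝ v z ^ 2) =
        ∫⁻ z in H, ENNReal.ofReal (inner ℝ v z ^ 2) := by
      have := (Measure.measurePreserving_neg (volume : Measure (Ctx d))).setLIntegral_comp_preimage
        hHm (measurable_ofReal_inner_sq continuous_id v)
      simpa [inner_neg_right] using this
    rw [two_mul]
    nth_rewrite 2 [← hneg]
    refine le_trans (lintegral_mono_set ?_) (lintegral_union_le _ _ _)
    intro z hz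
    rcases le_total 0 (inner ℝ w z) with h | h
    · exact Or.inl ⟨hz, h⟩
    · exact Or.inr ⟨by simpa using hz, by simpa [inner_neg_right] using h⟩
  have hball := (le_lintegral_ball_inner_sq hd v).trans hstep2
  set I := ∫⁻ z in H, ENNReal.ofReal (inner ℝ v z ^ 2)
  calc ENNReal.ofReal ((1 - δ) ^ d / (4096 * d) * ‖v‖ ^ 2) * volume (ball (0 : Ctx d) 1)
      = ENNReal.ofReal ((1 - δ) ^ d * (1 / 256) * (1 / 2)) *
        (ENNReal.ofReal (‖v‖ ^ 2 / (8 * d)) * volume (ball (0 : Ctx d) 1)) := by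
        rw [← mul_assoc, ← ENNReal.ofReal_mul (by positivity)]
        congr 2
        field_simp
        ring
    _ ≤ ENNReal.ofReal ((1 - δ) ^ d * (1 / 256) * (1 / 2)) * (2 * I) := by gcongr
    _ = ENNReal.ofReal ((1 - δ) ^ d * (1 / 256)) * I := by
        rw [← mul_assoc, show (2 : ENNReal) = ENNReal.ofReal 2 by simp,
          ← ENNReal.ofReal_mul (by positivity)]
        ring_nf
    _ ≤ ENNReal.ofReal ((1 - δ) ^ d * (1 - δ) ^ 2) * I := by
        gcongr
        nlinarith
    _ = ENNReal.ofReal ((1 - δ) ^ d) * (ENNReal.ofReal ((1 - δ) ^ 2) * I) := by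
        rw [ENNReal.ofReal_mul (by positivity), mul_assoc]
    _ ≤ _ := by gcongr

theorem ellipsoid_mem_capCone {δ κ : ℝ} (h0 : 15 / 16 ≤ δ) (h1 : δ < 1)
    (hκ2 : κ ^ 2 = (1 - δ) / 16) {w z : Ctx d} (hw : ‖w‖ = 1) (hz1 : ‖z‖ < 1) :
    (1 / 2 + inner ℝ w z * (1 / 4 - κ)) • w + κ • z ∈ capCone δ w := by
  have hδ : 0 < 1 - δ := by linarith
  have hww : inner ℝ w w = 1 := by rw [real_inner_self_eq_norm_sq, hw, one_pow]
  set a := inner ℝ w z with ha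
  have ha1 : a ^ 2 ≤ ‖z‖ ^ 2 := by
    have := abs_real_inner_le_norm w z
    rw [hw, one_mul] at this
    exact sq_le_sq.2 (by rwa [abs_norm])
  have hz2 : ‖z‖ ^ 2 < 1 := by nlinarith [norm_nonneg z]
  have ha2 : -1 < a ∧ a < 1 := abs_lt_of_sq_lt_sq' (by linarith) one_pos.le |>.imp_left id
  set y := (1 / 2 + a * (1 / 4 - κ)) • w + κ • z with hydef
  have hyw : inner ℝ w y = 1 / 2 + a / 4 := by
    rw [hydef, inner_add_right, inner_smul_right, inner_smul_right, hww, ← ha]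
    ring
  have hyn : ‖y‖ ^ 2 = (1 / 2 + a / 4) ^ 2 + κ ^ 2 * (‖z‖ ^ 2 - a ^ 2) := by
    rw [hydef, norm_add_sq_real, norm_smul, norm_smul, hw, real_inner_smul_left,
      inner_smul_right, ← ha, mul_one, Real.norm_eq_abs, sq_abs, mul_pow, Real.norm_eq_abs,
      sq_abs]
    ring
  have hlt : ‖y‖ ^ 2 < 1 := by
    have h3 : (1 - δ) / 16 * (‖z‖ ^ 2 - a ^ 2) ≤ 1 / 16 * 1 := by
      gcongr
      · linarith
      · linarith [sq_nonneg a]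
    have h4 : (1 / 2 + a / 4) ^ 2 ≤ (3 / 4) ^ 2 := by
      apply pow_le_pow_left₀ <;> linarith
    rw [hyn, hκ2]
    linarith
  refine ⟨?_, ?_⟩
  · rw [mem_ball_zero_iff]
    nlinarith [norm_nonneg y]
  · change δ * ‖y‖ < inner ℝ w y
    rw [hyw]
    refine lt_of_pow_lt_pow_left₀ 2 (by linarith) ?_
    have h3 : κ ^ 2 * (‖z‖ ^ 2 - a ^ 2) < (1 - δ) * (1 / 2 + a / 4) ^ 2 := by
      rw [hκ2]
      have h4 : (1 / 2 + a / 4) ^ 2 - 1 / 16 * (1 - a ^ 2) = (2 * (a + 1) ^ 2 + 1) / 16 := by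
        ring
      have h5 : 1 / 16 * (‖z‖ ^ 2 - a ^ 2) < (1 / 2 + a / 4) ^ 2 := by
        linarith [sq_nonneg (a + 1)]
      calc (1 - δ) / 16 * (‖z‖ ^ 2 - a ^ 2) = (1 - δ) * (1 / 16 * (‖z‖ ^ 2 - a ^ 2)) := by ring
        _ < _ := mul_lt_mul_of_pos_left h5 hδ
    rw [mul_pow, hyn]
    have h4 : 0 < (1 / 2 + a / 4) ^ 2 := by
      have : 0 < 1 / 2 + a / 4 := by linarith
      positivity
    have h5 : δ ^ 2 * (2 - δ) ≤ 1 := by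
      have : 0 ≤ (1 - δ) * (1 + δ - δ ^ 2) := mul_nonneg hδ.le (by nlinarith)
      linarith
    have h6 : 0 < δ ^ 2 := by positivity
    calc δ ^ 2 * ((1 / 2 + a / 4) ^ 2 + κ ^ 2 * (‖z‖ ^ 2 - a ^ 2))
        < δ ^ 2 * ((1 / 2 + a / 4) ^ 2 + (1 - δ) * (1 / 2 + a / 4) ^ 2) := by gcongr
      _ = δ ^ 2 * (2 - δ) * (1 / 2 + a / 4) ^ 2 := by ring
      _ ≤ 1 * (1 / 2 + a / 4) ^ 2 := by gcongr
      _ = _ := one_mul _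

/-- For `δ` close to `1`, the cone over a cap contains an ellipsoid whose semi-axis in the direction
of the cap is a constant and whose other semi-axes are of order `√(1 - δ)`. -/
theorem le_lintegral_capCone_of_ge (hd : 0 < d) {δ : ℝ} (h0 : 15 / 16 ≤ δ) (h1 : δ < 1)
    {w : Ctx d} (hw : ‖w‖ = 1) (v : Ctx d) :
    ENNReal.ofReal ((1 - δ) ^ d / (4096 * d) * ‖v‖ ^ 2) * volume (ball (0 : Ctx d) 1) ≤
      ∫⁻ y in capCone δ w, ENNReal.ofReal (inner ℝ v y ^ 2) := by
  have hd' : (0 : ℝ) < d := by exact_mod_cast hd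
  have hδ : 0 < 1 - δ := by linarith
  have hww : inner ℝ w w = 1 := by rw [real_inner_self_eq_norm_sq, hw, one_pow]
  obtain ⟨κ, hκ, hκ2⟩ : ∃ κ : ℝ, 0 < κ ∧ κ ^ 2 = (1 - δ) / 16 :=
    ⟨√((1 - δ) / 16), Real.sqrt_pos.2 (by positivity), Real.sq_sqrt (by positivity)⟩
  have hκ1 : κ ≤ 1 / 4 := by nlinarith
  have hκδ : 1 - δ ≤ κ := by nlinarith
  let A : Ctx d →L[ℝ] Ctx d := κ • ContinuousLinearMap.id ℝ (Ctx d) +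
    (innerSL ℝ w).smulRight ((1 / 4 - κ) • w)
  have hAz : ∀ z, A z = κ • z + (inner ℝ w z * (1 / 4 - κ)) • w := by
    intro z
    simp [A, smul_smul]
  have hA : LinearMap.det (A : Ctx d →ₗ[ℝ] Ctx d) = κ ^ d * (1 / (4 * κ)) := by
    have : (A : Ctx d →ₗ[ℝ] Ctx d) = κ • LinearMap.transvection
        (innerSL ℝ w : Ctx d →ₗ[ℝ] ℝ) (((1 / 4 - κ) / κ) • w) := by
      ext1 z
      change A z = κ • (z + inner ℝ w z • (((1 / 4 - κ) / κ) • w))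
      rw [hAz, smul_add, smul_smul, smul_smul]
      congr 2
      field_simp
    rw [this, LinearMap.det_smul, finrank_euclideanSpace, Fintype.card_fin,
      LinearMap.transvection.det]
    congr 1
    simp [hw]
    field_simp
    ring
  clear_value A
  have hApos : 0 < κ ^ d * (1 / (4 * κ)) := by positivity
  have key := lintegral_comp_affine_le (K := capCone δ w) (measurableSet_ball (x := 0) (ε := 1)) A
    (by rw [hA]; exact hApos.ne') ((1 / 2 : ℝ) • w)
    (by
      intro z hz
      have hy : (1 / 2 : ℝ) • w + A z = (1 / 2 + inner ℝ w z * (1 / 4 - κ)) • w + κ • z := by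
        rw [hAz, add_smul]
        abel
      rw [hy]
      exact ellipsoid_mem_capCone h0 h1 hκ2 hw (by simpa using hz))
    fun y => ENNReal.ofReal (inner ℝ v y ^ 2)
  rw [hA, abs_of_pos hApos] at key
  refine le_trans ?_ key
  -- The image of `v` under the (symmetric) linear part of the affine map.
  set v' : Ctx d := κ • v + (inner ℝ v w * (1 / 4 - κ)) • w with hv'
  have hv'n : κ ^ 2 * ‖v‖ ^ 2 ≤ ‖v'‖ ^ 2 := by
    rw [hv', norm_add_sq_real, norm_smul, norm_smul, hw, real_inner_smul_left, inner_smul_right,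
      mul_pow, Real.norm_eq_abs, sq_abs]
    have : 0 ≤ 1 / 4 - κ := by linarith
    have h3 : 0 ≤ 2 * (κ * ((1 / 4 - κ) * inner ℝ v w ^ 2)) := by positivity
    nlinarith [sq_nonneg (‖inner ℝ v w * (1 / 4 - κ)‖ * 1)]
  have hstep1 : ∫⁻ z in ball (0 : Ctx d) 1, ENNReal.ofReal (inner ℝ v' z ^ 2) ≤
      ∫⁻ z in ball (0 : Ctx d) 1, ENNReal.ofReal (inner ℝ v ((1 / 2 : ℝ) • w + A z) ^ 2) := by
    rw [← ENNReal.mul_le_mul_iff_right (a := 2) (by norm_num) (by norm_num), two_mul, two_mul]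
    have m1 : Measurable fun z : Ctx d => ENNReal.ofReal (inner ℝ v' z ^ 2) :=
      measurable_ofReal_inner_sq continuous_id v'
    have m2 : Measurable fun z => ENNReal.ofReal (inner ℝ v ((1 / 2 : ℝ) • w + A z) ^ 2) :=
      measurable_ofReal_inner_sq (continuous_const.add A.continuous) v
    have e2 := (Measure.measurePreserving_neg (volume : Measure (Ctx d))).setLIntegral_comp_preimage
        (measurableSet_ball (x := (0 : Ctx d)) (ε := 1)) m2
    have hpre : (fun z : Ctx d => -z) ⁻¹' ball 0 1 = ball 0 1 := by
      ext z
      simp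
    rw [hpre] at e2
    nth_rewrite 2 [← e2]
    rw [← lintegral_add_left m1, ← lintegral_add_left m2]
    refine setLIntegral_mono' measurableSet_ball fun z _ => ?_
    rw [← ENNReal.ofReal_add (by positivity) (by positivity),
      ← ENNReal.ofReal_add (by positivity) (by positivity)]
    apply ENNReal.ofReal_le_ofReal
    have hb : inner ℝ v (A z) = inner ℝ v' z := by
      rw [hAz, hv', inner_add_right, inner_add_left, inner_smul_right, inner_smul_right,
        real_inner_smul_left, real_inner_smul_left]
      ring
    rw [map_neg, inner_add_right, inner_add_right, inner_neg_right, hb]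
    nlinarith [sq_nonneg (inner ℝ v ((1 / 2 : ℝ) • w))]
  have hball := (le_lintegral_ball_inner_sq hd v').trans hstep1
  calc ENNReal.ofReal ((1 - δ) ^ d / (4096 * d) * ‖v‖ ^ 2) * volume (ball (0 : Ctx d) 1)
      ≤ ENNReal.ofReal (κ ^ d * (1 / (4 * κ)) * (‖v'‖ ^ 2 / (8 * d))) *
        volume (ball (0 : Ctx d) 1) := by
        refine mul_le_mul_left (ENNReal.ofReal_le_ofReal ?_) _
        obtain ⟨e, rfl⟩ : ∃ e, d = e + 1 := ⟨d - 1, by omega⟩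
        have h3 : κ ^ (e + 1) * (1 / (4 * κ)) = κ ^ e / 4 := by
          rw [pow_succ]
          field_simp
        rw [h3]
        have h4 : (1 - δ) ^ (e + 1) ≤ κ ^ e * (16 * κ ^ 2) := by
          rw [pow_succ, hκ2]
          have := pow_le_pow_left₀ hδ.le hκδ e
          nlinarith
        have h5 : (1 - δ) ^ (e + 1) * ‖v‖ ^ 2 ≤ 16 * κ ^ e * ‖v'‖ ^ 2 := by
          calc (1 - δ) ^ (e + 1) * ‖v‖ ^ 2 ≤ κ ^ e * (16 * κ ^ 2) * ‖v‖ ^ 2 := by gcongr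
            _ = 16 * κ ^ e * (κ ^ 2 * ‖v‖ ^ 2) := by ring
            _ ≤ _ := by gcongr
        rw [show (1 - δ) ^ (e + 1) / (4096 * ((e + 1 : ℕ) : ℝ)) * ‖v‖ ^ 2
            = (1 - δ) ^ (e + 1) * ‖v‖ ^ 2 / (4096 * ((e + 1 : ℕ) : ℝ)) by ring,
          show κ ^ e / 4 * (‖v'‖ ^ 2 / (8 * ((e + 1 : ℕ) : ℝ)))
            = 128 * κ ^ e * ‖v'‖ ^ 2 / (4096 * ((e + 1 : ℕ) : ℝ)) by ring]
        refine div_le_div_of_nonneg_right (h5.trans ?_) (by positivity)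
        gcongr
        norm_num
    _ = ENNReal.ofReal (κ ^ d * (1 / (4 * κ))) *
        (ENNReal.ofReal (‖v'‖ ^ 2 / (8 * d)) * volume (ball (0 : Ctx d) 1)) := by
        rw [ENNReal.ofReal_mul (by positivity), mul_assoc]
    _ ≤ _ := by gcongr

/-- The second moments of the uniform distribution restricted to a cap at height `δ` are all at
least of order `(1 - δ)ᵈ / d`. -/
theorem le_lintegral_cap_inner_sq (hd : 0 < d) {δ : ℝ} (h0 : 0 < δ) (h1 : δ < 1) {w : Ctx d}
    (hw : ‖w‖ = 1) (v : Ctx d) :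
    ENNReal.ofReal ((1 - δ) ^ d / (4096 * d) * ‖v‖ ^ 2) ≤
      ∫⁻ u in {u | δ < inner ℝ w u}, ENNReal.ofReal (inner ℝ v u ^ 2) ∂(sphereUniform d) := by
  apply le_lintegral_cap_of_cone hd
  rcases le_total δ (15 / 16) with h | h
  · exact le_lintegral_capCone_of_le hd h0 h hw v
  · exact le_lintegral_capCone_of_ge hd h h1 hw v

theorem le_lintegral_sphere_inner_sq (hd : 0 < d) (v : Ctx d) :
    ENNReal.ofReal (1 / (8 * d) * ‖v‖ ^ 2) ≤
      ∫⁻ u, ENNReal.ofReal (inner ℝ v u ^ 2) ∂(sphereUniform d) := by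
  have h := le_lintegral_cap_of_cone hd (δ := -2) (w := 0) (v := v)
    (q := 1 / (8 * d) * ‖v‖ ^ 2) ?_
  · exact h.trans (setLIntegral_le_lintegral _ _)
  · have hae : (capCone (-2) (0 : Ctx d)) =ᵐ[volume] ball (0 : Ctx d) 1 := by
      have : Nonempty (Fin d) := ⟨⟨0, hd⟩⟩
      have h0 : ∀ᵐ y : Ctx d, y ≠ 0 := by simp [ae_iff]
      filter_upwards [h0] with y hy
      apply propext
      change (y ∈ ball (0 : Ctx d) 1 ∧ -2 * ‖y‖ < inner ℝ 0 y) ↔ y ∈ ball (0 : Ctx d) 1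
      have : 0 < ‖y‖ := norm_pos_iff.2 hy
      simp [hy]
    rw [setLIntegral_congr hae]
    convert le_lintegral_ball_inner_sq hd v using 3
    ring

/-! ### Null sets of the sphere -/

theorem sphereUniform_eq_zero_of_cone (hd : 0 < d) {A : Set (Ctx d)} (hA : MeasurableSet A)
    (h : volume (ball (0 : Ctx d) 1 ∩ {y | y ≠ 0 ∧ ‖y‖⁻¹ • y ∈ A}) = 0) :
    sphereUniform d A = 0 := by
  rw [sphereUniform_apply hd hA, h, mul_zero]

theorem sphereUniform_submodule (hd : 0 < d) {W : Submodule ℝ (Ctx d)} (hW : W ≠ ⊤) :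
    sphereUniform d (W : Set (Ctx d)) = 0 := by
  refine sphereUniform_eq_zero_of_cone hd W.closed_of_finiteDimensional.measurableSet
    (measure_mono_null ?_ (Measure.addHaar_submodule volume W hW))
  rintro y ⟨-, hy0, hy⟩
  exact (W.smul_mem_iff (inv_ne_zero (norm_ne_zero_iff.2 hy0))).1 hy

theorem span_singleton_ne_top (hd : 2 ≤ d) (b : Ctx d) : Submodule.span ℝ {b} ≠ ⊤ := by
  intro h
  have h1 := finrank_span_le_card (R := ℝ) ({b} : Set (Ctx d))
  rw [h, finrank_top] at h1
  simp at h1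
  omega

/-- The sections of the sphere by affine hyperplanes are null sets. -/
theorem sphereUniform_inner_eq (hd : 2 ≤ d) {θ : Ctx d} (hθ : θ ≠ 0) (c : ℝ) :
    sphereUniform d {u | inner ℝ θ u = c} = 0 := by
  have hθ' : 0 < ‖θ‖ := norm_pos_iff.2 hθ
  have hm : MeasurableSet {u : Ctx d | inner ℝ θ u = c} :=
    measurableSet_eq_fun (by fun_prop) measurable_const
  refine sphereUniform_eq_zero_of_cone (by omega) hm ?_
  have hsub : ball (0 : Ctx d) 1 ∩ {y | y ≠ 0 ∧ ‖y‖⁻¹ • y ∈ {u : Ctx d | inner ℝ θ u = c}} ⊆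
      ball (0 : Ctx d) 1 ∩ {y | y ≠ 0 ∧ inner ℝ θ y = c * ‖y‖} := by
    rintro y ⟨h1, h0, h2⟩
    refine ⟨h1, h0, ?_⟩
    have hn : 0 < ‖y‖ := norm_pos_iff.2 h0
    have h3 : inner ℝ θ (‖y‖⁻¹ • y) = c := h2
    rw [inner_smul_right, inv_mul_eq_div, div_eq_iff hn.ne'] at h3
    exact h3
  refine measure_mono_null hsub ?_
  rcases lt_or_ge |c| ‖θ‖ with hc | hc
  · -- The cone meets every line parallel to `θ` at most once.
    refine Measure.addHaar_eq_zero_of_disjoint_translates volume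
      (fun n : ℕ => (1 / ((n : ℝ) + 1)) • θ) ?_ ?_ ?_
    · refine (Metric.isBounded_closedBall (x := (0 : Ctx d)) (r := ‖θ‖)).subset ?_
      rintro _ ⟨n, rfl⟩
      rw [mem_closedBall_zero_iff, norm_smul, Real.norm_of_nonneg (by positivity)]
      have : 1 / ((n : ℝ) + 1) ≤ 1 := by
        rw [div_le_one (by positivity)]
        linarith [(Nat.cast_nonneg n : (0 : ℝ) ≤ n)]
      nlinarith
    · have key : ∀ y y' : Ctx d, ∀ η : ℝ, 0 < η → inner ℝ θ y = c * ‖y‖ →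
          inner ℝ θ y' = c * ‖y'‖ → y' = y + η • θ → False := by
        intro y y' η hη h1 h2 h3
        have h4 : inner ℝ θ y' = inner ℝ θ y + η * ‖θ‖ ^ 2 := by
          rw [h3, inner_add_right, inner_smul_right, real_inner_self_eq_norm_sq]
        have h5 : |‖y'‖ - ‖y‖| ≤ η * ‖θ‖ := by
          refine (abs_norm_sub_norm_le y' y).trans ?_
          rw [h3, add_sub_cancel_left, norm_smul, Real.norm_of_nonneg hη.le]
        have h6 : c * (‖y'‖ - ‖y‖) = η * ‖θ‖ ^ 2 := by linarith
        have h7 : c * (‖y'‖ - ‖y‖) ≤ |c| * (η * ‖θ‖) :=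
          (le_abs_self _).trans (by rw [abs_mul]; gcongr)
        have h8 : |c| * (η * ‖θ‖) < ‖θ‖ * (η * ‖θ‖) := by gcongr
        nlinarith
      intro n m hnm
      rw [Function.onFun, Set.disjoint_left]
      rintro p hp hp'
      obtain ⟨_, rfl, y, hy, rfl⟩ := hp
      obtain ⟨_, rfl, y', hy', he⟩ := hp'
      have hne : (1 / ((n : ℝ) + 1)) ≠ (1 / ((m : ℝ) + 1)) := by
        intro h
        rw [one_div, one_div, inv_inj, add_left_inj, Nat.cast_inj] at h
        exact hnm h
      have he' : (1 / ((m : ℝ) + 1)) • θ + y' = (1 / ((n : ℝ) + 1)) • θ + y := he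
      rcases lt_or_gt_of_ne hne with h | h
      · refine key y' y _ (sub_pos.2 h) hy'.2.2 hy.2.2 ?_
        have h1 : y = (1 / ((m : ℝ) + 1)) • θ + y' - (1 / ((n : ℝ) + 1)) • θ := by
          rw [he']
          abel
        rw [h1]
        module
      · refine key y y' _ (sub_pos.2 h) hy.2.2 hy'.2.2 ?_
        have h1 : y' = (1 / ((n : ℝ) + 1)) • θ + y - (1 / ((m : ℝ) + 1)) • θ := by
          rw [← he']
          abel
        rw [h1]
        module
    · exact measurableSet_ball.inter ((measurableSet_singleton 0).compl.inter
        (measurableSet_eq_fun (by fun_prop) (by fun_prop)))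
  · -- By the equality case of Cauchy-Schwarz, the cone is contained in the line spanned by `θ`.
    refine measure_mono_null ?_
      (Measure.addHaar_submodule volume _ (span_singleton_ne_top hd θ))
    rintro y ⟨-, h0, h1⟩
    have hn : 0 < ‖y‖ := norm_pos_iff.2 h0
    have h2 : |inner ℝ θ y / (‖θ‖ * ‖y‖)| = 1 := by
      apply le_antisymm (abs_real_inner_div_norm_mul_norm_le_one θ y)
      rw [show inner ℝ θ y = c * ‖y‖ from h1, abs_div, abs_mul, abs_mul, abs_norm, abs_norm,
        le_div_iff₀ (by positivity)]
      nlinarith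
    obtain ⟨-, r, -, hr⟩ := (abs_real_inner_div_norm_mul_norm_eq_one_iff θ y).1 h2
    exact Submodule.mem_span_singleton.2 ⟨r, hr.symm⟩

end Geometry

/-! ### Measurability of the statistics -/

section Measurability

open Matrix hiding gram

variable {d : ℕ}

/-- The product σ-algebra on real matrices. -/
instance instMeasurableSpaceRealMatrix : MeasurableSpace (Matrix (Fin d) (Fin d) ℝ) :=
  inferInstanceAs (MeasurableSpace (Fin d → Fin d → ℝ))

instance instBorelSpaceRealMatrix : BorelSpace (Matrix (Fin d) (Fin d) ℝ) :=
  inferInstanceAs (BorelSpace (Fin d → Fin d → ℝ))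

instance instSecondCountableRealMatrix : SecondCountableTopology (Matrix (Fin d) (Fin d) ℝ) :=
  inferInstanceAs (SecondCountableTopology (Fin d → Fin d → ℝ))

theorem measurable_matrix_inv : Measurable fun A : Matrix (Fin d) (Fin d) ℝ => A⁻¹ := by
  have h : (fun A : Matrix (Fin d) (Fin d) ℝ => A⁻¹) = fun A => (A.det)⁻¹ • A.adjugate := by
    ext1 A
    rw [Matrix.inv_def, Ring.inverse_eq_inv']
  rw [h]
  refine measurable_pi_iff.2 fun i => measurable_pi_iff.2 fun j => ?_
  have h1 : Continuous fun A : Matrix (Fin d) (Fin d) ℝ => A.det := continuous_id.matrix_det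
  have h2 : Continuous fun A : Matrix (Fin d) (Fin d) ℝ => A.adjugate i j :=
    continuous_id.matrix_adjugate.matrix_elem i j
  exact h1.measurable.inv.mul h2.measurable

theorem continuous_ofLp' : Continuous fun y : Ctx d => y.ofLp := PiLp.continuous_ofLp 2 _

theorem Stats.measurable_est : Measurable fun p : Stats d => p.est := by
  have h : Continuous fun q : Matrix (Fin d) (Fin d) ℝ × Ctx d =>
      (WithLp.toLp 2 (q.1 *ᵥ q.2.ofLp) : Ctx d) :=
    (PiLp.continuous_toLp 2 _).comp
      (continuous_fst.matrix_mulVec (continuous_ofLp'.comp continuous_snd))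
  exact h.measurable.comp ((measurable_matrix_inv.comp measurable_fst).prodMk measurable_snd)

theorem Stats.measurable_push :
    Measurable fun q : Stats d × Ctx d × ℝ => q.1.push q.2.1 q.2.2 := by
  have h1 : Continuous fun q : Stats d × Ctx d × ℝ => q.2.1.ofLp :=
    continuous_ofLp'.comp (continuous_fst.comp continuous_snd)
  have h : Continuous fun q : Stats d × Ctx d × ℝ => q.1.push q.2.1 q.2.2 :=
    ((continuous_fst.comp continuous_fst).add (h1.matrix_vecMulVec h1)).prodMk (by fun_prop)
  exact h.measurable

/-- The recording rule is measurable, as a condition on the estimate and the context. -/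
def MeasurableIncl (incl : ℕ → Ctx d → Ctx d → Prop) : Prop :=
  ∀ t, MeasurableSet {q : Ctx d × Ctx d | incl t q.1 q.2}

theorem measurableIncl_saIncl (δ : ℝ) : MeasurableIncl (saIncl d δ) := by
  intro t
  have h : MeasurableSet {q : Ctx d × Ctx d | δ * ‖q.1‖ < inner ℝ q.1 q.2} :=
    measurableSet_lt (by fun_prop) (by fun_prop)
  exact (MeasurableSet.const (t < d)).union h

theorem measurableIncl_etcIncl (n : ℕ) : MeasurableIncl (etcIncl d n) :=
  fun t => MeasurableSet.const (t < n)

theorem MeasurableIncl.measurableSet {incl : ℕ → Ctx d → Ctx d → Prop} (hi : MeasurableIncl incl)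
    (t : ℕ) : MeasurableSet {q : Stats d × Ctx d | incl t q.1.est q.2} :=
  ((Stats.measurable_est.comp measurable_fst).prodMk measurable_snd) (hi t)

theorem measurable_runStats {Ω : Type*} {m : MeasurableSpace Ω} {incl : ℕ → Ctx d → Ctx d → Prop}
    (hi : MeasurableIncl incl) (θ : Ctx d) {x : ℕ → Ω → Ctx d} {ε : ℕ → Ω → ℝ} (t : ℕ)
    (hx : ∀ s < t, Measurable (x s)) (hε : ∀ s < t, Measurable (ε s)) :
    Measurable fun ω => runStats incl θ (fun s => x s ω) (fun s => ε s ω) t := by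
  induction t with
  | zero => exact measurable_const
  | succ t ih =>
    have ih := ih (fun s hs => hx s (by omega)) (fun s hs => hε s (by omega))
    have hxt := hx t (by omega)
    have hεt := hε t (by omega)
    simp only [runStats]
    refine Measurable.ite ((ih.prodMk hxt) (hi.measurableSet t)) ?_ ih
    refine Stats.measurable_push.comp (ih.prodMk (hxt.prodMk ?_))
    exact (measurable_const.inner hxt).add hεt

theorem measurable_runDir {Ω : Type*} {m : MeasurableSpace Ω} {incl : ℕ → Ctx d → Ctx d → Prop}
    (hi : MeasurableIncl incl) (k : ℕ) (θ : Ctx d) {x : ℕ → Ω → Ctx d} {ε : ℕ → Ω → ℝ} (t : ℕ)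
    (hx : ∀ s < t, Measurable (x s)) (hε : ∀ s < t, Measurable (ε s)) :
    Measurable fun ω => runDir incl k θ (fun s => x s ω) (fun s => ε s ω) t := by
  simp only [runDir]
  split_ifs
  · exact measurable_const
  · exact Stats.measurable_est.comp (measurable_runStats hi θ t hx hε)

end Measurability

/-! ### Consequences of the stochastic assumptions -/

section Env

variable {Ω : Type*} {d : ℕ} {x : ℕ → Ω → Ctx d} {ε : ℕ → Ω → ℝ}

/-- The σ-algebra generated by the contexts and the noise of the rounds before `t`. -/
abbrev past (x : ℕ → Ω → Ctx d) (ε : ℕ → Ω → ℝ) (t : ℕ) : MeasurableSpace Ω :=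
  ⨆ s ∈ Set.Iio t, MeasurableSpace.comap (fun ω => (x s ω, ε s ω)) inferInstance

theorem measurable_past {s t : ℕ} (hst : s < t) :
    Measurable[past x ε t] fun ω => (x s ω, ε s ω) := by
  have h : MeasurableSpace.comap (fun ω => (x s ω, ε s ω)) inferInstance ≤ past x ε t :=
    le_iSup₂_of_le (f := fun s (_ : s ∈ Set.Iio t) =>
      MeasurableSpace.comap (fun ω => (x s ω, ε s ω)) inferInstance) s hst le_rfl
  exact (comap_measurable _).mono h le_rfl

theorem measurable_past_ctx {s t : ℕ} (hst : s < t) : Measurable[past x ε t] (x s) :=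
  measurable_fst.comp (measurable_past hst)

theorem measurable_past_noise {s t : ℕ} (hst : s < t) : Measurable[past x ε t] (ε s) :=
  measurable_snd.comp (measurable_past hst)

namespace IsStochasticEnv

variable [MeasurableSpace Ω] {P : Measure Ω} {c₀ : ℝ} {σ : NNReal}

theorem past_le (h : IsStochasticEnv P c₀ σ x ε) (t : ℕ) : past x ε t ≤ ‹MeasurableSpace Ω› :=
  iSup₂_le fun s _ => ((h.measurable_ctx s).prodMk (h.measurable_noise s)).comap_le

theorem indepFun_of_past (h : IsStochasticEnv P c₀ σ x ε) {β : Type*} [MeasurableSpace β]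
    {Y : Ω → β} {t : ℕ} (hY : Measurable[past x ε t] Y) :
    IndepFun Y (fun ω => (x t ω, ε t ω)) P := by
  have h1 := indep_iSup_of_disjoint
    (fun s => ((h.measurable_ctx s).prodMk (h.measurable_noise s)).comap_le) h.indep_rounds.iIndep
    (S := Set.Iio t) (T := {t}) (by simp)
  rw [IndepFun_iff_Indep]
  refine indep_of_indep_of_le_left ?_ hY.comap_le
  simpa only [Set.mem_singleton_iff, iSup_iSup_eq_left] using h1

/-- The joint law of past observations, the current context and the current noise is a product. -/
theorem map_past_ctx [IsProbabilityMeasure P] (h : IsStochasticEnv P c₀ σ x ε) {β : Type*}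
    [MeasurableSpace β] {Y : Ω → β} {t : ℕ} (hY : Measurable[past x ε t] Y) :
    P.map (fun ω => (Y ω, x t ω)) = (P.map Y).prod (P.map (x t)) ∧
      IndepFun (fun ω => (Y ω, x t ω)) (ε t) P := by
  have hYm : Measurable Y := hY.mono (h.past_le t) le_rfl
  have hx := h.measurable_ctx t
  have hε := h.measurable_noise t
  have : IsProbabilityMeasure (P.map Y) := Measure.isProbabilityMeasure_map hYm.aemeasurable
  have : IsProbabilityMeasure (P.map (x t)) := Measure.isProbabilityMeasure_map hx.aemeasurable
  have : IsProbabilityMeasure (P.map (ε t)) := Measure.isProbabilityMeasure_map hε.aemeasurable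
  have hind := h.indepFun_of_past hY
  have h1 : P.map (fun ω => (Y ω, x t ω)) = (P.map Y).prod (P.map (x t)) :=
    (indepFun_iff_map_prod_eq_prod_map_map hYm.aemeasurable hx.aemeasurable).1
      (hind.comp measurable_id measurable_fst)
  refine ⟨h1, ?_⟩
  rw [indepFun_iff_map_prod_eq_prod_map_map (hYm.prodMk hx).aemeasurable hε.aemeasurable, h1]
  have h2 := (indepFun_iff_map_prod_eq_prod_map_map hYm.aemeasurable
    (hx.prodMk hε).aemeasurable).1 hind
  rw [(indepFun_iff_map_prod_eq_prod_map_map hx.aemeasurable hε.aemeasurable).1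
    (h.indep_ctx_noise t)] at h2
  have h3 := (measurePreserving_prodAssoc (P.map Y) (P.map (x t)) (P.map (ε t))).symm.map_eq
  rw [← h3, ← h2, Measure.map_map (MeasurableEquiv.measurable _) (by fun_prop)]
  rfl

theorem map_ctx_absolutelyContinuous (h : IsStochasticEnv P c₀ σ x ε) (t : ℕ) :
    P.map (x t) ≪ sphereUniform d := by
  obtain ⟨f, -, -, hf⟩ := h.law_ctx
  rw [hf t]
  exact withDensity_absolutelyContinuous _ _

theorem map_ctx_eq_zero (h : IsStochasticEnv P c₀ σ x ε) (t : ℕ) {A : Set (Ctx d)}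
    (hA : sphereUniform d A = 0) : P.map (x t) A = 0 :=
  h.map_ctx_absolutelyContinuous t hA

theorem map_ctx_eq (h : IsStochasticEnv P c₀ σ x ε) (t : ℕ) : P.map (x t) = P.map (x 0) := by
  obtain ⟨f, -, -, hf⟩ := h.law_ctx
  rw [hf, hf]

theorem ae_norm_ctx (h : IsStochasticEnv P c₀ σ x ε) (t : ℕ) : ∀ᵐ ω ∂P, ‖x t ω‖ = 1 :=
  ae_of_ae_map (h.measurable_ctx t).aemeasurable
    ((h.map_ctx_absolutelyContinuous t).ae_le ae_sphereUniform_norm_eq_one)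

theorem mul_setLIntegral_le (h : IsStochasticEnv P c₀ σ x ε) (t : ℕ) (F : Ctx d → ENNReal)
    (A : Set (Ctx d)) :
    ENNReal.ofReal c₀ * ∫⁻ u in A, F u ∂(sphereUniform d) ≤ ∫⁻ u in A, F u ∂(P.map (x t)) := by
  obtain ⟨f, hfm, hf, hlaw⟩ := h.law_ctx
  rw [hlaw t, ← smul_eq_mul, ← lintegral_smul_measure, ← Measure.restrict_smul]
  refine lintegral_mono' (Measure.restrict_mono le_rfl ?_) le_rfl
  refine Measure.le_iff.2 fun s hs => ?_
  rw [withDensity_apply _ hs, Measure.smul_apply, smul_eq_mul, ← setLIntegral_const]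
  refine lintegral_mono_ae ?_
  filter_upwards [ae_restrict_of_ae ae_sphereUniform_norm_eq_one] with u hu
  exact ENNReal.ofReal_le_ofReal (hf u hu)

theorem memLp_noise (h : IsStochasticEnv P c₀ σ x ε) (t : ℕ) : MemLp (ε t) 2 P :=
  (h.subgaussian_noise t).memLp 2

theorem integrable_noise (h : IsStochasticEnv P c₀ σ x ε) (t : ℕ) : Integrable (ε t) P :=
  (h.subgaussian_noise t).integrable

theorem integrable_noise_sq (h : IsStochasticEnv P c₀ σ x ε) (t : ℕ) :
    Integrable (fun ω => ε t ω ^ 2) P := (h.memLp_noise t).integrable_sq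

/-- A crude bound for the second moment of sub-Gaussian noise, from `e² ≤ 2 (exp e + exp (-e))`. -/
theorem integral_noise_sq_le (h : IsStochasticEnv P c₀ σ x ε) (t : ℕ) :
    ∫ ω, ε t ω ^ 2 ∂P ≤ 4 * Real.exp ((σ : ℝ) ^ 2 / 2) := by
  have hs := h.subgaussian_noise t
  have h1 := hs.mgf_le 1
  have h2 := hs.mgf_le (-1)
  have i1 := hs.integrable_exp_mul 1
  have i2 := hs.integrable_exp_mul (-1)
  simp only [mgf] at h1 h2
  calc ∫ ω, ε t ω ^ 2 ∂P
      ≤ ∫ ω, 2 * (Real.exp (1 * ε t ω) + Real.exp (-1 * ε t ω)) ∂P := by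
        refine integral_mono (h.integrable_noise_sq t) ((i1.add i2).const_mul 2) fun ω => ?_
        have h3 := Real.quadratic_le_exp_of_nonneg (abs_nonneg (ε t ω))
        have h4 := Real.exp_abs_le (ε t ω)
        rw [sq_abs] at h3
        simp only [one_mul, neg_one_mul]
        linarith [abs_nonneg (ε t ω)]
    _ = 2 * (∫ ω, Real.exp (1 * ε t ω) ∂P + ∫ ω, Real.exp (-1 * ε t ω) ∂P) := by
        rw [integral_const_mul, integral_add i1 i2]
    _ ≤ _ := by
        refine (mul_le_mul_of_nonneg_left (add_le_add h1 h2) zero_le_two).trans (le_of_eq ?_)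
        push_cast
        ring_nf

end IsStochasticEnv

end Env

/-! ### Potential functions of the statistics -/

section Potential

open Matrix hiding gram

variable {d : ℕ}

namespace Stats

/-- The trace of `(S + 1)⁻¹`, where `S` is the Gram matrix. -/
def width (p : Stats d) : ℝ := (p.1 + 1)⁻¹.trace

/-- The accumulated noise `∑ e x` of the responses `r = ⟨θ, x⟩ + e`. -/
def noise (θ : Ctx d) (p : Stats d) : Fin d → ℝ := p.2.ofLp - p.1 *ᵥ θ.ofLp

/-- The self-normalized size `Zᵀ (S + 1)⁻¹ Z` of the accumulated noise `Z`. -/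
def dev (θ : Ctx d) (p : Stats d) : ℝ := p.noise θ ⬝ᵥ (p.1 + 1)⁻¹ *ᵥ p.noise θ

/-- The elliptical potential `log det (S + 1)`. -/
def pot (p : Stats d) : ℝ := Real.log (p.1 + 1).det

/-- The squared length of `y` in the norm given by `(S + 1)⁻¹`. -/
def sqLen (p : Stats d) (y : Ctx d) : ℝ := y.ofLp ⬝ᵥ (p.1 + 1)⁻¹ *ᵥ y.ofLp

variable {p : Stats d} {y θ : Ctx d} {r : ℝ}

theorem dotProduct_self_ofLp (y : Ctx d) : y.ofLp ⬝ᵥ y.ofLp = ‖y‖ ^ 2 := by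
  rw [EuclideanSpace.real_norm_sq_eq]
  simp [dotProduct, sq]

theorem inner_eq_dotProduct (y z : Ctx d) : inner ℝ y z = y.ofLp ⬝ᵥ z.ofLp := by
  rw [EuclideanSpace.inner_eq_star_dotProduct, star_trivial, dotProduct_comm]

theorem posSemidef_push (hp : p.1.PosSemidef) : (p.push y r).1.PosSemidef :=
  hp.add (posSemidef_vecMulVec_self_real _)

theorem push_add_one : (p.push y r).1 + 1 = (p.1 + 1) + vecMulVec y.ofLp y.ofLp :=
  add_right_comm _ _ _

theorem sqLen_nonneg (hp : p.1.PosSemidef) : 0 ≤ p.sqLen y :=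
  quadForm_inv_nonneg (posDef_add_one hp) _

theorem sqLen_le_one (hp : p.1.PosSemidef) (hy : ‖y‖ = 1) : p.sqLen y ≤ 1 := by
  refine (quadForm_inv_add_one_le hp _).trans ?_
  rw [dotProduct_self_ofLp, hy, one_pow]

theorem width_nonneg (hp : p.1.PosSemidef) : 0 ≤ p.width :=
  trace_nonneg_of_posSemidef (posDef_add_one hp).inv.posSemidef

theorem width_push_le (hp : p.1.PosSemidef) : (p.push y r).width ≤ p.width := by
  rw [width, push_add_one]
  exact trace_inv_add_vecMulVec_le (posDef_add_one hp) _

theorem width_zero : width ((0, 0) : Stats d) = d := by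
  simp [width]

theorem dev_nonneg (hp : p.1.PosSemidef) : 0 ≤ p.dev θ :=
  quadForm_inv_nonneg (posDef_add_one hp) _

theorem dev_le (hp : p.1.PosSemidef) : p.dev θ ≤ p.noise θ ⬝ᵥ p.noise θ :=
  quadForm_inv_add_one_le hp _

theorem dev_zero : dev θ ((0, 0) : Stats d) = 0 := by
  simp [dev, noise]

theorem pot_zero : pot ((0, 0) : Stats d) = 0 := by
  simp [pot]

theorem pot_push (hp : p.1.PosSemidef) : (p.push y r).pot = p.pot + Real.log (1 + p.sqLen y) := by
  rw [pot, push_add_one, det_add_vecMulVec_self (posDef_add_one hp),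
    Real.log_mul (posDef_add_one hp).det_pos.ne', pot, sqLen]
  have := quadForm_inv_nonneg (posDef_add_one hp) y.ofLp
  positivity

theorem sqLen_div_le_log {u : ℝ} (hu : 0 ≤ u) : u / (1 + u) ≤ Real.log (1 + u) := by
  have h := Real.one_sub_inv_le_log_of_pos (show 0 < 1 + u by positivity)
  refine le_trans (le_of_eq ?_) h
  field_simp
  ring

theorem sqLen_le_pot_sub (hp : p.1.PosSemidef) (hy : ‖y‖ = 1) :
    p.sqLen y ≤ 2 * ((p.push y r).pot - p.pot) := by
  have h0 := sqLen_nonneg hp (y := y)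
  have h1 := sqLen_le_one hp hy
  have h2 := sqLen_div_le_log h0
  rw [pot_push hp, add_sub_cancel_left]
  have h3 : p.sqLen y / 2 ≤ p.sqLen y / (1 + p.sqLen y) := by gcongr; linarith
  linarith

theorem noise_push (e : ℝ) : (p.push y (inner ℝ θ y + e)).noise θ = p.noise θ + e • y.ofLp := by
  simp only [noise, push, add_mulVec, vecMulVec_mulVec, op_smul_eq_smul, WithLp.ofLp_add,
    WithLp.ofLp_smul, inner_eq_dotProduct, dotProduct_comm y.ofLp]
  module

/-- Recording a context with noise `e` changes the self-normalized noise by a term that is linear in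
`e` and a term that is quadratic in `e`, whose coefficient is at most the increase of the potential;
the coefficient of the linear term is bounded by `2` plus twice the self-normalized noise. -/
theorem dev_push_le (hp : p.1.PosSemidef) (hy : ‖y‖ = 1) (e : ℝ) (r : ℝ) :
    (p.push y (inner ℝ θ y + e)).dev θ ≤ p.dev θ +
        e * (2 * (y.ofLp ⬝ᵥ ((p.push y r).1 + 1)⁻¹ *ᵥ p.noise θ)) +
        e ^ 2 * ((p.push y r).pot - p.pot) ∧
      |2 * (y.ofLp ⬝ᵥ ((p.push y r).1 + 1)⁻¹ *ᵥ p.noise θ)| ≤ 2 + 2 * p.dev θ := by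
  have hV := posDef_add_one hp
  set V := p.1 + 1 with hVdef
  set Z := p.noise θ with hZ
  have hV' : (p.push y r).1 + 1 = V + vecMulVec y.ofLp y.ofLp := push_add_one
  have hV'2 : (p.push y (inner ℝ θ y + e)).1 + 1 = V + vecMulVec y.ofLp y.ofLp := push_add_one
  have hu0 : 0 ≤ p.sqLen y := sqLen_nonneg hp
  have hu1 := sqLen_le_one hp hy
  have hD0 : 0 ≤ p.dev θ := dev_nonneg hp
  have hu : y.ofLp ⬝ᵥ V⁻¹ *ᵥ y.ofLp = p.sqLen y := rfl
  have hD : Z ⬝ᵥ V⁻¹ *ᵥ Z = p.dev θ := rfl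
  have hcomm : Z ⬝ᵥ V⁻¹ *ᵥ y.ofLp = y.ofLp ⬝ᵥ V⁻¹ *ᵥ Z := by
    rw [dotProduct_inv_mulVec_comm hV, dotProduct_comm]
  set k := y.ofLp ⬝ᵥ V⁻¹ *ᵥ Z with hk
  set u := p.sqLen y with hudef
  have hyZ : y.ofLp ⬝ᵥ (V + vecMulVec y.ofLp y.ofLp)⁻¹ *ᵥ Z = k / (1 + u) := by
    rw [quadForm_inv_add_vecMulVec hV, hu, ← hk]
    field_simp
    ring
  have hZy : Z ⬝ᵥ (V + vecMulVec y.ofLp y.ofLp)⁻¹ *ᵥ y.ofLp = k / (1 + u) := by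
    rw [quadForm_inv_add_vecMulVec hV, hu, hcomm]
    field_simp
    ring
  have hyy : y.ofLp ⬝ᵥ (V + vecMulVec y.ofLp y.ofLp)⁻¹ *ᵥ y.ofLp = u / (1 + u) := by
    rw [quadForm_inv_add_vecMulVec hV, hu]
    field_simp
    ring
  have hZZ : Z ⬝ᵥ (V + vecMulVec y.ofLp y.ofLp)⁻¹ *ᵥ Z ≤ p.dev θ := by
    rw [quadForm_inv_add_vecMulVec hV, hu, hD, hcomm, ← hk]
    have : 0 ≤ k * k / (1 + u) := div_nonneg (mul_self_nonneg k) (by linarith)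
    linarith
  rw [hV', hyZ, pot_push hp, add_sub_cancel_left]
  constructor
  · rw [dev, noise_push, hV'2, ← hZ, mulVec_add, mulVec_smul, add_dotProduct, dotProduct_add,
      dotProduct_add, smul_dotProduct, smul_dotProduct, dotProduct_smul, dotProduct_smul, hyZ, hZy,
      hyy]
    simp only [smul_eq_mul]
    have h1 : e ^ 2 * (u / (1 + u)) ≤ e ^ 2 * Real.log (1 + u) := by
      gcongr
      exact sqLen_div_le_log hu0
    linarith
  · have h1 := quadForm_inv_nonneg hV (y.ofLp - Z)
    have h2 := quadForm_inv_nonneg hV (y.ofLp + Z)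
    rw [mulVec_sub, sub_dotProduct, dotProduct_sub, dotProduct_sub, hu, hD, hcomm, ← hk] at h1
    rw [mulVec_add, add_dotProduct, dotProduct_add, dotProduct_add, hu, hD, hcomm, ← hk] at h2
    have h3 : |k| ≤ 1 + p.dev θ := abs_le.2 ⟨by linarith, by linarith⟩
    have h4 : |k / (1 + u)| ≤ |k| := by
      rw [abs_div, abs_of_pos (show 0 < 1 + u by positivity)]
      exact div_le_self (abs_nonneg _) (by linarith)
    rw [abs_mul, abs_two]
    linarith

theorem pot_le_of_trace_le {T : ℝ} (hp : p.1.PosSemidef) (ht : p.1.trace ≤ T) :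
    p.pot ≤ d * Real.log (d + T) := by
  have hV := posDef_add_one hp
  have h1 := det_le_trace_pow hV.posSemidef
  have h2 : (p.1 + 1).trace ≤ d + T := by
    rw [trace_add, trace_one, Fintype.card_fin]
    linarith
  have h3 : 0 ≤ (p.1 + 1).trace := trace_nonneg_of_posSemidef hV.posSemidef
  rw [pot, ← Real.log_pow]
  refine Real.log_le_log hV.det_pos (h1.trans ?_)
  rw [Fintype.card_fin]
  exact pow_le_pow_left₀ h3 h2 d

theorem norm_est_sub_sq_le (hp : p.1.PosSemidef) (hw : p.width ≤ 1 / 2) :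
    ‖p.est - θ‖ ^ 2 ≤ 4 * (p.width * p.dev θ) := by
  obtain ⟨hdet, h⟩ := isUnit_det_and_error_le hp hw
  have h1 := h (p.est - θ).ofLp (p.noise θ) (by
    rw [WithLp.ofLp_sub, mulVec_sub, noise, est]
    simp only [mulVec_mulVec, mul_nonsing_inv _ hdet, one_mulVec])
  rwa [dotProduct_self_ofLp] at h1

end Stats

/-- The difference, on the context `x`, between the actions (as numbers) of the policies that accept
on the half spaces of directions `θ` and `w`. -/
def actionGap (θ w x : Ctx d) : ℝ :=
  (if 0 ≤ inner ℝ θ x then 1 else 0) - (if 0 ≤ inner ℝ w x then 1 else 0)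

/-- The noiseless regret, on the context `x`, of accepting on the half space of direction `w`
instead of the optimal half space of direction `θ`. -/
def instRegret (θ w x : Ctx d) : ℝ := inner ℝ θ x * actionGap θ w x

theorem instRegret_nonneg (θ w x : Ctx d) : 0 ≤ instRegret θ w x := by
  unfold instRegret actionGap
  split_ifs <;> linarith

theorem instRegret_le_norm (θ w : Ctx d) {x : Ctx d} (hx : ‖x‖ = 1) : instRegret θ w x ≤ ‖θ‖ := by
  have h := abs_real_inner_le_norm θ x
  rw [hx, mul_one] at h
  have h1 := abs_le.1 h
  have := norm_nonneg θ
  unfold instRegret actionGap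
  split_ifs <;> linarith

theorem instRegret_le_norm_sub (θ w : Ctx d) {x : Ctx d} (hx : ‖x‖ = 1) :
    instRegret θ w x ≤ ‖w - θ‖ := by
  have h := abs_real_inner_le_norm (w - θ) x
  rw [hx, mul_one, inner_sub_left] at h
  have h1 := abs_le.1 h
  have := norm_nonneg (w - θ)
  unfold instRegret actionGap
  split_ifs <;> linarith

/-- The regret of a least squares policy, in terms of the potentials of its data. -/
theorem instRegret_est_le {p : Stats d} (hp : p.1.PosSemidef) {θ x : Ctx d} (hx : ‖x‖ = 1) {l : ℝ}
    (hl : 0 < l) : instRegret θ p.est x ≤ l * p.width + (p.dev θ + ‖θ‖ ^ 2) / l := by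
  have hw0 := Stats.width_nonneg hp
  have hD0 : 0 ≤ p.dev θ := Stats.dev_nonneg hp
  have hB := norm_nonneg θ
  -- Both cases are instances of the inequality of arithmetic and geometric means.
  have amgm : ∀ a : ℝ, 0 ≤ a → ∀ r : ℝ, r ^ 2 ≤ 4 * (p.width * a) → r ≤ l * p.width + a / l := by
    intro a ha r hr
    refine le_of_sq_le_sq (b := l * p.width + a / l) ?_ (by positivity)
    have h1 : (l * p.width) * (a / l) = p.width * a := by field_simp
    nlinarith [sq_nonneg (l * p.width - a / l)]
  rcases le_or_gt p.width (1 / 2) with hw | hw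
  · refine (instRegret_le_norm_sub θ _ hx).trans ((amgm _ hD0 _
      (Stats.norm_est_sub_sq_le hp hw)).trans ?_)
    gcongr
    nlinarith
  · refine (instRegret_le_norm θ _ hx).trans ((amgm (‖θ‖ ^ 2) (by positivity) _ ?_).trans ?_)
    · nlinarith [sq_nonneg ‖θ‖]
    · gcongr
      linarith

end Potential

/-! ### Expectations of the potentials along a run -/

section Runs

open Matrix hiding gram

variable {d : ℕ} {incl : ℕ → Ctx d → Ctx d → Prop} {θ : Ctx d}

namespace Stats

theorem measurable_ridge_inv : Measurable fun p : Stats d => (p.1 + 1)⁻¹ :=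
  measurable_matrix_inv.comp (continuous_fst.add continuous_const).measurable

theorem measurable_width : Measurable fun p : Stats d => p.width := by
  have h : Continuous fun A : Matrix (Fin d) (Fin d) ℝ => A.trace := continuous_id.matrix_trace
  exact h.measurable.comp measurable_ridge_inv

theorem measurable_pot : Measurable fun p : Stats d => p.pot := by
  have h : Continuous fun p : Stats d => (p.1 + 1).det :=
    (continuous_fst.add continuous_const).matrix_det
  exact Real.measurable_log.comp h.measurable

theorem continuous_noise : Continuous fun p : Stats d => p.noise θ :=
  (continuous_ofLp'.comp continuous_snd).sub (continuous_fst.matrix_mulVec continuous_const)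

theorem measurable_dotProduct_ridge_inv {α : Type*} [MeasurableSpace α] {p : α → Stats d}
    {y z : α → Fin d → ℝ} (hp : Measurable p) (hy : Measurable y) (hz : Measurable z) :
    Measurable fun a => y a ⬝ᵥ ((p a).1 + 1)⁻¹ *ᵥ z a := by
  have h : Continuous fun q : Matrix (Fin d) (Fin d) ℝ × (Fin d → ℝ) × (Fin d → ℝ) =>
      q.2.1 ⬝ᵥ q.1 *ᵥ q.2.2 :=
    (continuous_fst.comp continuous_snd).dotProduct
      (continuous_fst.matrix_mulVec (continuous_snd.comp continuous_snd))
  exact h.measurable.comp ((measurable_ridge_inv.comp hp).prodMk (hy.prodMk hz))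

theorem measurable_dev : Measurable fun p : Stats d => p.dev θ :=
  measurable_dotProduct_ridge_inv measurable_id continuous_noise.measurable
    continuous_noise.measurable

theorem measurable_sqLen : Measurable fun q : Stats d × Ctx d => q.1.sqLen q.2 :=
  measurable_dotProduct_ridge_inv measurable_fst
    (continuous_ofLp'.measurable.comp measurable_snd)
    (continuous_ofLp'.measurable.comp measurable_snd)

end Stats

section Paths

variable {x : ℕ → Ctx d} {ε : ℕ → ℝ}

theorem posSemidef_runStats (t : ℕ) : (runStats incl θ x ε t).1.PosSemidef := by
  induction t with
  | zero => exact PosSemidef.zero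
  | succ t ih =>
    simp only [runStats]
    split_ifs
    · exact Stats.posSemidef_push ih
    · exact ih

theorem trace_runStats_le (hx : ∀ s, ‖x s‖ = 1) (t : ℕ) :
    (runStats incl θ x ε t).1.trace ≤ t := by
  induction t with
  | zero => simp [runStats]
  | succ t ih =>
    simp only [runStats]
    push_cast
    split_ifs
    · rw [Stats.push, trace_add, trace_vecMulVec, Stats.dotProduct_self_ofLp, hx]
      linarith
    · linarith

theorem pot_runStats_le (hx : ∀ s, ‖x s‖ = 1) (t : ℕ) :
    (runStats incl θ x ε t).pot ≤ d * Real.log (d + t) :=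
  Stats.pot_le_of_trace_le (posSemidef_runStats t) (trace_runStats_le hx t)

theorem pot_runStats_le_succ (t : ℕ) :
    (runStats incl θ x ε t).pot ≤ (runStats incl θ x ε (t + 1)).pot := by
  simp only [runStats]
  split_ifs
  · rw [Stats.pot_push (posSemidef_runStats t)]
    have := Stats.sqLen_nonneg (posSemidef_runStats (incl := incl) (θ := θ) (x := x) (ε := ε) t)
      (y := x t)
    have := Real.log_nonneg (show 1 ≤ 1 + (runStats incl θ x ε t).sqLen (x t) by linarith)
    linarith
  · exact le_rfl

theorem pot_runStats_nonneg (t : ℕ) : 0 ≤ (runStats incl θ x ε t).pot := by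
  induction t with
  | zero => exact Stats.pot_zero.ge
  | succ t ih => exact ih.trans (pot_runStats_le_succ t)

theorem width_runStats_antitone : Antitone fun t => (runStats incl θ x ε t).width := by
  refine antitone_nat_of_succ_le fun t => ?_
  simp only [runStats]
  split_ifs
  · exact Stats.width_push_le (posSemidef_runStats t)
  · exact le_rfl

theorem width_runStats_le (t : ℕ) : (runStats incl θ x ε t).width ≤ d :=
  (width_runStats_antitone (Nat.zero_le t)).trans Stats.width_zero.le

theorem norm_noise_runStats_le (hx : ∀ s, ‖x s‖ = 1) (t : ℕ) :
    ‖(WithLp.toLp 2 ((runStats incl θ x ε t).noise θ) : Ctx d)‖ ≤ ∑ s ∈ Finset.range t, |ε s| := by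
  induction t with
  | zero => simp [runStats, Stats.noise]
  | succ t ih =>
    rw [Finset.sum_range_succ]
    simp only [runStats]
    split_ifs
    · rw [Stats.noise_push, WithLp.toLp_add, WithLp.toLp_smul]
      refine (norm_add_le _ _).trans (add_le_add ih ?_)
      rw [norm_smul, WithLp.toLp_ofLp, hx, mul_one, Real.norm_eq_abs]
    · linarith [abs_nonneg (ε t)]

theorem dev_runStats_le (hx : ∀ s, ‖x s‖ = 1) (t : ℕ) :
    (runStats incl θ x ε t).dev θ ≤ (∑ s ∈ Finset.range t, |ε s|) ^ 2 := by
  refine (Stats.dev_le (posSemidef_runStats t)).trans ?_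
  have h := pow_le_pow_left₀ (norm_nonneg _) (norm_noise_runStats_le (incl := incl) (θ := θ)
    (ε := ε) hx t) 2
  rwa [← Stats.dotProduct_self_ofLp] at h

end Paths

/-- The measure `μ`, restricted to `A`, has second moment at least `q` in every direction. -/
def HasSecondMoments (μ : Measure (Ctx d)) (q : ℝ) (A : Set (Ctx d)) : Prop :=
  ∀ v : Ctx d, ENNReal.ofReal (q * ‖v‖ ^ 2) ≤ ∫⁻ y in A, ENNReal.ofReal (inner ℝ v y ^ 2) ∂μ

/-- The squared length `yᵀ V⁻¹ y = ∑ ⟨Nᵢ, y⟩²`, for a factorization `V⁻¹ = Nᵀ N`, is a sum of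
squares in the directions `Nᵢ`, whose squared norms add up to `tr V⁻¹`. -/
theorem HasSecondMoments.le_lintegral_sqLen {μ : Measure (Ctx d)} {q : ℝ} (hq : 0 ≤ q)
    {A : Set (Ctx d)} (h : HasSecondMoments μ q A) {p : Stats d} (hp : p.1.PosSemidef) :
    ENNReal.ofReal (q * p.width) ≤ ∫⁻ y in A, ENNReal.ofReal (p.sqLen y) ∂μ := by
  obtain ⟨N, hN⟩ := exists_eq_transpose_mul_self (posDef_add_one hp).inv.posSemidef
  have h1 : p.width = ∑ i, ‖(WithLp.toLp 2 (N i) : Ctx d)‖ ^ 2 := by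
    rw [Stats.width, hN, trace_transpose_mul_self]
    exact Finset.sum_congr rfl fun i _ => by rw [← Stats.dotProduct_self_ofLp]
  have h2 : ∀ y, p.sqLen y = ∑ i, inner ℝ (WithLp.toLp 2 (N i) : Ctx d) y ^ 2 := by
    intro y
    rw [Stats.sqLen, hN, dotProduct_transpose_mul_self_mulVec]
    exact Finset.sum_congr rfl fun i _ => by rw [Stats.inner_eq_dotProduct]
  simp_rw [h2]
  rw [h1, Finset.mul_sum, ENNReal.ofReal_sum_of_nonneg fun i _ => by positivity]
  have h3 : ∀ y : Ctx d, ENNReal.ofReal (∑ i, inner ℝ (WithLp.toLp 2 (N i) : Ctx d) y ^ 2) =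
      ∑ i, ENNReal.ofReal (inner ℝ (WithLp.toLp 2 (N i) : Ctx d) y ^ 2) :=
    fun y => ENNReal.ofReal_sum_of_nonneg fun i _ => sq_nonneg _
  simp_rw [h3]
  rw [lintegral_finsetSum _ fun i _ =>
    measurable_ofReal_inner_sq (f := fun y => y) continuous_id (WithLp.toLp 2 (N i))]
  exact Finset.sum_le_sum fun i _ => h _

/-- The statistics of the learner as random variables. -/
abbrev envStats {Ω : Type*} (incl : ℕ → Ctx d → Ctx d → Prop) (θ : Ctx d) (x : ℕ → Ω → Ctx d)
    (ε : ℕ → Ω → ℝ) (t : ℕ) (ω : Ω) : Stats d :=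
  runStats incl θ (fun s => x s ω) (fun s => ε s ω) t

theorem measurable_past_envStats {Ω : Type*} {x : ℕ → Ω → Ctx d} {ε : ℕ → Ω → ℝ}
    (hi : MeasurableIncl incl) (t : ℕ) : Measurable[past x ε t] (envStats incl θ x ε t) :=
  @measurable_runStats d Ω (past x ε t) incl hi θ x ε t (fun _ hs => measurable_past_ctx hs)
    fun _ hs => measurable_past_noise hs

namespace IsStochasticEnv

variable {Ω : Type*} [MeasurableSpace Ω] {P : Measure Ω} {c₀ : ℝ} {σ : NNReal}
  {x : ℕ → Ω → Ctx d} {ε : ℕ → Ω → ℝ}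

local notation "st" => envStats incl θ x ε

theorem ae_forall_norm_ctx (h : IsStochasticEnv P c₀ σ x ε) : ∀ᵐ ω ∂P, ∀ s, ‖x s ω‖ = 1 :=
  ae_all_iff.2 h.ae_norm_ctx

theorem measurable_envStats (h : IsStochasticEnv P c₀ σ x ε) (hi : MeasurableIncl incl) (t : ℕ) :
    Measurable (st t) :=
  measurable_runStats hi θ t (fun s _ => h.measurable_ctx s) fun s _ => h.measurable_noise s

theorem integrable_width [IsProbabilityMeasure P] (h : IsStochasticEnv P c₀ σ x ε)
    (hi : MeasurableIncl incl) (t : ℕ) : Integrable (fun ω => (st t ω).width) P :=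
  Integrable.of_bound
    (Stats.measurable_width.comp (h.measurable_envStats hi t)).aestronglyMeasurable d
    (ae_of_all _ fun ω => by
      rw [Real.norm_of_nonneg (Stats.width_nonneg (posSemidef_runStats t))]
      exact width_runStats_le t)

theorem integrable_pot [IsProbabilityMeasure P] (h : IsStochasticEnv P c₀ σ x ε)
    (hi : MeasurableIncl incl) (t : ℕ) : Integrable (fun ω => (st t ω).pot) P :=
  Integrable.of_bound (Stats.measurable_pot.comp (h.measurable_envStats hi t)).aestronglyMeasurable
    (d * Real.log (d + t)) (by
      filter_upwards [h.ae_forall_norm_ctx] with ω hω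
      rw [Real.norm_of_nonneg (pot_runStats_nonneg t)]
      exact pot_runStats_le hω t)

theorem integral_pot_le [IsProbabilityMeasure P] (h : IsStochasticEnv P c₀ σ x ε)
    (hi : MeasurableIncl incl) (t : ℕ) : ∫ ω, (st t ω).pot ∂P ≤ d * Real.log (d + t) := by
  refine (integral_mono_ae (h.integrable_pot hi t) (integrable_const (d * Real.log (d + t)))
    ?_).trans (by simp)
  filter_upwards [h.ae_forall_norm_ctx] with ω hω
  exact pot_runStats_le hω t

theorem integrable_dev [IsProbabilityMeasure P] (h : IsStochasticEnv P c₀ σ x ε)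
    (hi : MeasurableIncl incl) (t : ℕ) : Integrable (fun ω => (st t ω).dev θ) P := by
  have h1 : MemLp (fun ω => ∑ s ∈ Finset.range t, |ε s ω|) 2 P :=
    memLp_finsetSum _ fun s _ => (h.memLp_noise s).abs
  refine h1.integrable_sq.mono'
    (Stats.measurable_dev.comp (h.measurable_envStats hi t)).aestronglyMeasurable ?_
  filter_upwards [h.ae_forall_norm_ctx] with ω hω
  rw [Real.norm_of_nonneg (Stats.dev_nonneg (posSemidef_runStats t))]
  exact dev_runStats_le hω t

/-- The expected self-normalized noise grows at most as fast as the potential: the noise of a round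
is centered and independent of the past and of the context, so only its variance contributes. -/
theorem integral_dev_succ_le [IsProbabilityMeasure P] (h : IsStochasticEnv P c₀ σ x ε)
    (hi : MeasurableIncl incl) (t : ℕ) :
    ∫ ω, (st (t + 1) ω).dev θ ∂P ≤ ∫ ω, (st t ω).dev θ ∂P + 4 * Real.exp ((σ : ℝ) ^ 2 / 2) *
      (∫ ω, (st (t + 1) ω).pot ∂P - ∫ ω, (st t ω).pot ∂P) := by
  classical
  let cross : Stats d × Ctx d → ℝ := fun q => if incl t q.1.est q.2 then
    2 * (q.2.ofLp ⬝ᵥ ((q.1.push q.2 0).1 + 1)⁻¹ *ᵥ q.1.noise θ) else 0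
  let gain : Stats d × Ctx d → ℝ := fun q => if incl t q.1.est q.2 then
    (q.1.push q.2 0).pot - q.1.pot else 0
  have hpush : Measurable fun q : Stats d × Ctx d => q.1.push q.2 0 :=
    Stats.measurable_push.comp (measurable_fst.prodMk (measurable_snd.prodMk measurable_const))
  have hcross : Measurable cross := by
    refine Measurable.ite (hi.measurableSet t) (Measurable.const_mul ?_ 2) measurable_const
    exact Stats.measurable_dotProduct_ridge_inv hpush
      (continuous_ofLp'.measurable.comp measurable_snd)
      (Stats.continuous_noise.measurable.comp measurable_fst)
  have hgain : Measurable gain := by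
    refine Measurable.ite (hi.measurableSet t) ?_ measurable_const
    exact (Stats.measurable_pot.comp hpush).sub (Stats.measurable_pot.comp measurable_fst)
  have hst := h.measurable_envStats (θ := θ) hi t
  have hpair : Measurable fun ω => (st t ω, x t ω) := hst.prodMk (h.measurable_ctx t)
  have hind : IndepFun (fun ω => (st t ω, x t ω)) (ε t) P :=
    (h.map_past_ctx (measurable_past_envStats hi t)).2
  have hgain_eq : ∀ ω, gain (st t ω, x t ω) = (st (t + 1) ω).pot - (st t ω).pot := by
    intro ω
    simp only [gain, envStats, runStats]
    split_ifs
    · rw [Stats.pot_push (posSemidef_runStats t), Stats.pot_push (posSemidef_runStats t)]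
    · simp
  have hgain_int : Integrable (fun ω => gain (st t ω, x t ω)) P := by
    simp_rw [hgain_eq]
    exact (h.integrable_pot hi (t + 1)).sub (h.integrable_pot hi t)
  have hstep : ∀ᵐ ω ∂P, (st (t + 1) ω).dev θ ≤ (st t ω).dev θ +
      ε t ω * cross (st t ω, x t ω) + ε t ω ^ 2 * gain (st t ω, x t ω) ∧
      |cross (st t ω, x t ω)| ≤ 2 + 2 * (st t ω).dev θ := by
    filter_upwards [h.ae_forall_norm_ctx] with ω hω
    have hp := posSemidef_runStats (incl := incl) (θ := θ) (x := fun s => x s ω)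
      (ε := fun s => ε s ω) t
    have key := Stats.dev_push_le (θ := θ) hp (hω t) (ε t ω) 0
    have hdev := Stats.dev_nonneg (θ := θ) hp
    simp only [cross, gain, envStats, runStats]
    split_ifs
    · exact key
    · simp only [mul_zero, add_zero, abs_zero]
      exact ⟨le_rfl, by linarith⟩
  have hcross_int : Integrable (fun ω => cross (st t ω, x t ω)) P := by
    refine Integrable.mono'
      ((integrable_const 2).add ((h.integrable_dev (θ := θ) hi t).const_mul 2))
      (hcross.comp hpair).aestronglyMeasurable ?_
    filter_upwards [hstep] with ω hω
    exact hω.2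
  have hic : IndepFun (ε t) (fun ω => cross (st t ω, x t ω)) P :=
    (hind.comp hcross measurable_id).symm
  have hig : IndepFun (fun ω => ε t ω ^ 2) (fun ω => gain (st t ω, x t ω)) P :=
    (hind.comp (φ := gain) (ψ := fun e : ℝ => e ^ 2) hgain (by fun_prop)).symm
  have i1 : Integrable (fun ω => ε t ω * cross (st t ω, x t ω)) P :=
    hic.integrable_mul (h.integrable_noise t) hcross_int
  have i2 : Integrable (fun ω => ε t ω ^ 2 * gain (st t ω, x t ω)) P :=
    hig.integrable_mul (h.integrable_noise_sq t) hgain_int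
  have i3 : Integrable (fun ω => (st t ω).dev θ + ε t ω * cross (st t ω, x t ω)) P :=
    (h.integrable_dev hi t).add i1
  have e1 : ∫ ω, ε t ω * cross (st t ω, x t ω) ∂P = 0 := by
    rw [hic.integral_fun_mul_eq_mul_integral (h.integrable_noise t).aestronglyMeasurable
      hcross_int.aestronglyMeasurable, h.mean_noise, zero_mul]
  have e2 : ∫ ω, ε t ω ^ 2 * gain (st t ω, x t ω) ∂P ≤ 4 * Real.exp ((σ : ℝ) ^ 2 / 2) *
      (∫ ω, (st (t + 1) ω).pot ∂P - ∫ ω, (st t ω).pot ∂P) := by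
    rw [hig.integral_fun_mul_eq_mul_integral (h.integrable_noise_sq t).aestronglyMeasurable
      hgain_int.aestronglyMeasurable]
    have e3 : ∫ ω, gain (st t ω, x t ω) ∂P =
        ∫ ω, (st (t + 1) ω).pot ∂P - ∫ ω, (st t ω).pot ∂P := by
      simp_rw [hgain_eq]
      exact integral_sub (h.integrable_pot hi (t + 1)) (h.integrable_pot hi t)
    rw [e3]
    refine mul_le_mul_of_nonneg_right (h.integral_noise_sq_le t) (sub_nonneg.2 ?_)
    exact integral_mono (h.integrable_pot hi t) (h.integrable_pot hi (t + 1))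
      fun ω => pot_runStats_le_succ t
  calc ∫ ω, (st (t + 1) ω).dev θ ∂P
      ≤ ∫ ω, ((st t ω).dev θ + ε t ω * cross (st t ω, x t ω) +
          ε t ω ^ 2 * gain (st t ω, x t ω)) ∂P :=
        integral_mono_ae (h.integrable_dev hi (t + 1)) (i3.add i2)
          (hstep.mono fun ω hω => hω.1)
    _ = ∫ ω, (st t ω).dev θ ∂P + ∫ ω, ε t ω * cross (st t ω, x t ω) ∂P +
          ∫ ω, ε t ω ^ 2 * gain (st t ω, x t ω) ∂P := by
        rw [integral_add i3 i2, integral_add (h.integrable_dev hi t) i1]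
    _ ≤ _ := by rw [e1, add_zero]; gcongr

theorem integral_dev_le [IsProbabilityMeasure P] (h : IsStochasticEnv P c₀ σ x ε)
    (hi : MeasurableIncl incl) (t : ℕ) :
    ∫ ω, (st t ω).dev θ ∂P ≤ 4 * Real.exp ((σ : ℝ) ^ 2 / 2) * (d * Real.log (d + t)) := by
  have key : ∫ ω, (st t ω).dev θ ∂P ≤
      4 * Real.exp ((σ : ℝ) ^ 2 / 2) * ∫ ω, (st t ω).pot ∂P := by
    induction t with
    | zero => simp [envStats, runStats, Stats.dev_zero, Stats.pot_zero]
    | succ t ih =>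
      have := h.integral_dev_succ_le (θ := θ) hi t
      linarith
  exact key.trans (mul_le_mul_of_nonneg_left (h.integral_pot_le hi t) (by positivity))

/-- If the recorded part of the context distribution has second moments at least `q`, then a round
increases the potential in proportion to the trace of `(S + 1)⁻¹`. -/
theorem mul_integral_width_le [IsProbabilityMeasure P] (h : IsStochasticEnv P c₀ σ x ε)
    (hi : MeasurableIncl incl) {q : ℝ} (hq : 0 ≤ q) (t : ℕ)
    (hcap : ∀ᵐ ω ∂P, HasSecondMoments (P.map (x 0)) q {y | incl t (st t ω).est y}) :
    q * ∫ ω, (st t ω).width ∂P ≤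
      2 * (∫ ω, (st (t + 1) ω).pot ∂P - ∫ ω, (st t ω).pot ∂P) := by
  classical
  have hst := h.measurable_envStats (θ := θ) hi t
  have hinc : ∀ᵐ ω ∂P, (if incl t (st t ω).est (x t ω) then (st t ω).sqLen (x t ω) else 0) ≤
      2 * ((st (t + 1) ω).pot - (st t ω).pot) := by
    filter_upwards [h.ae_forall_norm_ctx] with ω hω
    simp only [envStats, runStats]
    split_ifs
    · exact Stats.sqLen_le_pot_sub (posSemidef_runStats t) (hω t)
    · simp
  have hint : Integrable (fun ω => 2 * ((st (t + 1) ω).pot - (st t ω).pot)) P :=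
    ((h.integrable_pot hi (t + 1)).sub (h.integrable_pot hi t)).const_mul 2
  have hle : ENNReal.ofReal (q * ∫ ω, (st t ω).width ∂P) ≤
      ENNReal.ofReal (2 * (∫ ω, (st (t + 1) ω).pot ∂P - ∫ ω, (st t ω).pot ∂P)) := by
    let F : Stats d × Ctx d → ENNReal := fun r =>
      if incl t r.1.est r.2 then ENNReal.ofReal (r.1.sqLen r.2) else 0
    have hF : Measurable F :=
      Measurable.ite (hi.measurableSet t) Stats.measurable_sqLen.ennreal_ofReal measurable_const
    have : IsProbabilityMeasure (P.map (x t)) :=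
      Measure.isProbabilityMeasure_map (h.measurable_ctx t).aemeasurable
    calc ENNReal.ofReal (q * ∫ ω, (st t ω).width ∂P)
        = ∫⁻ ω, ENNReal.ofReal (q * (st t ω).width) ∂P := by
          rw [← integral_const_mul, ofReal_integral_eq_lintegral_ofReal
            ((h.integrable_width hi t).const_mul q)]
          exact ae_of_all _ fun ω => mul_nonneg hq (Stats.width_nonneg (posSemidef_runStats t))
      _ ≤ ∫⁻ ω, ∫⁻ y, F (st t ω, y) ∂(P.map (x t)) ∂P := by
          refine lintegral_mono_ae ?_
          filter_upwards [hcap] with ω hω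
          refine (hω.le_lintegral_sqLen hq (posSemidef_runStats t)).trans (le_of_eq ?_)
          have hm : MeasurableSet {y | incl t (st t ω).est y} :=
            measurable_prodMk_left (hi.measurableSet t) (x := st t ω)
          rw [← lintegral_indicator hm, h.map_ctx_eq t]
          rfl
      _ = ∫⁻ r, F r ∂((P.map (st t)).prod (P.map (x t))) := by
          rw [lintegral_prod _ hF.aemeasurable, lintegral_map hF.lintegral_prod_right' hst]
      _ = ∫⁻ ω, F (st t ω, x t ω) ∂P := by
          rw [← (h.map_past_ctx (measurable_past_envStats hi t)).1,
            lintegral_map hF (hst.prodMk (h.measurable_ctx t))]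
      _ ≤ ∫⁻ ω, ENNReal.ofReal (2 * ((st (t + 1) ω).pot - (st t ω).pot)) ∂P := by
          refine lintegral_mono_ae ?_
          filter_upwards [hinc] with ω hω
          refine le_trans (le_of_eq ?_) (ENNReal.ofReal_le_ofReal hω)
          simp only [F]
          split_ifs <;> simp
      _ = _ := by
          rw [← ofReal_integral_eq_lintegral_ofReal hint, integral_const_mul]
          · congr 2
            exact integral_sub (h.integrable_pot hi (t + 1)) (h.integrable_pot hi t)
          · exact ae_of_all _ fun ω => mul_nonneg zero_le_two
              (sub_nonneg.2 (pot_runStats_le_succ t))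
  refine (ENNReal.ofReal_le_ofReal_iff (mul_nonneg zero_le_two (sub_nonneg.2 ?_))).1 hle
  exact integral_mono (h.integrable_pot hi t) (h.integrable_pot hi (t + 1))
    fun ω => pot_runStats_le_succ t

theorem mul_sum_integral_width_le [IsProbabilityMeasure P] (h : IsStochasticEnv P c₀ σ x ε)
    (hi : MeasurableIncl incl) {q : ℝ} (hq : 0 ≤ q) {a b : ℕ} (hab : a ≤ b)
    (hcap : ∀ t, a ≤ t → t < b →
      ∀ᵐ ω ∂P, HasSecondMoments (P.map (x 0)) q {y | incl t (st t ω).est y}) :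
    q * ∑ t ∈ Finset.Ico a b, ∫ ω, (st t ω).width ∂P ≤ 2 * (d * Real.log (d + b)) := by
  have h1 : q * ∑ t ∈ Finset.Ico a b, ∫ ω, (st t ω).width ∂P ≤
      ∑ t ∈ Finset.Ico a b, 2 * (∫ ω, (st (t + 1) ω).pot ∂P - ∫ ω, (st t ω).pot ∂P) := by
    rw [Finset.mul_sum]
    refine Finset.sum_le_sum fun t ht => ?_
    rw [Finset.mem_Ico] at ht
    exact h.mul_integral_width_le hi hq t (hcap t ht.1 ht.2)
  refine h1.trans ?_
  rw [← Finset.mul_sum, Finset.sum_Ico_sub (fun t => ∫ ω, (st t ω).pot ∂P) hab]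
  have h2 : 0 ≤ ∫ ω, (st a ω).pot ∂P := integral_nonneg fun ω => pot_runStats_nonneg a
  have h3 := h.integral_pot_le (θ := θ) hi b
  linarith

end IsStochasticEnv

end Runs

/-! ### The second moments of the recorded contexts -/

section SecondMoments

open Matrix hiding gram

variable {d : ℕ} {Ω : Type*} [MeasurableSpace Ω] {P : Measure Ω} {c₀ : ℝ} {σ : NNReal}
  {x : ℕ → Ω → Ctx d} {ε : ℕ → Ω → ℝ} {incl : ℕ → Ctx d → Ctx d → Prop} {θ : Ctx d}

namespace IsStochasticEnv

theorem hasSecondMoments_of_le (h : IsStochasticEnv P c₀ σ x ε) (hc : 0 < c₀) {q : ℝ}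
    {A : Set (Ctx d)} (hA : ∀ v : Ctx d, ENNReal.ofReal (q * ‖v‖ ^ 2) ≤
      ∫⁻ u in A, ENNReal.ofReal (inner ℝ v u ^ 2) ∂(sphereUniform d)) :
    HasSecondMoments (P.map (x 0)) (c₀ * q) A := by
  intro v
  refine le_trans ?_ (h.mul_setLIntegral_le 0 _ A)
  rw [mul_assoc, ENNReal.ofReal_mul hc.le]
  gcongr
  exact hA v

theorem hasSecondMoments_etcIncl (h : IsStochasticEnv P c₀ σ x ε) (hc : 0 < c₀) (hd : 0 < d)
    {n t : ℕ} (ht : t < n) (β : Ctx d) :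
    HasSecondMoments (P.map (x 0)) (c₀ * (1 / (8 * d))) {y | etcIncl d n t β y} := by
  have hset : {y | etcIncl d n t β y} = Set.univ := Set.eq_univ_of_forall fun _ => ht
  rw [hset]
  refine h.hasSecondMoments_of_le hc fun v => ?_
  rw [Measure.restrict_univ]
  exact le_lintegral_sphere_inner_sq hd v

theorem hasSecondMoments_saIncl (h : IsStochasticEnv P c₀ σ x ε) (hc : 0 < c₀) (hd : 0 < d)
    {δ : ℝ} (h0 : 0 < δ) (h1 : δ < 1) {t : ℕ} (ht : d ≤ t) {β : Ctx d} (hβ : β ≠ 0) :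
    HasSecondMoments (P.map (x 0)) (c₀ * ((1 - δ) ^ d / (4096 * d))) {y | saIncl d δ t β y} := by
  have hn : 0 < ‖β‖ := norm_pos_iff.2 hβ
  have hset : {y | saIncl d δ t β y} = {u | δ < inner ℝ (‖β‖⁻¹ • β) u} := by
    ext y
    change (t < d ∨ δ * ‖β‖ < inner ℝ β y) ↔ δ < inner ℝ (‖β‖⁻¹ • β) y
    rw [real_inner_smul_left, inv_mul_eq_div, lt_div_iff₀ hn]
    simp [not_lt.2 ht]
  rw [hset]
  refine h.hasSecondMoments_of_le hc fun v => le_lintegral_cap_inner_sq hd h0 h1 ?_ v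
  rw [norm_smul, norm_inv, norm_norm, inv_mul_cancel₀ hn.ne']

/-- A relation between the past and the current context has probability zero if all its sections are
null sets of the sphere. -/
theorem ae_notMem_of_past [IsProbabilityMeasure P] (h : IsStochasticEnv P c₀ σ x ε) {β : Type*}
    [MeasurableSpace β] {Y : Ω → β} {t : ℕ} (hY : Measurable[past x ε t] Y) {B : Set (β × Ctx d)}
    (hB : MeasurableSet B) (hsec : ∀ b, sphereUniform d {y | (b, y) ∈ B} = 0) :
    ∀ᵐ ω ∂P, (Y ω, x t ω) ∉ B := by
  have hYm : Measurable Y := hY.mono (h.past_le t) le_rfl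
  have hx := h.measurable_ctx t
  have : IsProbabilityMeasure (P.map (x t)) := Measure.isProbabilityMeasure_map hx.aemeasurable
  refine ae_of_ae_map (p := fun r => r ∉ B) (hYm.prodMk hx).aemeasurable ?_
  rw [(h.map_past_ctx hY).1]
  refine measure_eq_zero_iff_ae_notMem.1 ?_
  rw [Measure.measure_prod_null hB]
  exact ae_of_all _ fun b => h.map_ctx_eq_zero t (hsec b)

/-- The contexts are almost surely in general position, as each new one avoids the span of the
previous ones. -/
theorem ae_linearIndependent [IsProbabilityMeasure P] (h : IsStochasticEnv P c₀ σ x ε)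
    (hd : 0 < d) (t : ℕ) (ht : t ≤ d) :
    ∀ᵐ ω ∂P, LinearIndependent ℝ fun i : Fin t => x i ω := by
  induction t with
  | zero => exact ae_of_all _ fun ω => linearIndependent_empty_type
  | succ t ih =>
    let B : Set ((Fin t → Ctx d) × Ctx d) := {r | LinearIndependent ℝ r.1 ∧
      ¬ LinearIndependent ℝ (Fin.snoc r.1 r.2 : Fin (t + 1) → Ctx d)}
    have hsnoc : Continuous fun r : (Fin t → Ctx d) × Ctx d =>
        (Fin.snoc r.1 r.2 : Fin (t + 1) → Ctx d) :=
      Continuous.finSnoc continuous_fst continuous_snd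
    have hB : MeasurableSet B :=
      (isOpen_setOfPred_linearIndependent.measurableSet.preimage measurable_fst).inter
        ((isOpen_setOfPred_linearIndependent.measurableSet.preimage hsnoc.measurable).compl)
    have hY : Measurable[past x ε t] fun ω => fun i : Fin t => x i ω :=
      @measurable_pi_iff _ _ _ (past x ε t) _ _ |>.2 fun i => measurable_past_ctx i.2
    have key := h.ae_notMem_of_past hY hB fun b => by
      by_cases hb : LinearIndependent ℝ b
      · refine measure_mono_null ?_ (sphereUniform_submodule hd
          (W := Submodule.span ℝ (Set.range b)) ?_)
        · rintro y ⟨-, hy⟩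
          rw [linearIndependent_finSnoc] at hy
          by_contra h2
          exact hy ⟨hb, h2⟩
        · intro h2
          have h3 := finrank_range_le_card (R := ℝ) b
          rw [Set.finrank, h2, finrank_top, finrank_euclideanSpace, Fintype.card_fin,
            Fintype.card_fin] at h3
          omega
      · refine measure_mono_null ?_ measure_empty
        rintro y ⟨hy, -⟩
        exact hb hy
    filter_upwards [key, ih (by omega)] with ω h1 h2
    have h3 : LinearIndependent ℝ (Fin.snoc (fun i : Fin t => x i ω) (x t ω) :
        Fin (t + 1) → Ctx d) := by
      by_contra h4
      exact h1 ⟨h2, h4⟩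
    convert h3 using 1
    ext1 i
    refine Fin.lastCases ?_ (fun j => ?_) i <;> simp

local notation "st" => envStats incl θ x ε

/-- Unless `θ = 0`, almost surely the first response does not vanish, and then no later record makes
the sum `∑ r x` vanish, because no context is parallel to the sum so far. -/
theorem ae_snd_ne_zero [IsProbabilityMeasure P] (h : IsStochasticEnv P c₀ σ x ε) (hd : 2 ≤ d)
    (hθ : θ ≠ 0) (hi : MeasurableIncl incl) (hi0 : ∀ β y, incl 0 β y) (t : ℕ) :
    ∀ᵐ ω ∂P, (st (t + 1) ω).2 ≠ 0 := by
  induction t with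
  | zero =>
    have hx := h.measurable_ctx 0
    have hε := h.measurable_noise 0
    have : IsProbabilityMeasure (P.map (x 0)) := Measure.isProbabilityMeasure_map hx.aemeasurable
    have h1 : ∀ᵐ ω ∂P, inner ℝ θ (x 0 ω) + ε 0 ω ≠ 0 := by
      refine ae_of_ae_map (p := fun r : ℝ × Ctx d => inner ℝ θ r.2 + r.1 ≠ 0)
        (hε.prodMk hx).aemeasurable ?_
      rw [(indepFun_iff_map_prod_eq_prod_map_map hε.aemeasurable hx.aemeasurable).1
        (h.indep_ctx_noise 0).symm]
      have hB : MeasurableSet {r : ℝ × Ctx d | inner ℝ θ r.2 + r.1 = 0} :=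
        measurableSet_eq_fun (by fun_prop) measurable_const
      have h2 := (Measure.measure_prod_null (μ := P.map (ε 0)) (ν := P.map (x 0)) hB).2
        (ae_of_all _ fun e => h.map_ctx_eq_zero 0 (by
          refine measure_mono_null ?_ (sphereUniform_inner_eq hd hθ (-e))
          intro y hy
          exact eq_neg_of_add_eq_zero_left hy))
      exact measure_eq_zero_iff_ae_notMem.1 h2
    filter_upwards [h1, h.ae_norm_ctx 0] with ω h1 h2
    have h3 : x 0 ω ≠ 0 := by
      rw [← norm_ne_zero_iff, h2]
      exact one_ne_zero
    simpa [envStats, runStats, hi0, Stats.push] using ⟨h1, h3⟩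
  | succ t ih =>
    let B : Set (Stats d × Ctx d) := {r | r.1.2 ≠ 0 ∧ |inner ℝ r.1.2 r.2| = ‖r.1.2‖ * ‖r.2‖ ∧
      r.2 ≠ 0}
    have hB : MeasurableSet B := by
      refine MeasurableSet.inter ?_ (MeasurableSet.inter ?_ ?_)
      · exact ((measurableSet_singleton 0).preimage
          (measurable_snd.comp measurable_fst)).compl
      · exact measurableSet_eq_fun (by fun_prop) (by fun_prop)
      · exact ((measurableSet_singleton 0).preimage measurable_snd).compl
    have key := h.ae_notMem_of_past (measurable_past_envStats (θ := θ) hi (t + 1)) hB fun p => by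
      refine measure_mono_null ?_
        (sphereUniform_submodule (by omega) (span_singleton_ne_top hd p.2))
      rintro y ⟨h1, h2, h3⟩
      have h4 : |inner ℝ p.2 y / (‖p.2‖ * ‖y‖)| = 1 := by
        have : 0 < ‖p.2‖ * ‖y‖ := mul_pos (norm_pos_iff.2 h1) (norm_pos_iff.2 h3)
        rw [abs_div, abs_of_pos this, div_eq_one_iff_eq this.ne']
        exact h2
      obtain ⟨-, r, -, hr⟩ := (abs_real_inner_div_norm_mul_norm_eq_one_iff p.2 y).1 h4
      exact Submodule.mem_span_singleton.2 ⟨r, hr.symm⟩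
    filter_upwards [key, ih, h.ae_norm_ctx (t + 1)] with ω h1 h2 h3
    have h4 : x (t + 1) ω ≠ 0 := by
      rw [← norm_ne_zero_iff, h3]
      exact one_ne_zero
    rw [envStats, runStats]
    split_ifs
    · intro h5
      refine h1 ⟨h2, ?_, h4⟩
      have h6 : (st (t + 1) ω).2 =
          -((inner ℝ θ (x (t + 1) ω) + ε (t + 1) ω) • x (t + 1) ω) :=
        eq_neg_of_add_eq_zero_left h5
      change |inner ℝ (st (t + 1) ω).2 (x (t + 1) ω)| =
        ‖(st (t + 1) ω).2‖ * ‖x (t + 1) ω‖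
      rw [h6, inner_neg_left, abs_neg, real_inner_smul_left, real_inner_self_eq_norm_sq, norm_neg,
        norm_smul, abs_mul, Real.norm_eq_abs, abs_pow, abs_norm]
      ring
    · exact h2

end IsStochasticEnv

theorem inner_eq_zero_of_quadForm_eq_zero {x : ℕ → Ctx d} {ε : ℕ → ℝ} {m : ℕ}
    (hi : ∀ s < m, ∀ β y, incl s β y) (v : Ctx d) (t : ℕ)
    (h : v.ofLp ⬝ᵥ (runStats incl θ x ε t).1 *ᵥ v.ofLp = 0) :
    ∀ s < t, s < m → inner ℝ (x s) v = 0 := by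
  induction t with
  | zero => intro s hs; omega
  | succ t ih =>
    have h0 : 0 ≤ v.ofLp ⬝ᵥ (runStats incl θ x ε t).1 *ᵥ v.ofLp := by
      simpa using (posSemidef_runStats (incl := incl) (θ := θ) (x := x) (ε := ε)
        t).dotProduct_mulVec_nonneg v.ofLp
    have h1 : ∀ r, v.ofLp ⬝ᵥ ((runStats incl θ x ε t).push (x t) r).1 *ᵥ v.ofLp =
        v.ofLp ⬝ᵥ (runStats incl θ x ε t).1 *ᵥ v.ofLp + inner ℝ (x t) v ^ 2 := by
      intro r
      rw [Stats.push, add_mulVec, dotProduct_add, vecMulVec_mulVec, op_smul_eq_smul,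
        dotProduct_smul, Stats.inner_eq_dotProduct, dotProduct_comm v.ofLp (x t).ofLp, smul_eq_mul,
        sq]
    intro s hs hsm
    rw [runStats] at h
    rcases Nat.lt_succ_iff_lt_or_eq.1 hs with hst | rfl
    · refine ih ?_ s hst hsm
      simp only at h
      split_ifs at h
      · rw [h1] at h
        linarith [sq_nonneg (inner ℝ (x t) v)]
      · exact h
    · simp only [hi s hsm, if_true] at h
      rw [h1] at h
      exact pow_eq_zero_iff two_ne_zero |>.1 (by linarith [sq_nonneg (inner ℝ (x s) v)])

/-- The Gram matrix is invertible as soon as linearly independent contexts have been recorded. -/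
theorem det_runStats_ne_zero {x : ℕ → Ctx d} {ε : ℕ → ℝ} (hi : ∀ s < d, ∀ β y, incl s β y)
    (hx : LinearIndependent ℝ fun i : Fin d => x i) {t : ℕ} (ht : d ≤ t) :
    (runStats incl θ x ε t).1.det ≠ 0 := by
  intro h
  obtain ⟨v, hv, hv0⟩ := exists_mulVec_eq_zero_iff.2 h
  have h1 := inner_eq_zero_of_quadForm_eq_zero (θ := θ) (x := x) (ε := ε) hi (WithLp.toLp 2 v) t
    (by rw [hv0, dotProduct_zero])
  have h2 : Submodule.span ℝ (Set.range fun i : Fin d => x i) = ⊤ :=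
    hx.span_eq_top_of_card_eq_finrank' (by simp)
  have h3 : Submodule.span ℝ (Set.range fun i : Fin d => x i) ≤
      (Submodule.span ℝ {(WithLp.toLp 2 v : Ctx d)})ᗮ := by
    rw [Submodule.span_le]
    rintro _ ⟨i, rfl⟩
    rw [SetLike.mem_coe, Submodule.mem_orthogonal_singleton_iff_inner_left]
    exact h1 i (by omega) i.2
  rw [h2] at h3
  have h4 := h3 (Submodule.mem_top (x := (WithLp.toLp 2 v : Ctx d)))
  rw [Submodule.mem_orthogonal_singleton_iff_inner_left, inner_self_eq_zero] at h4
  exact hv (by simpa using congrArg WithLp.ofLp h4)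

/-- Unless `θ = 0`, the least squares estimate almost surely never vanishes: the Gram matrix is
invertible and the sum `∑ r x` is not zero. -/
theorem IsStochasticEnv.ae_est_ne_zero [IsProbabilityMeasure P] (h : IsStochasticEnv P c₀ σ x ε)
    (hd : 2 ≤ d) (hθ : θ ≠ 0) (hi : MeasurableIncl incl) (hid : ∀ s < d, ∀ β y, incl s β y) {t : ℕ}
    (ht : d ≤ t) : ∀ᵐ ω ∂P, (envStats incl θ x ε t ω).est ≠ 0 := by
  obtain ⟨t, rfl⟩ : ∃ s, t = s + 1 := ⟨t - 1, by omega⟩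
  filter_upwards [h.ae_snd_ne_zero hd hθ hi (hid 0 (by omega)) t,
    h.ae_linearIndependent (by omega) d le_rfl] with ω h1 h2 h3
  have hdet := det_runStats_ne_zero (θ := θ) (x := fun s => x s ω) (ε := fun s => ε s ω) hid h2 ht
  have h4 : (envStats incl θ x ε (t + 1) ω).1⁻¹ *ᵥ (envStats incl θ x ε (t + 1) ω).2.ofLp = 0 := by
    exact congrArg WithLp.ofLp h3
  have h5 := congrArg ((envStats incl θ x ε (t + 1) ω).1 *ᵥ ·) h4
  simp only [mulVec_mulVec, mul_nonsing_inv _ hdet.isUnit, one_mulVec, mulVec_zero] at h5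
  exact h1 (by simpa using congrArg (WithLp.toLp 2) h5)

end SecondMoments

/-! ### Regret in expectation -/

section ExpectedRegret

variable {d : ℕ} {θ : Ctx d}

theorem abs_actionGap_le (θ w x : Ctx d) : |actionGap θ w x| ≤ 1 := by
  unfold actionGap
  split_ifs <;> norm_num

theorem measurable_actionGap (θ : Ctx d) :
    Measurable fun q : Ctx d × Ctx d => actionGap θ q.1 q.2 := by
  refine Measurable.sub ?_ ?_
  · exact Measurable.ite (measurableSet_le measurable_const (by fun_prop)) measurable_const
      measurable_const
  · exact Measurable.ite (measurableSet_le measurable_const (by fun_prop)) measurable_const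
      measurable_const

theorem measurable_instRegret (θ : Ctx d) :
    Measurable fun q : Ctx d × Ctx d => instRegret θ q.1 q.2 := by
  refine Measurable.mul ?_ (measurable_actionGap θ)
  fun_prop

/-- If the actions are those of half spaces, the regret splits into a noiseless part and a noise
part. -/
theorem stratRegret_eq_sum {alg : Algo d} {δ : ℝ} {x : ℕ → Ctx d} {ε : ℕ → ℝ} {w : ℕ → Ctx d}
    (hw : ∀ t, action alg δ θ x ε t = decide (0 ≤ inner ℝ (w t) (x t))) (T : ℕ) :
    stratRegret alg δ θ x ε T =
      ∑ t ∈ Finset.range T, (instRegret θ (w t) (x t) + actionGap θ (w t) (x t) * ε t) := by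
  rw [stratRegret, ← Finset.sum_sub_distrib]
  refine Finset.sum_congr rfl fun t _ => ?_
  simp only [hw, rew, linPolicy, decide_eq_true_eq, instRegret, actionGap]
  split_ifs <;> ring

theorem measurable_actionGap_comp {Ω : Type*} [MeasurableSpace Ω] {w y : Ω → Ctx d}
    (hw : Measurable w) (hy : Measurable y) : Measurable fun ω => actionGap θ (w ω) (y ω) := by
  have h := (measurable_actionGap θ).comp (hw.prodMk hy)
  exact h

namespace IsStochasticEnv

variable {Ω : Type*} {x : ℕ → Ω → Ctx d} {ε : ℕ → Ω → ℝ} [MeasurableSpace Ω] {P : Measure Ω}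
  {c₀ : ℝ} {σ : NNReal}

theorem ae_instRegret_mem (h : IsStochasticEnv P c₀ σ x ε) (w : Ω → Ctx d) (t : ℕ) :
    ∀ᵐ ω ∂P, ‖instRegret θ (w ω) (x t ω)‖ ≤ ‖θ‖ := by
  filter_upwards [h.ae_norm_ctx t] with ω hω
  rw [Real.norm_of_nonneg (instRegret_nonneg _ _ _)]
  exact instRegret_le_norm _ _ hω

theorem integrable_instRegret [IsProbabilityMeasure P] (h : IsStochasticEnv P c₀ σ x ε)
    {w : Ω → Ctx d} (hw : Measurable w) (t : ℕ) :
    Integrable (fun ω => instRegret θ (w ω) (x t ω)) P :=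
  Integrable.of_bound
    ((measurable_instRegret θ).comp (hw.prodMk (h.measurable_ctx t))).aestronglyMeasurable ‖θ‖
    (h.ae_instRegret_mem w t)

theorem integral_instRegret_le_norm [IsProbabilityMeasure P] (h : IsStochasticEnv P c₀ σ x ε)
    (w : Ω → Ctx d) (t : ℕ) : ∫ ω, instRegret θ (w ω) (x t ω) ∂P ≤ ‖θ‖ := by
  refine (le_abs_self _).trans ((norm_integral_le_of_norm_le_const (h.ae_instRegret_mem w t)).trans
    ?_)
  simp

theorem integrable_actionGap_mul_noise (h : IsStochasticEnv P c₀ σ x ε) {w : Ω → Ctx d}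
    (hw : Measurable w) (t : ℕ) : Integrable (fun ω => actionGap θ (w ω) (x t ω) * ε t ω) P :=
  (h.integrable_noise t).bdd_mul (c := 1)
    ((measurable_actionGap θ).comp (hw.prodMk (h.measurable_ctx t))).aestronglyMeasurable
    (ae_of_all _ fun _ => abs_actionGap_le _ _ _)

/-- The noise is independent of the policy and of the context. -/
theorem integral_actionGap_mul_noise [IsProbabilityMeasure P] (h : IsStochasticEnv P c₀ σ x ε)
    {w : Ω → Ctx d} {t : ℕ} (hw : Measurable[past x ε t] w) :
    ∫ ω, actionGap θ (w ω) (x t ω) * ε t ω ∂P = 0 := by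
  have hw' : Measurable w := hw.mono (h.past_le t) le_rfl
  have hgm : Measurable fun ω => actionGap θ (w ω) (x t ω) :=
    measurable_actionGap_comp hw' (h.measurable_ctx t)
  have hind : IndepFun (fun ω => actionGap θ (w ω) (x t ω)) (ε t) P := by
    have h1 := (h.map_past_ctx hw).2.comp (measurable_actionGap θ) measurable_id
    exact h1
  rw [hind.integral_fun_mul_eq_mul_integral hgm.aestronglyMeasurable
    (h.measurable_noise t).aestronglyMeasurable, h.mean_noise, mul_zero]

/-- Since the noise is independent of the policy and of the context, it does not contribute to the
expected regret. -/
theorem integrable_stratRegret_and_expRegret_eq [IsProbabilityMeasure P]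
    (h : IsStochasticEnv P c₀ σ x ε) {alg : Algo d} {δ : ℝ} {w : ℕ → Ω → Ctx d}
    (hm : ∀ t, Measurable[past x ε t] (w t))
    (hw : ∀ ω t, action alg δ θ (fun s => x s ω) (fun s => ε s ω) t =
      decide (0 ≤ inner ℝ (w t ω) (x t ω))) (T : ℕ) :
    Integrable (fun ω => stratRegret alg δ θ (fun t => x t ω) (fun t => ε t ω) T) P ∧
      expRegret P alg δ θ x ε T = ∑ t ∈ Finset.range T, ∫ ω, instRegret θ (w t ω) (x t ω) ∂P := by
  have hm' : ∀ t, Measurable (w t) := fun t => (hm t).mono (h.past_le t) le_rfl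
  have hi1 := fun t => h.integrable_instRegret (θ := θ) (hm' t) t
  have hi2 := fun t => h.integrable_actionGap_mul_noise (θ := θ) (hm' t) t
  have hi3 : ∀ t, Integrable (fun ω => instRegret θ (w t ω) (x t ω) +
      actionGap θ (w t ω) (x t ω) * ε t ω) P := fun t => (hi1 t).add (hi2 t)
  have heq : (fun ω => stratRegret alg δ θ (fun t => x t ω) (fun t => ε t ω) T) = fun ω =>
      ∑ t ∈ Finset.range T,
        (instRegret θ (w t ω) (x t ω) + actionGap θ (w t ω) (x t ω) * ε t ω) :=
    funext fun ω => stratRegret_eq_sum (w := fun t => w t ω) (hw ω) T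
  rw [expRegret, heq]
  refine ⟨integrable_finsetSum _ fun t _ => hi3 t, ?_⟩
  rw [integral_finsetSum _ fun t _ => hi3 t]
  refine Finset.sum_congr rfl fun t _ => ?_
  rw [integral_add (hi1 t) (hi2 t), h.integral_actionGap_mul_noise (hm t), add_zero]

end IsStochasticEnv

/-- The expected regret of a least squares learner in the round with index `t`. -/
def meanRegret {Ω : Type*} [MeasurableSpace Ω] (P : Measure Ω) (incl : ℕ → Ctx d → Ctx d → Prop)
    (m : ℕ) (θ : Ctx d) (x : ℕ → Ω → Ctx d) (ε : ℕ → Ω → ℝ) (t : ℕ) : ℝ :=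
  ∫ ω, instRegret θ (runDir incl m θ (fun s => x s ω) (fun s => ε s ω) t) (x t ω) ∂P

section

variable {Ω : Type*} {x : ℕ → Ω → Ctx d} {ε : ℕ → Ω → ℝ} {incl : ℕ → Ctx d → Ctx d → Prop} {m : ℕ}

theorem measurable_past_runDir (hi : MeasurableIncl incl) (t : ℕ) :
    Measurable[past x ε t] fun ω => runDir incl m θ (fun s => x s ω) (fun s => ε s ω) t :=
  measurable_runDir (m := past x ε t) hi m θ t (fun _ hs => measurable_past_ctx hs)
    fun _ hs => measurable_past_noise hs

variable [MeasurableSpace Ω] {P : Measure Ω} {c₀ : ℝ} {σ : NNReal}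

theorem meanRegret_nonneg (t : ℕ) : 0 ≤ meanRegret P incl m θ x ε t :=
  integral_nonneg fun _ => instRegret_nonneg _ _ _

theorem IsStochasticEnv.meanRegret_le_norm [IsProbabilityMeasure P]
    (h : IsStochasticEnv P c₀ σ x ε) (t : ℕ) : meanRegret P incl m θ x ε t ≤ ‖θ‖ :=
  h.integral_instRegret_le_norm _ t

theorem IsLeastSquaresAlgo.integrable_and_expRegret_eq [IsProbabilityMeasure P] {alg : Algo d}
    {δ : ℝ} (ha : IsLeastSquaresAlgo alg δ incl m) (hi : MeasurableIncl incl)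
    (h : IsStochasticEnv P c₀ σ x ε) (T : ℕ) :
    Integrable (fun ω => stratRegret alg δ θ (fun t => x t ω) (fun t => ε t ω) T) P ∧
      expRegret P alg δ θ x ε T = ∑ t ∈ Finset.range T, meanRegret P incl m θ x ε t :=
  h.integrable_stratRegret_and_expRegret_eq (measurable_past_runDir hi)
    (fun _ _ => ha _ _ _ _) T

/-- The expected regret of a round in which the least squares estimate is used, in terms of the
potentials of any earlier statistics which agree with those of this round. -/
theorem IsStochasticEnv.meanRegret_le [IsProbabilityMeasure P] (h : IsStochasticEnv P c₀ σ x ε)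
    (hi : MeasurableIncl incl) {s t : ℕ} (hm : m ≤ t)
    (hst : ∀ ω, envStats incl θ x ε t ω = envStats incl θ x ε s ω) {l : ℝ} (hl : 0 < l) :
    meanRegret P incl m θ x ε t ≤ l * ∫ ω, (envStats incl θ x ε s ω).width ∂P +
      (4 * Real.exp ((σ : ℝ) ^ 2 / 2) * (d * Real.log (d + s)) + ‖θ‖ ^ 2) / l := by
  have hw := h.integrable_width (θ := θ) hi s
  have hd := h.integrable_dev (θ := θ) hi s
  have hd' : Integrable (fun ω => ((envStats incl θ x ε s ω).dev θ + ‖θ‖ ^ 2) / l) P :=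
    (hd.add (integrable_const _)).div_const l
  have h1 : meanRegret P incl m θ x ε t ≤ ∫ ω, (l * (envStats incl θ x ε s ω).width +
      ((envStats incl θ x ε s ω).dev θ + ‖θ‖ ^ 2) / l) ∂P := by
    refine integral_mono_ae (h.integrable_instRegret
      ((measurable_past_runDir hi t).mono (h.past_le t) le_rfl) t)
      ((hw.const_mul l).add hd') ?_
    filter_upwards [h.ae_norm_ctx t] with ω hω
    have h2 : runDir incl m θ (fun s => x s ω) (fun s => ε s ω) t =
        (envStats incl θ x ε s ω).est := by
      rw [runDir, if_neg (by omega), ← hst ω]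
    simp only [h2]
    exact instRegret_est_le (posSemidef_runStats s) hω hl
  refine h1.trans ?_
  rw [integral_add (hw.const_mul l) hd',
    integral_const_mul, integral_div, integral_add hd (integrable_const _)]
  have h3 := h.integral_dev_le (θ := θ) hi s
  simp only [integral_const, probReal_univ, one_smul]
  gcongr

end

end ExpectedRegret

/-! ### Rates of the two subroutines -/

section Rates

variable {d : ℕ} {δ : ℝ}

/-- The choice `l = √(Y / A)` balances the two terms. -/
theorem le_two_mul_sqrt_of_forall_le {X A Y : ℝ} (hA : 0 < A) (hY : 0 < Y)
    (h : ∀ l, 0 < l → X ≤ l * A + Y / l) : X ≤ 2 * √(A * Y) := by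
  have hs : 0 < √(A * Y) := Real.sqrt_pos.2 (by positivity)
  have hsq : √(A * Y) * √(A * Y) = A * Y := Real.mul_self_sqrt (by positivity)
  have h1 := h (√(A * Y) / A) (by positivity)
  have h2 : √(A * Y) / A * A = √(A * Y) := by field_simp
  have h3 : Y / (√(A * Y) / A) = √(A * Y) := by
    rw [div_div_eq_mul_div, div_eq_iff hs.ne', hsq, mul_comm]
  linarith

theorem sqrt_le_sqrt_mul {a K R : ℝ} (hR : 0 ≤ R) (h : a ≤ K * R ^ 2) : √a ≤ √K * R := by
  refine (Real.sqrt_le_sqrt h).trans ?_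
  rw [Real.sqrt_mul' _ (sq_nonneg R), Real.sqrt_sq hR]

theorem rateOLS_nonneg (hδ : δ < 1) (T : ℕ) : 0 ≤ rateOLS d δ T := by
  have : 0 < 1 - δ := sub_pos.2 hδ
  unfold rateOLS
  positivity

theorem rateETC_nonneg (T : ℕ) : 0 ≤ rateETC d T := by
  unfold rateETC
  positivity

theorem rateOLS_sq (hδ : δ < 1) (T : ℕ) :
    rateOLS d δ T ^ 2 = (d : ℝ) ^ 5 * T / (1 - δ) ^ d := by
  have h1 : 0 < 1 - δ := sub_pos.2 hδ
  rw [rateOLS, mul_pow, div_pow, Real.sq_sqrt (Nat.cast_nonneg _), ← Real.rpow_natCast,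
    ← Real.rpow_mul (Nat.cast_nonneg _), ← Real.rpow_natCast ((1 - δ) ^ ((d : ℝ) / 2)),
    ← Real.rpow_mul h1.le]
  norm_num
  rw [div_mul_eq_mul_div]

theorem rateETC_sq (T : ℕ) : rateETC d T ^ 2 = (d : ℝ) ^ 2 * (T : ℝ) ^ (4 / 3 : ℝ) := by
  rw [rateETC, mul_pow, ← Real.rpow_natCast ((T : ℝ) ^ (2 / 3 : ℝ)),
    ← Real.rpow_mul (Nat.cast_nonneg _)]
  norm_num

theorem one_le_rateETC (hd : 1 ≤ d) {T : ℕ} (hT : 1 ≤ T) : 1 ≤ rateETC d T :=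
  one_le_mul_of_one_le_of_one_le (by exact_mod_cast hd)
    (Real.one_le_rpow (by exact_mod_cast hT) (by norm_num))

theorem one_le_one_add_log (hd : 1 ≤ d) {T : ℕ} (hT : 1 ≤ T) :
    1 ≤ 1 + Real.log ((d : ℝ) * T) := by
  have h1 : (1 : ℝ) ≤ d := by exact_mod_cast hd
  have h2 : (1 : ℝ) ≤ T := by exact_mod_cast hT
  linarith [Real.log_nonneg (one_le_mul_of_one_le_of_one_le h1 h2)]

theorem log_add_le (hd : 1 ≤ d) {T : ℕ} (hT : 1 ≤ T) :
    Real.log ((d : ℝ) + T) ≤ 1 + Real.log ((d : ℝ) * T) := by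
  have h1 : (1 : ℝ) ≤ d := by exact_mod_cast hd
  have h2 : (1 : ℝ) ≤ T := by exact_mod_cast hT
  have h3 : (d : ℝ) + T ≤ 2 * ((d : ℝ) * T) := by
    nlinarith [mul_nonneg (sub_nonneg.2 h1) (sub_nonneg.2 h2)]
  have h4 := Real.log_le_log (by positivity) h3
  rw [Real.log_mul two_ne_zero (by positivity)] at h4
  linarith [Real.log_two_lt_d9]

/-- The constant `4 exp (σ² / 2) + B²`, which bounds the second moments of rewards. -/
def rewardScale (σ : NNReal) (B : ℝ) : ℝ := 4 * Real.exp ((σ : ℝ) ^ 2 / 2) + B ^ 2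

theorem rewardScale_pos (σ : NNReal) (B : ℝ) : 0 < rewardScale σ B := by
  unfold rewardScale
  positivity

variable {Ω : Type*} {x : ℕ → Ω → Ctx d} {ε : ℕ → Ω → ℝ} [MeasurableSpace Ω] {P : Measure Ω}
  {c₀ : ℝ} {σ : NNReal} {θ : Ctx d} {incl : ℕ → Ctx d → Ctx d → Prop} {m : ℕ} {B : ℝ}

theorem IsStochasticEnv.sum_meanRegret_le [IsProbabilityMeasure P] (h : IsStochasticEnv P c₀ σ x ε)
    {T : ℕ} (hm : m ≤ T) : ∑ t ∈ Finset.range T, meanRegret P incl m θ x ε t ≤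
      ‖θ‖ * m + ∑ t ∈ Finset.Ico m T, meanRegret P incl m θ x ε t := by
  rw [← Finset.sum_range_add_sum_Ico _ hm]
  gcongr
  refine (Finset.sum_le_card_nsmul _ _ ‖θ‖ fun t _ => h.meanRegret_le_norm t).trans (le_of_eq ?_)
  rw [Finset.card_range, nsmul_eq_mul, mul_comm]

theorem IsStochasticEnv.sum_meanRegret_le_norm_mul [IsProbabilityMeasure P]
    (h : IsStochasticEnv P c₀ σ x ε) (T : ℕ) :
    ∑ t ∈ Finset.range T, meanRegret P incl m θ x ε t ≤ ‖θ‖ * T := by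
  refine (Finset.sum_le_card_nsmul _ _ ‖θ‖ fun t _ => h.meanRegret_le_norm t).trans (le_of_eq ?_)
  rw [Finset.card_range, nsmul_eq_mul, mul_comm]

/-- The variance term of a round is at most `d (1 + log (d T))` times a constant. -/
theorem variance_term_le (hd : 1 ≤ d) {s T : ℕ} (hT : 1 ≤ T) (hs : s ≤ T) (hB : ‖θ‖ ≤ B) :
    4 * Real.exp ((σ : ℝ) ^ 2 / 2) * (d * Real.log (d + s)) + ‖θ‖ ^ 2 ≤
      rewardScale σ B * (d * (1 + Real.log (d * T))) := by
  have hd' : (1 : ℝ) ≤ d := by exact_mod_cast hd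
  have hL := one_le_one_add_log hd hT
  have h1 : Real.log ((d : ℝ) + s) ≤ 1 + Real.log (d * T) := by
    refine le_trans (Real.log_le_log (by positivity) ?_) (log_add_le hd hT)
    gcongr
  have h2 : (1 : ℝ) ≤ d * (1 + Real.log (d * T)) := one_le_mul_of_one_le_of_one_le hd' hL
  have h3 : ‖θ‖ ^ 2 ≤ B ^ 2 * (d * (1 + Real.log (d * T))) := by
    have : ‖θ‖ ^ 2 ≤ B ^ 2 := by gcongr
    nlinarith [sq_nonneg B]
  rw [rewardScale, add_mul]
  gcongr

theorem IsStochasticEnv.expRegret_saOLS_le [IsProbabilityMeasure P]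
    (h : IsStochasticEnv P c₀ σ x ε) (hc : 0 < c₀) (hd : 2 ≤ d) (h0 : 0 < δ) (h1 : δ < 1)
    (hB : ‖θ‖ ≤ B) {T : ℕ} (hT : 1 ≤ T) :
    expRegret P (saOLS d δ) δ θ x ε T ≤ (B + 2 * √(8192 * rewardScale σ B / c₀)) *
      ((1 + Real.log (d * T)) * rateOLS d δ T) := by
  have hi := measurableIncl_saIncl (d := d) δ
  have hB0 : 0 ≤ B := (norm_nonneg θ).trans hB
  have hd' : (2 : ℝ) ≤ d := by exact_mod_cast hd
  have hT' : (1 : ℝ) ≤ T := by exact_mod_cast hT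
  have hL := one_le_one_add_log (show 1 ≤ d by omega) hT
  set L : ℝ := 1 + Real.log (d * T) with hLdef
  set K : ℝ := 8192 * rewardScale σ B / c₀ with hK
  have hr := rewardScale_pos σ B
  have hR := rateOLS_nonneg (d := d) h1 T
  have hδ' : 0 < (1 - δ) ^ d := pow_pos (sub_pos.2 h1) d
  have hδ1 : (1 - δ) ^ d ≤ 1 := pow_le_one₀ (by linarith) (by linarith)
  have hLR : rateOLS d δ T ≤ L * rateOLS d δ T := le_mul_of_one_le_left hR hL
  rw [((isLeastSquaresAlgo_saOLS h0.le).integrable_and_expRegret_eq hi h T).2, add_mul]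
  -- The first `d` rounds are few enough.
  have hfew : ∀ n : ℕ, n ≤ d → n ≤ T → ‖θ‖ * n ≤ B * (L * rateOLS d δ T) := by
    intro n hn hnT
    have h2 : (n : ℝ) ≤ rateOLS d δ T := by
      refine le_of_sq_le_sq ?_ hR
      rw [rateOLS_sq h1, le_div_iff₀ hδ']
      have h3 : (n : ℝ) ^ 2 ≤ (d : ℝ) * T := by
        rw [sq]
        gcongr
      have h4 : (d : ℝ) * T ≤ d ^ 5 * T := by
        gcongr
        exact le_self_pow₀ (by linarith) (by norm_num)
      calc (n : ℝ) ^ 2 * (1 - δ) ^ d ≤ (n : ℝ) ^ 2 * 1 := by gcongr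
        _ ≤ _ := by linarith
    exact mul_le_mul hB (h2.trans hLR) (Nat.cast_nonneg _) hB0
  have hsq : 0 ≤ 2 * √K * (L * rateOLS d δ T) := by positivity
  by_cases hθ : θ = 0
  · refine (h.sum_meanRegret_le_norm_mul T).trans ?_
    rw [hθ, norm_zero, zero_mul]
    positivity
  rcases le_or_gt T d with hTd | hTd
  · exact (h.sum_meanRegret_le_norm_mul T).trans ((hfew T hTd le_rfl).trans (by linarith))
  refine (h.sum_meanRegret_le hTd.le).trans (add_le_add (hfew d le_rfl hTd.le) ?_)
  set q : ℝ := c₀ * ((1 - δ) ^ d / (4096 * d)) with hq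
  have hq0 : 0 < q := by positivity
  have hwidth := h.mul_sum_integral_width_le (θ := θ) hi hq0.le hTd.le fun t ht _ => by
    filter_upwards [h.ae_est_ne_zero hd hθ hi (fun s hs β y => Or.inl hs) ht] with ω hω
    exact hasSecondMoments_saIncl h hc (by omega) h0 h1 ht hω
  have hlog := log_add_le (show 1 ≤ d by omega) hT
  have hsum : ∑ t ∈ Finset.Ico d T, ∫ ω, (envStats (saIncl d δ) θ x ε t ω).width ∂P ≤
      2 * (d * L) / q := by
    rw [le_div_iff₀ hq0, mul_comm]
    refine hwidth.trans ?_
    gcongr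
  have key : ∀ l, 0 < l → ∑ t ∈ Finset.Ico d T, meanRegret P (saIncl d δ) d θ x ε t ≤
      l * (2 * (d * L) / q) + T * (rewardScale σ B * (d * L)) / l := by
    intro l hl
    have h2 : ∀ t ∈ Finset.Ico d T, meanRegret P (saIncl d δ) d θ x ε t ≤
        l * ∫ ω, (envStats (saIncl d δ) θ x ε t ω).width ∂P +
          rewardScale σ B * (d * L) / l := by
      intro t ht
      rw [Finset.mem_Ico] at ht
      refine (h.meanRegret_le hi ht.1 (fun _ => rfl) hl).trans ?_
      gcongr
      exact variance_term_le (by omega) hT ht.2.le hB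
    refine (Finset.sum_le_sum h2).trans ?_
    rw [Finset.sum_add_distrib, ← Finset.mul_sum, Finset.sum_const, Nat.card_Ico, nsmul_eq_mul,
      mul_div_assoc (T : ℝ)]
    gcongr
    exact Nat.sub_le T d
  refine (le_two_mul_sqrt_of_forall_le (by positivity) (by positivity) key).trans ?_
  rw [mul_assoc 2 (√K)]
  gcongr
  refine sqrt_le_sqrt_mul (by positivity) ?_
  rw [mul_pow, rateOLS_sq h1]
  have h3 : 2 * (d * L) / q * (T * (rewardScale σ B * (d * L))) =
      K * (L ^ 2 * ((d : ℝ) ^ 3 * T / (1 - δ) ^ d)) := by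
    rw [hq, hK]
    field_simp
    ring
  rw [h3]
  gcongr
  · linarith
  · norm_num

theorem exploreLength_bounds (hd : 1 ≤ d) {T : ℕ} (hT : 1 ≤ T) {s : ℝ} (hs : 0 ≤ s) :
    s ^ (2 / 3 : ℝ) * rateETC d T ≤ exploreLength d s T (1 / (T : ℝ) ^ 2) ∧
      (exploreLength d s T (1 / (T : ℝ) ^ 2) : ℝ) ≤
        (32 * s ^ (2 / 3 : ℝ) + 1) * ((1 + Real.log (d * T)) * rateETC d T) := by
  have hd' : (1 : ℝ) ≤ d := by exact_mod_cast hd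
  have hT' : (1 : ℝ) ≤ T := by exact_mod_cast hT
  have hR := one_le_rateETC hd hT
  have hL := one_le_one_add_log hd hT
  set L : ℝ := 1 + Real.log (d * T) with hLdef
  set S : ℝ := s ^ (2 / 3 : ℝ) with hS
  have hS0 : 0 ≤ S := Real.rpow_nonneg hs _
  have hdT : (1 : ℝ) ≤ d * T := one_le_mul_of_one_le_of_one_le hd' hT'
  set y : ℝ := Real.log (4 * d / (1 / (T : ℝ) ^ 2)) with hy
  have hy' : y = Real.log (4 * d * (T : ℝ) ^ 2) := by rw [hy, div_div_eq_mul_div, div_one]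
  have hlog4 : Real.log 4 ≤ 2 := by
    rw [show (4 : ℝ) = 2 ^ 2 by norm_num, Real.log_pow]
    have := Real.log_two_lt_d9
    push_cast
    linarith
  have hy1 : 1 ≤ y := by
    rw [hy', Real.le_log_iff_exp_le (by positivity)]
    have : (1 : ℝ) ≤ d * (T : ℝ) ^ 2 :=
      one_le_mul_of_one_le_of_one_le hd' (one_le_pow₀ hT')
    linarith [Real.exp_one_lt_d9]
  have hy2 : y ≤ 2 * L := by
    have h1 : 4 * d * (T : ℝ) ^ 2 ≤ 4 * (d * T) ^ 2 := by
      have : (d : ℝ) ≤ (d : ℝ) ^ 2 := le_self_pow₀ hd' (by norm_num)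
      rw [mul_pow, mul_assoc]
      gcongr
    have h2 := Real.log_le_log (by positivity) h1
    rw [Real.log_mul (x := 4) (y := (d * T) ^ 2) (by norm_num) (by positivity), Real.log_pow] at h2
    push_cast at h2
    rw [hy', hLdef]
    linarith
  have hc1 : (1 : ℝ) ≤ y ^ (1 / 3 : ℝ) := Real.one_le_rpow hy1 (by norm_num)
  have hc2 : y ^ (1 / 3 : ℝ) ≤ y := by
    simpa using Real.rpow_le_rpow_of_exponent_le hy1 (show (1 / 3 : ℝ) ≤ 1 by norm_num)
  have hk1 : (1 : ℝ) ≤ 63 ^ (1 / 3 : ℝ) := Real.one_le_rpow (by norm_num) (by norm_num)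
  have hk2 : (63 : ℝ) ^ (1 / 3 : ℝ) ≤ 4 := by
    have h1 : (63 : ℝ) ^ (1 / 3 : ℝ) ≤ 64 ^ (1 / 3 : ℝ) :=
      Real.rpow_le_rpow (by norm_num) (by norm_num) (by norm_num)
    refine h1.trans (le_of_eq ?_)
    rw [show (64 : ℝ) = 4 ^ (3 : ℝ) by norm_num, ← Real.rpow_mul (by norm_num)]
    norm_num
  have heq : 4 * (63 : ℝ) ^ (1 / 3 : ℝ) * s ^ (2 / 3 : ℝ) * d * (T : ℝ) ^ (2 / 3 : ℝ) *
      y ^ (1 / 3 : ℝ) = 4 * 63 ^ (1 / 3 : ℝ) * y ^ (1 / 3 : ℝ) * (S * rateETC d T) := by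
    rw [rateETC, hS]
    ring
  have hSR : 0 ≤ S * rateETC d T := by positivity
  rw [exploreLength, ← hy, heq]
  constructor
  · refine le_trans ?_ (Nat.le_ceil _)
    refine le_mul_of_one_le_left hSR ?_
    nlinarith
  · refine (Nat.ceil_lt_add_one (by positivity)).le.trans ?_
    have h1 : 4 * 63 ^ (1 / 3 : ℝ) * y ^ (1 / 3 : ℝ) ≤ 4 * 4 * (2 * L) := by
      gcongr
      exact hc2.trans hy2
    have h2 : 1 ≤ L * rateETC d T := one_le_mul_of_one_le_of_one_le hL hR
    have h3 := mul_le_mul_of_nonneg_right h1 hSR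
    linarith

/-- The statistics of explore-then-commit do not change after the exploration. -/
theorem runStats_etcIncl_eq (n : ℕ) (θ : Ctx d) (x : ℕ → Ctx d) (ε : ℕ → ℝ) {t : ℕ} (ht : n ≤ t) :
    runStats (etcIncl d n) θ x ε t = runStats (etcIncl d n) θ x ε n := by
  induction t, ht using Nat.le_induction with
  | base => rfl
  | succ t ht ih =>
    rw [← ih]
    simp [runStats, etcIncl, not_lt.2 ht]

theorem IsStochasticEnv.expRegret_etcRun_le [IsProbabilityMeasure P]
    (h : IsStochasticEnv P c₀ σ x ε) (hc : 0 < c₀) (hσ : 0 < σ) (hd : 2 ≤ d) (h0 : 0 < δ)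
    (hB : ‖θ‖ ≤ B) {T : ℕ} (hT : 1 ≤ T) :
    expRegret P (etcRun d δ σ T) δ θ x ε T ≤ (B * (32 * (σ : ℝ) ^ (2 / 3 : ℝ) + 1) +
      2 * √(16 * rewardScale σ B / (c₀ * (σ : ℝ) ^ (2 / 3 : ℝ)))) *
        ((1 + Real.log (d * T)) * rateETC d T) := by
  have hB0 : 0 ≤ B := (norm_nonneg θ).trans hB
  have hd1 : 1 ≤ d := by omega
  have hd' : (2 : ℝ) ≤ d := by exact_mod_cast hd
  have hT' : (1 : ℝ) ≤ T := by exact_mod_cast hT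
  have hL := one_le_one_add_log hd1 hT
  obtain ⟨hn1, hn2⟩ := exploreLength_bounds (d := d) hd1 hT σ.2
  have hn1 : (σ : ℝ) ^ (2 / 3 : ℝ) * rateETC d T ≤ exploreLength d σ T (1 / (T : ℝ) ^ 2) := hn1
  have hn2 : (exploreLength d σ T (1 / (T : ℝ) ^ 2) : ℝ) ≤
    (32 * (σ : ℝ) ^ (2 / 3 : ℝ) + 1) * ((1 + Real.log (d * T)) * rateETC d T) := hn2
  rw [etcRun, ((isLeastSquaresAlgo_etc h0.le σ T _).integrable_and_expRegret_eq
    (measurableIncl_etcIncl _) h T).2]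
  set n := exploreLength d σ T (1 / (T : ℝ) ^ 2)
  have hi := measurableIncl_etcIncl (d := d) n
  set L : ℝ := 1 + Real.log (d * T) with hLdef
  have hS : 0 < (σ : ℝ) ^ (2 / 3 : ℝ) := Real.rpow_pos_of_pos (by exact_mod_cast hσ) _
  set S : ℝ := (σ : ℝ) ^ (2 / 3 : ℝ)
  set K : ℝ := 16 * rewardScale σ B / (c₀ * S) with hK
  have hr := rewardScale_pos σ B
  have hR := one_le_rateETC hd1 hT
  have hfew : ‖θ‖ * n ≤ B * (32 * S + 1) * (L * rateETC d T) := by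
    rw [mul_assoc]
    exact mul_le_mul hB hn2 (Nat.cast_nonneg _) hB0
  rw [add_mul]
  have hsq : 0 ≤ 2 * √K * (L * rateETC d T) := by positivity
  rcases le_or_gt T n with hTn | hTn
  · refine (h.sum_meanRegret_le_norm_mul T).trans (le_trans ?_ (hfew.trans (by linarith)))
    gcongr
  refine (h.sum_meanRegret_le hTn.le).trans (add_le_add hfew ?_)
  have hn0 : (0 : ℝ) < n := lt_of_lt_of_le (by positivity) hn1
  set q : ℝ := c₀ * (1 / (8 * d)) with hq
  have hq0 : 0 < q := by positivity
  set W : ℝ := ∫ ω, (envStats (etcIncl d n) θ x ε n ω).width ∂P with hW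
  have hwidth := h.mul_sum_integral_width_le (θ := θ) hi hq0.le (Nat.zero_le n) fun t _ ht =>
    ae_of_all _ fun ω => hasSecondMoments_etcIncl h hc (by omega) ht _
  have hnW : n * W ≤ 2 * (d * L) / q := by
    rw [le_div_iff₀ hq0, mul_comm]
    have hlog : Real.log ((d : ℝ) + n) ≤ L := by
      refine le_trans (Real.log_le_log (by positivity) ?_) (log_add_le hd1 hT)
      gcongr
    refine le_trans ?_ (hwidth.trans (by gcongr))
    gcongr
    rw [← nsmul_eq_mul]
    refine le_trans (le_of_eq ?_) (Finset.card_nsmul_le_sum (Finset.Ico 0 n) _ W ?_)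
    · rw [Nat.card_Ico, Nat.sub_zero]
    · intro t ht
      rw [Finset.mem_Ico] at ht
      exact integral_mono (h.integrable_width hi n) (h.integrable_width hi t)
        fun ω => width_runStats_antitone ht.2.le
  have key : ∀ l, 0 < l → ∑ t ∈ Finset.Ico n T, meanRegret P (etcIncl d n) n θ x ε t ≤
      l * (T * (2 * (d * L) / q / n)) + T * (rewardScale σ B * (d * L)) / l := by
    intro l hl
    have h2 : ∀ t ∈ Finset.Ico n T, meanRegret P (etcIncl d n) n θ x ε t ≤
        l * (2 * (d * L) / q / n) + rewardScale σ B * (d * L) / l := by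
      intro t ht
      rw [Finset.mem_Ico] at ht
      refine (h.meanRegret_le hi ht.1 (fun _ => runStats_etcIncl_eq n θ _ _ ht.1) hl).trans ?_
      gcongr
      · rw [le_div_iff₀ hn0, mul_comm]
        exact hnW
      · exact variance_term_le hd1 hT hTn.le hB
    refine (Finset.sum_le_card_nsmul _ _ _ h2).trans ?_
    rw [Nat.card_Ico, nsmul_eq_mul]
    have h3 : ((T - n : ℕ) : ℝ) ≤ T := by exact_mod_cast Nat.sub_le T n
    refine (mul_le_mul_of_nonneg_right h3 (by positivity)).trans (le_of_eq ?_)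
    ring
  refine (le_two_mul_sqrt_of_forall_le (by positivity) (by positivity) key).trans ?_
  rw [mul_assoc 2 (√K)]
  gcongr
  refine sqrt_le_sqrt_mul (by positivity) ?_
  have h3 : T * (2 * (d * L) / q / n) * (T * (rewardScale σ B * (d * L))) =
      16 * rewardScale σ B / c₀ * (L ^ 2 * ((d : ℝ) ^ 3 * T ^ 2 / n)) := by
    rw [hq]
    field_simp
    ring
  have hT43 : (T : ℝ) ^ 2 = (T : ℝ) ^ (4 / 3 : ℝ) * (T : ℝ) ^ (2 / 3 : ℝ) := by
    rw [← Real.rpow_add (by positivity), ← Real.rpow_natCast]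
    norm_num
  have h4 : (d : ℝ) ^ 3 * T ^ 2 / n ≤ rateETC d T ^ 2 / S := by
    rw [div_le_div_iff₀ hn0 hS]
    have h5 : (d : ℝ) ^ 3 * T ^ 2 = rateETC d T ^ 2 * rateETC d T := by
      rw [rateETC_sq, hT43, rateETC]
      ring
    rw [h5, mul_assoc]
    gcongr
    linarith
  rw [h3, mul_pow]
  calc 16 * rewardScale σ B / c₀ * (L ^ 2 * ((d : ℝ) ^ 3 * T ^ 2 / n))
      ≤ 16 * rewardScale σ B / c₀ * (L ^ 2 * (rateETC d T ^ 2 / S)) := by gcongr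
    _ = K * (L ^ 2 * rateETC d T ^ 2) := by
      rw [hK]
      field_simp

end Rates

/-! ### Epochs -/

section Epochs

theorem epochSum_succ (i : ℕ) : epochSum (i + 1) = epochSum i + 2 ^ (i + 1) :=
  Finset.sum_Icc_succ_top (by omega) _

theorem epochSum_add_two (i : ℕ) : epochSum i + 2 = 2 ^ (i + 1) := by
  induction i with
  | zero => rfl
  | succ i ih => rw [epochSum_succ, pow_succ 2 (i + 1)]; omega

theorem strictMono_epochSum : StrictMono epochSum :=
  strictMono_nat_of_lt_succ fun i => by
    rw [epochSum_succ]
    exact Nat.lt_add_of_pos_right (by positivity)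

theorem epochOf_spec (n : ℕ) :
    ∃ j, epochOf n = j + 1 ∧ epochSum j ≤ n ∧ n < epochSum (j + 1) := by
  have hne : {i : ℕ | n < epochSum i}.Nonempty :=
    ⟨n + 1, Nat.lt_of_succ_le (strictMono_epochSum.id_le (n + 1))⟩
  have hmem : n < epochSum (epochOf n) := Nat.sInf_mem hne
  obtain ⟨j, hj⟩ : ∃ j, epochOf n = j + 1 := by
    refine Nat.exists_eq_succ_of_ne_zero fun h => ?_
    rw [h] at hmem
    simp [epochSum] at hmem
  refine ⟨j, hj, ?_, hj ▸ hmem⟩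
  have h1 : j ∉ {i : ℕ | n < epochSum i} := Nat.notMem_of_lt_sInf (by
    change j < epochOf n
    omega)
  exact not_lt.1 h1

theorem epochOf_eq {j n : ℕ} (h1 : epochSum j ≤ n) (h2 : n < epochSum (j + 1)) :
    epochOf n = j + 1 := by
  obtain ⟨k, hk, h3, h4⟩ := epochOf_spec n
  have h5 := strictMono_epochSum.lt_iff_lt.1 (h1.trans_lt h4)
  have h6 := strictMono_epochSum.lt_iff_lt.1 (h3.trans_lt h2)
  omega

theorem numEpochs_spec (τ : ℝ) :
    (numEpochs τ ≠ 0 → (epochSum (numEpochs τ) : ℝ) < τ) ∧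
      τ ≤ epochSum (numEpochs τ + 1) := by
  set S := {i : ℕ | 1 ≤ i ∧ ¬ ((epochSum i : ℝ) < τ)} with hS
  have hne : S.Nonempty := by
    obtain ⟨n, hn⟩ := exists_nat_ge τ
    refine ⟨n + 1, by omega, not_lt.2 (hn.trans ?_)⟩
    exact_mod_cast (Nat.le_succ n).trans (strictMono_epochSum.id_le (n + 1))
  have hmem : sInf S ∈ S := Nat.sInf_mem hne
  have h1 : numEpochs τ + 1 = sInf S := Nat.sub_add_cancel hmem.1
  refine ⟨fun h0 => ?_, ?_⟩
  · have h2 : numEpochs τ ∉ S := Nat.notMem_of_lt_sInf (by omega)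
    by_contra h3
    exact h2 ⟨Nat.one_le_iff_ne_zero.2 h0, h3⟩
  · rw [h1]
    exact not_lt.1 hmem.2

end Epochs

/-! ### Restarts in a stationary environment -/

section Shift

variable {d : ℕ} {Ω : Type*} {x : ℕ → Ω → Ctx d} {ε : ℕ → Ω → ℝ} [MeasurableSpace Ω]
  {P : Measure Ω} {c₀ : ℝ} {σ : NNReal} {θ : Ctx d} {incl : ℕ → Ctx d → Ctx d → Prop} {m : ℕ}

theorem IsStochasticEnv.map_shift [IsProbabilityMeasure P] (h : IsStochasticEnv P c₀ σ x ε)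
    (s : ℕ) :
    P.map (fun ω i => (x (s + i) ω, ε (s + i) ω)) = P.map (fun ω i => (x i ω, ε i ω)) := by
  have hm : ∀ i, Measurable fun ω => (x i ω, ε i ω) := fun i =>
    (h.measurable_ctx i).prodMk (h.measurable_noise i)
  have hlaw : ∀ i, P.map (fun ω => (x i ω, ε i ω)) = (P.map (x 0)).prod (P.map (ε 0)) := by
    intro i
    rw [(indepFun_iff_map_prod_eq_prod_map_map (h.measurable_ctx i).aemeasurable
      (h.measurable_noise i).aemeasurable).1 (h.indep_ctx_noise i), h.map_ctx_eq i,
      (h.identDistrib_noise i).map_eq]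
  have h1 := (iIndepFun_iff_map_fun_eq_infinitePi_map hm).1 h.indep_rounds
  have h2 := (iIndepFun_iff_map_fun_eq_infinitePi_map fun i => hm (s + i)).1
    (h.indep_rounds.precomp (add_right_injective s))
  rw [h1, h2]
  simp only [hlaw]

/-- A learner that starts afresh has the same expected regret as at the beginning. -/
theorem IsStochasticEnv.meanRegret_shift [IsProbabilityMeasure P] (h : IsStochasticEnv P c₀ σ x ε)
    (hi : MeasurableIncl incl) (s t : ℕ) :
    meanRegret P incl m θ (fun i => x (s + i)) (fun i => ε (s + i)) t =
      meanRegret P incl m θ x ε t := by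
  set F : (ℕ → Ctx d × ℝ) → ℝ := fun z =>
    instRegret θ (runDir incl m θ (fun i => (z i).1) (fun i => (z i).2) t) (z t).1 with hF
  have hFm : Measurable F := by
    have h1 : Measurable fun z : ℕ → Ctx d × ℝ =>
        runDir incl m θ (fun i => (z i).1) (fun i => (z i).2) t :=
      measurable_runDir hi m θ (x := fun i (z : ℕ → Ctx d × ℝ) => (z i).1)
        (ε := fun i (z : ℕ → Ctx d × ℝ) => (z i).2) t
        (fun i _ => measurable_fst.comp (measurable_pi_apply i))
        fun i _ => measurable_snd.comp (measurable_pi_apply i)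
    exact (measurable_instRegret θ).comp
      (h1.prodMk (measurable_fst.comp (measurable_pi_apply t)))
  have hm : ∀ i, Measurable fun ω => (x i ω, ε i ω) := fun i =>
    (h.measurable_ctx i).prodMk (h.measurable_noise i)
  have h1 := integral_map (measurable_pi_iff.2 hm).aemeasurable
    hFm.aestronglyMeasurable (μ := P)
  have h2 := integral_map (measurable_pi_iff.2 fun i => hm (s + i)).aemeasurable
    hFm.aestronglyMeasurable (μ := P)
  rw [h.map_shift, h1] at h2
  exact h2.symm

end Shift

/-! ### The combined algorithm -/

section Combined

variable {d : ℕ} {δ : ℝ} {θ : Ctx d}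

/-- The number of exploration rounds of explore-then-commit with horizon `T` and failure probability
`1 / T²`. -/
def etcLength (d : ℕ) (σ : ℝ) (T : ℕ) : ℕ := exploreLength d σ T (1 / (T : ℝ) ^ 2)

/-- The direction of the policy of the combined algorithm in the round with index `t`. -/
def combinedDir (δ σ τ : ℝ) (θ : Ctx d) (x : ℕ → Ctx d) (ε : ℕ → ℝ) (t : ℕ) : Ctx d :=
  let s := epochSum (numEpochs τ)
  let n := etcLength d σ (2 ^ epochOf t)
  let e := epochSum (epochOf t - 1)
  if t < s then runDir (etcIncl d n) n θ (fun i => x (e + i)) (fun i => ε (e + i)) (t - e)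
  else runDir (saIncl d δ) d θ (fun i => x (s + i)) (fun i => ε (s + i)) (t - s)

theorem combinedDir_of_epoch (δ σ : ℝ) {τ : ℝ} (θ : Ctx d) (x : ℕ → Ctx d) (ε : ℕ → ℝ) {j u : ℕ}
    (hj : j < numEpochs τ) (hu : u < 2 ^ (j + 1)) :
    combinedDir δ σ τ θ x ε (epochSum j + u) =
      runDir (etcIncl d (etcLength d σ (2 ^ (j + 1)))) (etcLength d σ (2 ^ (j + 1))) θ
        (fun i => x (epochSum j + i)) (fun i => ε (epochSum j + i)) u := by
  have h1 : epochOf (epochSum j + u) = j + 1 :=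
    epochOf_eq (by omega) (by rw [epochSum_succ]; omega)
  have h2 : epochSum (j + 1) ≤ epochSum (numEpochs τ) := strictMono_epochSum.monotone hj
  have h3 : epochSum j + u < epochSum (numEpochs τ) := by
    rw [epochSum_succ] at h2
    omega
  simp only [combinedDir, h1, h3, if_true, Nat.add_sub_cancel, Nat.add_sub_cancel_left]

theorem combinedDir_of_ge (δ σ : ℝ) {τ : ℝ} (θ : Ctx d) (x : ℕ → Ctx d) (ε : ℕ → ℝ) (u : ℕ) :
    combinedDir δ σ τ θ x ε (epochSum (numEpochs τ) + u) =
      runDir (saIncl d δ) d θ (fun i => x (epochSum (numEpochs τ) + i))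
        (fun i => ε (epochSum (numEpochs τ) + i)) u := by
  simp only [combinedDir, Nat.not_lt.2 (Nat.le_add_right _ _), if_false, Nat.add_sub_cancel_left]

/-- Every round either lies in a full epoch before the switch or comes after the switch. -/
theorem exists_epoch_or_ge (τ : ℝ) (t : ℕ) :
    (∃ j u, j < numEpochs τ ∧ u < 2 ^ (j + 1) ∧ t = epochSum j + u) ∨
      ∃ u, t = epochSum (numEpochs τ) + u := by
  rcases lt_or_ge t (epochSum (numEpochs τ)) with h | h
  · obtain ⟨j, -, h1, h2⟩ := epochOf_spec t
    refine Or.inl ⟨j, t - epochSum j, strictMono_epochSum.lt_iff_lt.1 (h1.trans_lt h), ?_, by omega⟩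
    rw [epochSum_succ] at h2
    omega
  · exact Or.inr ⟨t - epochSum (numEpochs τ), by omega⟩

theorem action_combined (hδ : 0 ≤ δ) (σ τ : ℝ) (θ : Ctx d) (x : ℕ → Ctx d) (ε : ℕ → ℝ) (t : ℕ) :
    action (combined d δ σ τ) δ θ x ε t =
      decide (0 ≤ inner ℝ (combinedDir δ σ τ θ x ε t) (x t)) := by
  rcases exists_epoch_or_ge τ t with ⟨j, u, hj, hu, rfl⟩ | ⟨u, rfl⟩
  · rw [combinedDir_of_epoch δ σ θ x ε hj hu, action_eq_of_restart
      (alg' := etcRun d δ σ (2 ^ (j + 1))) (e := epochSum (j + 1)) _ δ θ x ε u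
      (by rw [epochSum_succ]; omega)]
    · exact isLeastSquaresAlgo_etc hδ _ _ _ _ _ _ _
    · intro l h1 h2
      have h3 : epochSum (j + 1) ≤ epochSum (numEpochs τ) := strictMono_epochSum.monotone hj
      simp only [combined, epochOf_eq h1 h2, h2.trans_le h3, if_true, Nat.add_sub_cancel]
  · rw [combinedDir_of_ge, action_eq_of_restart (alg' := saOLS d δ)
      (e := epochSum (numEpochs τ) + u + 1) _ δ θ x ε u (by omega)]
    · exact isLeastSquaresAlgo_saOLS hδ _ _ _ _
    · intro l h1 _
      simp only [combined, not_lt.2 h1, if_false]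

variable {Ω : Type*} {x : ℕ → Ω → Ctx d} {ε : ℕ → Ω → ℝ}

theorem measurable_past_combinedDir (σ τ : ℝ) (t : ℕ) :
    Measurable[past x ε t] fun ω =>
      combinedDir δ σ τ θ (fun s => x s ω) (fun s => ε s ω) t := by
  rcases exists_epoch_or_ge τ t with ⟨j, u, hj, hu, rfl⟩ | ⟨u, rfl⟩
  · simp only [combinedDir_of_epoch δ σ θ _ _ hj hu]
    exact measurable_runDir (m := past x ε _) (measurableIncl_etcIncl _) _ θ
      (x := fun i => x (epochSum j + i)) (ε := fun i => ε (epochSum j + i)) u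
      (fun i hi => measurable_past_ctx (by omega)) fun i hi => measurable_past_noise (by omega)
  · simp only [combinedDir_of_ge]
    exact measurable_runDir (m := past x ε _) (measurableIncl_saIncl _) _ θ
      (x := fun i => x (epochSum (numEpochs τ) + i)) (ε := fun i => ε (epochSum (numEpochs τ) + i))
      u (fun i hi => measurable_past_ctx (by omega)) fun i hi => measurable_past_noise (by omega)

variable [MeasurableSpace Ω] {P : Measure Ω} {c₀ : ℝ} {σ : NNReal}

theorem IsStochasticEnv.integrable_combined_and_expRegret_eq [IsProbabilityMeasure P]
    (h : IsStochasticEnv P c₀ σ x ε) (hδ : 0 ≤ δ) (τ : ℝ) (T : ℕ) :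
    Integrable (fun ω => stratRegret (combined d δ σ τ) δ θ (fun t => x t ω) (fun t => ε t ω) T) P ∧
      expRegret P (combined d δ σ τ) δ θ x ε T = ∑ t ∈ Finset.range T,
        ∫ ω, instRegret θ (combinedDir δ σ τ θ (fun s => x s ω) (fun s => ε s ω) t) (x t ω) ∂P :=
  h.integrable_stratRegret_and_expRegret_eq (measurable_past_combinedDir σ τ)
    (fun _ _ => action_combined hδ _ _ _ _ _ _) T

/-- The expected regret of the combined algorithm over its first `j` epochs. -/
theorem IsStochasticEnv.expRegret_combined_epochSum [IsProbabilityMeasure P]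
    (h : IsStochasticEnv P c₀ σ x ε) (hδ : 0 ≤ δ) {τ : ℝ} {j : ℕ} (hj : j ≤ numEpochs τ) :
    expRegret P (combined d δ σ τ) δ θ x ε (epochSum j) =
      ∑ i ∈ Finset.range j, expRegret P (etcRun d δ σ (2 ^ (i + 1))) δ θ x ε (2 ^ (i + 1)) := by
  rw [(h.integrable_combined_and_expRegret_eq hδ τ _).2]
  induction j with
  | zero => simp [epochSum]
  | succ j ih =>
    rw [epochSum_succ, Finset.sum_range_add, ih (by omega), Finset.sum_range_succ]
    congr 1
    rw [etcRun, ((isLeastSquaresAlgo_etc hδ σ _ _).integrable_and_expRegret_eq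
      (measurableIncl_etcIncl _) h _).2]
    refine Finset.sum_congr rfl fun u hu => ?_
    rw [Finset.mem_range] at hu
    simp only [combinedDir_of_epoch δ σ θ _ _ hj hu]
    exact h.meanRegret_shift (measurableIncl_etcIncl _) (epochSum j) u

/-- After its last epoch, the combined algorithm is a fresh copy of strategy-aware OLS. -/
theorem IsStochasticEnv.expRegret_combined_add [IsProbabilityMeasure P]
    (h : IsStochasticEnv P c₀ σ x ε) (hδ : 0 ≤ δ) (τ : ℝ) (u : ℕ) :
    expRegret P (combined d δ σ τ) δ θ x ε (epochSum (numEpochs τ) + u) =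
      expRegret P (combined d δ σ τ) δ θ x ε (epochSum (numEpochs τ)) +
        expRegret P (saOLS d δ) δ θ x ε u := by
  rw [(h.integrable_combined_and_expRegret_eq hδ τ _).2,
    (h.integrable_combined_and_expRegret_eq hδ τ _).2, Finset.sum_range_add,
    ((isLeastSquaresAlgo_saOLS hδ).integrable_and_expRegret_eq (measurableIncl_saIncl δ) h _).2]
  congr 1
  refine Finset.sum_congr rfl fun u _ => ?_
  simp only [combinedDir_of_ge]
  exact h.meanRegret_shift (measurableIncl_saIncl δ) (epochSum (numEpochs τ)) u

theorem IsStochasticEnv.monotone_expRegret_combined [IsProbabilityMeasure P]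
    (h : IsStochasticEnv P c₀ σ x ε) (hδ : 0 ≤ δ) (τ : ℝ) :
    Monotone fun T => expRegret P (combined d δ σ τ) δ θ x ε T := by
  refine monotone_nat_of_le_succ fun T => ?_
  simp only [(h.integrable_combined_and_expRegret_eq hδ τ _).2, Finset.sum_range_succ]
  exact le_add_of_nonneg_right (integral_nonneg fun _ => instRegret_nonneg _ _ _)

end Combined

/-! ### The two rates at the switching time -/

section Switch

variable {d : ℕ} {δ : ℝ}

/-- The number of rounds at which the two rates `rateOLS` and `rateETC` agree. -/
def switchTime (d : ℕ) (δ : ℝ) : ℝ := (d : ℝ) ^ 9 / (1 - δ) ^ (3 * d)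

/-- The sixth root of `switchTime`. -/
def switchRoot (d : ℕ) (δ : ℝ) : ℝ := (d : ℝ) ^ (3 / 2 : ℝ) / (1 - δ) ^ ((d : ℝ) / 2)

theorem switchRoot_pow (hδ : δ < 1) : switchRoot d δ ^ 6 = switchTime d δ := by
  have h1 : 0 < 1 - δ := sub_pos.2 hδ
  rw [switchRoot, switchTime, div_pow, ← Real.rpow_natCast, ← Real.rpow_mul (Nat.cast_nonneg _),
    ← Real.rpow_natCast ((1 - δ) ^ ((d : ℝ) / 2)), ← Real.rpow_mul h1.le,
    ← Real.rpow_natCast (d : ℝ) 9, ← Real.rpow_natCast (1 - δ)]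
  push_cast
  ring_nf

theorem switchRoot_nonneg (hδ : δ < 1) : 0 ≤ switchRoot d δ := by
  have : 0 < 1 - δ := sub_pos.2 hδ
  unfold switchRoot
  positivity

theorem two_lt_switchTime (hd : 2 ≤ d) (h0 : 0 < δ) (h1 : δ < 1) : 2 < switchTime d δ := by
  have h2 : 0 < 1 - δ := sub_pos.2 h1
  have hd' : (2 : ℝ) ≤ d := by exact_mod_cast hd
  rw [switchTime, lt_div_iff₀ (pow_pos h2 _)]
  have h3 : (1 - δ) ^ (3 * d) ≤ 1 := pow_le_one₀ h2.le (by linarith)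
  have h4 : (2 : ℝ) ^ 9 ≤ d ^ 9 := by gcongr
  linarith

theorem sixthRoot_pow (T : ℕ) : ((T : ℝ) ^ (1 / 6 : ℝ)) ^ 6 = T := by
  rw [← Real.rpow_natCast, ← Real.rpow_mul (Nat.cast_nonneg _)]
  norm_num

theorem rpow_two_thirds_eq (T : ℕ) : (T : ℝ) ^ (2 / 3 : ℝ) = ((T : ℝ) ^ (1 / 6 : ℝ)) ^ 4 := by
  rw [← Real.rpow_natCast, ← Real.rpow_mul (Nat.cast_nonneg _)]
  norm_num

theorem rateETC_eq (T : ℕ) : rateETC d T = d * ((T : ℝ) ^ (1 / 6 : ℝ)) ^ 4 := by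
  rw [rateETC, rpow_two_thirds_eq]

theorem rateOLS_eq (T : ℕ) :
    rateOLS d δ T = d * (switchRoot d δ * ((T : ℝ) ^ (1 / 6 : ℝ)) ^ 3) := by
  have h1 : √(T : ℝ) = ((T : ℝ) ^ (1 / 6 : ℝ)) ^ 3 := by
    rw [← Real.rpow_natCast, ← Real.rpow_mul (Nat.cast_nonneg _), Real.sqrt_eq_rpow]
    norm_num
  have h2 : (d : ℝ) ^ (5 / 2 : ℝ) = d * (d : ℝ) ^ (3 / 2 : ℝ) := by
    rw [show (5 / 2 : ℝ) = 1 + 3 / 2 by norm_num, Real.rpow_add_of_nonneg (Nat.cast_nonneg _)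
      zero_le_one (by norm_num), Real.rpow_one]
  rw [rateOLS, switchRoot, h1, h2]
  ring

/-- A geometric sum, with the ratio `2^(2/3) ≥ 14/9`. -/
theorem sum_two_pow_rpow_le (j : ℕ) :
    ∑ i ∈ Finset.range j, ((2 ^ (i + 1) : ℕ) : ℝ) ^ (2 / 3 : ℝ) ≤
      14 / 5 * (((2 ^ j : ℕ) : ℝ) ^ (2 / 3 : ℝ) - 1) := by
  have ha : (14 / 9 : ℝ) ≤ 2 ^ (2 / 3 : ℝ) := by
    refine (pow_le_pow_iff_left₀ (by norm_num) (by positivity) three_ne_zero).1 ?_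
    rw [← Real.rpow_natCast (2 ^ (2 / 3 : ℝ)), ← Real.rpow_mul zero_le_two]
    norm_num
  have hp : ∀ k : ℕ, ((2 ^ k : ℕ) : ℝ) ^ (2 / 3 : ℝ) = ((2 : ℝ) ^ (2 / 3 : ℝ)) ^ k := by
    intro k
    rw [← Real.rpow_natCast, ← Real.rpow_mul zero_le_two, mul_comm, Real.rpow_mul zero_le_two,
      Real.rpow_natCast]
    push_cast
    rfl
  simp only [hp]
  set a : ℝ := 2 ^ (2 / 3 : ℝ)
  induction j with
  | zero => simp
  | succ j ih =>
    rw [Finset.sum_range_succ]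
    have h1 : 0 < a ^ j := by positivity
    rw [pow_succ]
    nlinarith

variable {Ω : Type*} {x : ℕ → Ω → Ctx d} {ε : ℕ → Ω → ℝ} [MeasurableSpace Ω] {P : Measure Ω}
  {c₀ : ℝ} {σ : NNReal} {θ : Ctx d}

theorem IsStochasticEnv.expRegret_combined_epochSum_le [IsProbabilityMeasure P]
    (h : IsStochasticEnv P c₀ σ x ε) (h0 : 0 ≤ δ) {τ M : ℝ} {T j : ℕ} (hM : 0 ≤ M)
    (hj : j ≤ numEpochs τ) (hjT : 2 ^ j ≤ 2 * T)
    (hE : ∀ t : ℕ, 1 ≤ t → t ≤ 2 * T → expRegret P (etcRun d δ σ t) δ θ x ε t ≤ M * rateETC d t) :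
    expRegret P (combined d δ σ τ) δ θ x ε (epochSum j) ≤
      M * (d * (14 / 5 * (((2 ^ j : ℕ) : ℝ) ^ (2 / 3 : ℝ) - 1))) := by
  rw [h.expRegret_combined_epochSum h0 hj]
  have h1 : ∀ i ∈ Finset.range j,
      expRegret P (etcRun d δ σ (2 ^ (i + 1))) δ θ x ε (2 ^ (i + 1)) ≤
        M * (d * ((2 ^ (i + 1) : ℕ) : ℝ) ^ (2 / 3 : ℝ)) := by
    intro i hi
    rw [Finset.mem_range] at hi
    exact hE _ Nat.one_le_two_pow ((Nat.pow_le_pow_right two_pos hi).trans hjT)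
  refine (Finset.sum_le_sum h1).trans ?_
  rw [← Finset.mul_sum, ← Finset.mul_sum]
  gcongr
  exact sum_two_pow_rpow_le j

/-- With switching time `switchTime`, the combined algorithm is as good as both subroutines, up to a
factor `4`. -/
theorem IsStochasticEnv.expRegret_combined_le [IsProbabilityMeasure P]
    (h : IsStochasticEnv P c₀ σ x ε) (hd : 2 ≤ d) (h0 : 0 < δ) (h1 : δ < 1) {T : ℕ} {M : ℝ}
    (hT : 1 ≤ T)
    (hO : ∀ t : ℕ, 1 ≤ t → t ≤ 2 * T → expRegret P (saOLS d δ) δ θ x ε t ≤ M * rateOLS d δ t)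
    (hE : ∀ t : ℕ, 1 ≤ t → t ≤ 2 * T → expRegret P (etcRun d δ σ t) δ θ x ε t ≤ M * rateETC d t) :
    expRegret P (combined d δ σ (switchTime d δ)) δ θ x ε T ≤
      4 * min (M * rateOLS d δ T) (M * rateETC d T) := by
  have hd' : (2 : ℝ) ≤ d := by exact_mod_cast hd
  have hG := switchRoot_nonneg (d := d) h1
  have hG6 := switchRoot_pow (d := d) h1
  have hM : 0 ≤ M := by
    have h2 := hO 1 le_rfl (by omega)
    rw [((isLeastSquaresAlgo_saOLS h0.le).integrable_and_expRegret_eq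
      (measurableIncl_saIncl δ) h _).2] at h2
    have h3 : 0 < rateOLS d δ 1 := by
      have : 0 < 1 - δ := sub_pos.2 h1
      unfold rateOLS
      positivity
    have h4 := (Finset.sum_nonneg fun t _ => meanRegret_nonneg t).trans h2
    exact nonneg_of_mul_nonneg_left h4 h3
  obtain ⟨hN1, hN2⟩ := numEpochs_spec (switchTime d δ)
  have hN0 : numEpochs (switchTime d δ) ≠ 0 := by
    intro hN
    rw [hN] at hN2
    have h2 : epochSum (0 + 1) = 2 := by have := epochSum_add_two (0 + 1); omega
    rw [h2] at hN2
    exact absurd (two_lt_switchTime hd h0 h1) (not_lt.2 (by exact_mod_cast hN2))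
  have hN1 := hN1 hN0
  have hmono := h.monotone_expRegret_combined (θ := θ) h0.le (switchTime d δ)
  set N := numEpochs (switchTime d δ)
  rw [← hG6] at hN1 hN2
  set G := switchRoot d δ
  set r : ℝ := (T : ℝ) ^ (1 / 6 : ℝ) with hr
  have hr0 : 0 ≤ r := by positivity
  have hr6 : r ^ 6 = T := sixthRoot_pow T
  have h6 : (6 : ℕ) ≠ 0 := by norm_num
  rw [rateOLS_eq, rateETC_eq, ← hr, ← mul_min_of_nonneg _ _ hM, ← mul_min_of_nonneg _ _
    (Nat.cast_nonneg d)]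
  rcases le_or_gt T (epochSum N) with hTs | hTs
  · -- The horizon is reached in an epoch of explore-then-commit, whose rate is the better one.
    obtain ⟨j, -, hj1, hj2⟩ := epochOf_spec (T - 1)
    have hjN : j < N := strictMono_epochSum.lt_iff_lt.1 (by omega)
    have hjT : 2 ^ (j + 1) ≤ T + 1 := by
      have := epochSum_add_two j
      omega
    refine (hmono (show T ≤ epochSum (j + 1) by omega)).trans ((h.expRegret_combined_epochSum_le
      h0.le hM hjN (hjT.trans (by omega)) hE).trans ?_)
    have h2 : ((2 ^ (j + 1) : ℕ) : ℝ) ^ (2 / 3 : ℝ) ≤ r ^ 4 + 1 := by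
      have h3 : ((2 ^ (j + 1) : ℕ) : ℝ) ≤ T + 1 := by exact_mod_cast hjT
      refine (Real.rpow_le_rpow (Nat.cast_nonneg _) h3 (by norm_num)).trans ?_
      refine (Real.rpow_add_le_add_rpow (Nat.cast_nonneg _) zero_le_one (by norm_num)
        (by norm_num)).trans (le_of_eq ?_)
      rw [Real.one_rpow, rpow_two_thirds_eq]
    have hrG : r ≤ G := by
      refine (pow_le_pow_iff_left₀ hr0 hG h6).1 ?_
      rw [hr6]
      exact le_trans (by exact_mod_cast hTs) hN1.le
    have h4 : min (G * r ^ 3) (r ^ 4) = r ^ 4 := by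
      rw [min_eq_right]
      calc r ^ 4 = r * r ^ 3 := by ring
        _ ≤ G * r ^ 3 := by gcongr
    rw [h4, mul_left_comm 4, mul_left_comm 4]
    refine mul_le_mul_of_nonneg_left (mul_le_mul_of_nonneg_left ?_ (Nat.cast_nonneg d)) hM
    linarith [pow_nonneg hr0 4]
  · obtain ⟨u, rfl⟩ := Nat.exists_eq_add_of_lt hTs
    rw [add_assoc, h.expRegret_combined_add h0.le]
    -- The sixth root of the number of rounds before the switch.
    set ρ : ℝ := (epochSum N : ℝ) ^ (1 / 6 : ℝ) with hρ
    have hρ0 : 0 ≤ ρ := by positivity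
    have hρ6 : ρ ^ 6 = epochSum N := sixthRoot_pow _
    have hρG : ρ ≤ G := (pow_le_pow_iff_left₀ hρ0 hG h6).1 (hρ6.le.trans hN1.le)
    have hρr : ρ ≤ r := by
      refine (pow_le_pow_iff_left₀ hρ0 hr0 h6).1 ?_
      rw [hρ6, hr6]
      exact_mod_cast hTs.le
    have hs := epochSum_add_two N
    have hGr : G ≤ 9 / 8 * r := by
      refine (pow_le_pow_iff_left₀ hG (by positivity) h6).1 ?_
      rw [mul_pow, hr6]
      have h2 := epochSum_add_two (N + 1)
      rw [pow_succ] at h2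
      have h3 : (epochSum (N + 1) : ℝ) ≤ 2 * ((epochSum N + u + 1 : ℕ) : ℝ) := by
        exact_mod_cast (show epochSum (N + 1) ≤ 2 * (epochSum N + u + 1) by omega)
      have h4 : (0 : ℝ) ≤ ((epochSum N + u + 1 : ℕ) : ℝ) := Nat.cast_nonneg _
      refine hN2.trans (h3.trans ?_)
      gcongr
      norm_num
    have h2N : 2 ^ N ≤ epochSum N := by
      obtain ⟨k, hk⟩ := Nat.exists_eq_succ_of_ne_zero hN0
      have h2 : 2 ≤ 2 ^ N := by
        rw [hk, pow_succ]
        have := Nat.one_le_two_pow (n := k)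
        omega
      rw [pow_succ] at hs
      omega
    have hetc : expRegret P (combined d δ σ (switchTime d δ)) δ θ x ε (epochSum N) ≤
        M * (d * (14 / 5 * ρ ^ 4)) := by
      refine (h.expRegret_combined_epochSum_le h0.le hM (j := N) le_rfl
        (show 2 ^ N ≤ 2 * (epochSum N + u + 1) by omega) hE).trans ?_
      have h3 : ((2 ^ N : ℕ) : ℝ) ^ (2 / 3 : ℝ) ≤ ρ ^ 4 := by
        rw [← rpow_two_thirds_eq]
        exact Real.rpow_le_rpow (Nat.cast_nonneg _) (by exact_mod_cast h2N) (by norm_num)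
      gcongr
      linarith
    have hols : expRegret P (saOLS d δ) δ θ x ε (u + 1) ≤ M * (d * (G * r ^ 3)) := by
      refine (hO (u + 1) (by omega) (by omega)).trans ?_
      rw [rateOLS_eq]
      gcongr
      rw [hr]
      refine Real.rpow_le_rpow (Nat.cast_nonneg _) ?_ (by norm_num)
      exact_mod_cast (show u + 1 ≤ epochSum N + u + 1 by omega)
    refine (add_le_add hetc hols).trans ?_
    rw [← mul_add, ← mul_add, mul_left_comm 4, mul_left_comm 4]
    gcongr
    have hr3 : 0 ≤ r ^ 3 := by positivity
    have h5 : ρ ^ 4 ≤ G * r ^ 3 := by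
      calc ρ ^ 4 = ρ * ρ ^ 3 := by ring
        _ ≤ G * r ^ 3 := by gcongr
    have h6 : ρ ^ 4 ≤ r ^ 4 := by gcongr
    have h7 : G * r ^ 3 ≤ 9 / 8 * r ^ 4 := by
      calc G * r ^ 3 ≤ 9 / 8 * r * r ^ 3 := by gcongr
        _ = 9 / 8 * r ^ 4 := by ring
    rcases min_choice (G * r ^ 3) (r ^ 4) with h8 | h8 <;> rw [h8]
    · linarith [mul_nonneg hG hr3]
    · linarith [pow_nonneg hr0 4]

/-- The constant in the rate of strategy-aware OLS. -/
def olsConst (c₀ : ℝ) (σ : NNReal) (B : ℝ) : ℝ := B + 2 * √(8192 * rewardScale σ B / c₀)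

/-- The constant in the rate of explore-then-commit. -/
def etcConst (c₀ : ℝ) (σ : NNReal) (B : ℝ) : ℝ := B * (32 * (σ : ℝ) ^ (2 / 3 : ℝ) + 1) +
  2 * √(16 * rewardScale σ B / (c₀ * (σ : ℝ) ^ (2 / 3 : ℝ)))

theorem IsStochasticEnv.rates [IsProbabilityMeasure P] (h : IsStochasticEnv P c₀ σ x ε)
    (hc : 0 < c₀) (hσ : 0 < σ) (hd : 2 ≤ d) (h0 : 0 < δ) (h1 : δ < 1) {B : ℝ} (hB : ‖θ‖ ≤ B) {T : ℕ}
    (hT : 1 ≤ T) {K : ℝ} (hK : olsConst c₀ σ B + etcConst c₀ σ B ≤ K) :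
    expRegret P (saOLS d δ) δ θ x ε T ≤ K * (1 + Real.log (d * T)) * rateOLS d δ T ∧
      expRegret P (etcRun d δ σ T) δ θ x ε T ≤ K * (1 + Real.log (d * T)) * rateETC d T := by
  have hB0 : 0 ≤ B := (norm_nonneg θ).trans hB
  have hL := one_le_one_add_log (show 1 ≤ d by omega) hT
  have hR1 := rateOLS_nonneg (d := d) h1 T
  have hR2 := rateETC_nonneg (d := d) T
  have h2 : 0 ≤ olsConst c₀ σ B := by unfold olsConst; positivity
  have h3 : 0 ≤ etcConst c₀ σ B := by unfold etcConst; positivity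
  have ho : expRegret P (saOLS d δ) δ θ x ε T ≤ olsConst c₀ σ B * _ :=
    h.expRegret_saOLS_le hc hd h0 h1 hB hT
  have he : expRegret P (etcRun d δ σ T) δ θ x ε T ≤ etcConst c₀ σ B * _ :=
    h.expRegret_etcRun_le hc hσ hd h0 hB hT
  rw [mul_assoc, mul_assoc]
  constructor
  · exact ho.trans (mul_le_mul_of_nonneg_right (by linarith) (by positivity))
  · exact he.trans (mul_le_mul_of_nonneg_right (by linarith) (by positivity))

end Switch

end

theorem theorem3p2 :
    ∃ g : ℕ → ℝ → ℝ,
      -- With switching time `g d δ`, the combined algorithm is within a factor `4` of the better of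
      -- the guarantees of its two subroutines.
      (∀ (c₀ : ℝ) (σ : NNReal) (d : ℕ) (δ : ℝ) (θ : Ctx d),
        0 < c₀ → 0 < σ → 2 ≤ d → 0 < δ → δ < 1 →
        ∀ (Ω : Type*) [MeasurableSpace Ω] (P : Measure Ω) [IsProbabilityMeasure P]
          (x : ℕ → Ω → Ctx d) (ε : ℕ → Ω → ℝ), IsStochasticEnv P c₀ σ x ε →
        ∀ (T : ℕ) (M : ℝ), 1 ≤ T →
          (∀ t : ℕ, 1 ≤ t → t ≤ 2 * T →
            expRegret P (saOLS d δ) δ θ x ε t ≤ M * rateOLS d δ t ∧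
            expRegret P (etcRun d δ σ t) δ θ x ε t ≤ M * rateETC d t) →
          expRegret P (combined d δ σ (g d δ)) δ θ x ε T
            ≤ 4 * min (M * rateOLS d δ T) (M * rateETC d T)) ∧
      -- The guarantees themselves, with constants that depend only on `c₀`, `σ` and the bound `B`.
      (∀ (c₀ : ℝ) (σ : NNReal) (B : ℝ), 0 < c₀ → 0 < σ →
        ∃ (C : ℝ) (k : ℕ), ∀ (d : ℕ) (δ : ℝ) (θ : Ctx d),
          2 ≤ d → 0 < δ → δ < 1 → ‖θ‖ ≤ B →
          ∀ (Ω : Type*) [MeasurableSpace Ω] (P : Measure Ω) [IsProbabilityMeasure P]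
            (x : ℕ → Ω → Ctx d) (ε : ℕ → Ω → ℝ), IsStochasticEnv P c₀ σ x ε →
          ∀ T : ℕ, 1 ≤ T →
            (∀ alg ∈ [saOLS d δ, etcRun d δ σ T, combined d δ σ (g d δ)],
              Integrable
                (fun ω => stratRegret alg δ θ (fun t => x t ω) (fun t => ε t ω) T) P) ∧
            expRegret P (saOLS d δ) δ θ x ε T
              ≤ C * (1 + Real.log (d * T)) ^ k * rateOLS d δ T ∧
            expRegret P (etcRun d δ σ T) δ θ x ε T
              ≤ C * (1 + Real.log (d * T)) ^ k * rateETC d T ∧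
            expRegret P (combined d δ σ (g d δ)) δ θ x ε T
              ≤ C * (1 + Real.log (d * T)) ^ k * min (rateOLS d δ T) (rateETC d T)) := by
  refine ⟨switchTime, ?_, ?_⟩
  · intro c₀ σ d δ θ _ _ hd h0 h1 Ω _ P _ x ε h T M hT hle
    exact h.expRegret_combined_le hd h0 h1 hT (fun t ht ht' => (hle t ht ht').1)
      fun t ht ht' => (hle t ht ht').2
  · intro c₀ σ B hc hσ
    refine ⟨8 * (olsConst c₀ σ B + etcConst c₀ σ B), 1, ?_⟩
    intro d δ θ hd h0 h1 hB Ω _ P _ x ε h T hT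
    have hB0 : 0 ≤ B := (norm_nonneg θ).trans hB
    have hK : 0 ≤ olsConst c₀ σ B + etcConst c₀ σ B := by
      unfold olsConst etcConst
      positivity
    obtain ⟨hols, hetc⟩ := h.rates hc hσ hd h0 h1 hB hT
      (show _ ≤ 8 * (olsConst c₀ σ B + etcConst c₀ σ B) by linarith)
    rw [pow_one]
    refine ⟨?_, hols, hetc, ?_⟩
    · intro alg halg
      simp only [List.mem_cons, List.not_mem_nil, or_false] at halg
      rcases halg with rfl | rfl | rfl
      · exact ((isLeastSquaresAlgo_saOLS h0.le).integrable_and_expRegret_eq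
          (measurableIncl_saIncl δ) h T).1
      · exact ((isLeastSquaresAlgo_etc h0.le _ _ _).integrable_and_expRegret_eq
          (measurableIncl_etcIncl _) h T).1
      · exact (h.integrable_combined_and_expRegret_eq h0.le _ T).1
    · -- Up to the horizon `2 T`, the logarithms at most double.
      set K := olsConst c₀ σ B + etcConst c₀ σ B with hKdef
      have hL := one_le_one_add_log (show 1 ≤ d by omega) hT
      have hd' : (2 : ℝ) ≤ d := by exact_mod_cast hd
      have hT' : (1 : ℝ) ≤ T := by exact_mod_cast hT
      have hlog : ∀ t : ℕ, 1 ≤ t → t ≤ 2 * T →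
          K * (1 + Real.log (d * t)) ≤ K * (2 * (1 + Real.log (d * T))) := by
        intro t ht htT
        have ht' : (1 : ℝ) ≤ t := by exact_mod_cast ht
        have htT' : (t : ℝ) ≤ 2 * T := by exact_mod_cast htT
        have h2 : (d : ℝ) * t ≤ 2 * (d * T) := by nlinarith
        have h3 := Real.log_le_log (by positivity) h2
        rw [Real.log_mul two_ne_zero (by positivity)] at h3
        have := Real.log_two_lt_d9
        gcongr
        linarith
      have hmain := h.expRegret_combined_le (θ := θ) (M := K * (2 * (1 + Real.log (d * T)))) hd h0
        h1 hT
        (fun t ht htT => (h.rates hc hσ hd h0 h1 hB ht le_rfl).1.trans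
          (mul_le_mul_of_nonneg_right (hlog t ht htT) (rateOLS_nonneg h1 t)))
        fun t ht htT => (h.rates hc hσ hd h0 h1 hB ht le_rfl).2.trans
          (mul_le_mul_of_nonneg_right (hlog t ht htT) (rateETC_nonneg t))
      rw [← mul_min_of_nonneg _ _ (by positivity)] at hmain
      refine hmain.trans (le_of_eq ?_)
      ring
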